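/- **Setting.** Let $d_x\ge 0$, $d_y\ge 1$, and $f,g:\mathbb R^{d_x}\times\mathbb R^{d_y}\to\mathbb R$. Assume, with Euclidean and spectral (operator) norms in $(x,y)$: $g$ is three times differentiable and $g(x,\cdot)$ is $\mu$-strongly convex for every $x$ ($\mu>0$); $f$ is twice differentiable and $C$-Lipschitz; $\nabla f,\nabla g$ are $\ell$-Lipschitz; $\nabla^2 f,\nabla^2 g$ are $\rho$-Lipschitz; $\nabla^3 g$ is $\nu$-Lipschitz; and $\varphi$ is bounded below, where $\varphi(x)=f(x,y^*(x))$, $y^*(x)=\arg\min_y g(x,y)$. Put $\bar\ell=\max\{C,\ell,\nu,\rho\}$, $\kappa=\bar\ell/\mu$, $\Delta=\varphi(x_0)-\inf\varphi$ (assume $\Delta>0$), $d=\max\{d_x,d_y\}$, and for $\lambda>0$ $$\mathcal L_\lambda(x,y)=f(x,y)+\lambda\bigl(g(x,y)-g(x,y^*(x))\bigr),\quad y^*_\lambda(x)=\arg\min_y\mathcal L_\lambda(x,y),\quad \mathcal L^*_\lambda(x)=\mathcal L_\lambda(x,y^*_\lambda(x)).$$ A point $\hat x$ is an $(\epsilon,\tau)$-SOSP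 of $\varphi$ if $\varphi$ is $C^2$ near $\hat x$, $\|\nabla\varphi(\hat x)\|\le\epsilon$ and $\lambda_{\min}(\nabla^2\varphi(\hat x))\ge-\tau$. **Algorithm (LFSBA).** $\mathrm{AGD}(h,z_0,K,\eta,\theta)$ sets $\tilde z_0=z_0$, performs $z_{k+1}=\tilde z_k-\eta\nabla h(\tilde z_k)$, $\tilde z_{k+1}=z_{k+1}+\theta(z_{k+1}-z_k)$ for $k<K$, and returns $z_K$. With $\theta(\kappa')=(\sqrt{\kappa'}-1)/(\sqrt{\kappa'}+1)$, start from $x_0$ and $y_{-1}=w_{-1}=0$; for $t=0,\dots,T-1$: 1. $w_t=\mathrm{AGD}(g(x_t,\cdot),w_{t-1},K_t,1/\ell,\theta(\kappa))$ and $y_t=\mathrm{AGD}(\mathcal L_\lambda(x_t,\cdot),y_{t-1},K_t,1/((1+\lambda)\ell),\theta(3\kappa))$; 2. $g_t=\nabla_xf(x_t,y_t)+\lambda(\nabla_xg(x_t,y_t)-\nabla_xg(x_t,w_t))$; 3. if $m\mid t$, set $\tilde x=x_t$ and $\tilde H=\nabla^2_{xx}f(x_t,y_t)+\lambda(\nabla^2_{xx}g(x_t,y_t)-\nabla^2_{xx}g(x_t,w_t))-\nabla^2_{xy}\mathcal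 L_\lambda(x_t,y_t)[\nabla^2_{yy}\mathcal L_\lambda(x_t,y_t)]^{-1}\nabla^2_{yx}\mathcal L_\lambda(x_t,y_t)+\lambda\nabla^2_{xy}g(x_t,w_t)[\nabla^2_{yy}g(x_t,w_t)]^{-1}\nabla^2_{yx}g(x_t,w_t)$; 4. let $s_t$ be any global minimizer of $s\mapsto g_t^\top s+\frac12s^\top\tilde Hs+\frac M6\|s\|^3$, and put $x_{t+1}=x_t+s_t$; 5. stop if $\epsilon\ge\frac1M\bigl(\frac{288}{287}\bigr)^2\bigl(\frac{M+2\bar\rho}{\sqrt2}\|s_t\|+\bar\rho\|\tilde x-x_t\|\bigr)^2$. The output $\hat x$ is the last iterate computed. Every evaluation of $\nabla_x$ or $\nabla_y$ of $f$ or $g$ is one first-order oracle call; every evaluation of a block $\nabla^2_{xx},\nabla^2_{xy},\nabla^2_{yy}$ of $f$ or $g$ is one second-order oracle call. **Theorem.** There is an absolute constant $c>0$, and for every $B$ a constant $A>0$ depending only on $B$, such that the following holds for all data as above, all integers $m\ge1$ and all $\epsilon>0$. Let $$c\,\bar\ell\kappa^5\le\bar\rho\le B\,\bar\ell\kappa^5,\qquad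 c\,m\bar\rho\le M\le B\,m\bar\rho,\qquad c\,\Delta\sqrt M\epsilon^{-3/2}\le T\le B\,\Delta\sqrt M\epsilon^{-3/2}\quad(T\in\mathbb N),$$ $$\lambda=\max\Bigl\{\frac{\bar\ell\kappa^2}{\Delta},\frac{\bar\ell\kappa^3}{\epsilon},\frac{\bar\ell\kappa^5}{\sqrt{M\epsilon}}\Bigr\},\qquad\text{and assume }\lambda\ge\frac{2\ell}{\mu}.$$ Let $C_2>0$ with $\rho+\lambda\rho+(\ell+\lambda\ell)\Bigl(\frac{4(\rho+\lambda\rho)}{\lambda\mu}+\frac{4(\rho+\lambda\rho)(\ell+\lambda\ell)}{\lambda^2\mu^2}\Bigr)\le C_2\le B\lambda\bar\ell\kappa^2$, let $\tilde\epsilon=\min\bigl\{\frac{\epsilon}{576\cdot4\lambda\bar\ell},\frac{\sqrt{M\epsilon}}{288\cdot2C_2}\bigr\}$, $R=\max\{\|y^*(x_0)\|,\|y^*_\lambda(x_0)\|\}$, and $$K_0=\Bigl\lceil2\sqrt{3\kappa}\,\log\Bigl(\tfrac{\sqrt{3\kappa+1}}{\tilde\epsilon}R\Bigr)\Bigr\rceil,\qquad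 K_t=\Bigl\lceil2\sqrt{3\kappa}\,\log\Bigl(\tfrac{\sqrt{3\kappa+1}}{\tilde\epsilon}\bigl(\tilde\epsilon+4\kappa\|s_{t-1}\|\bigr)\Bigr)\Bigr\rceil\quad(t\ge1),$$ read as $0$ where negative (or where $R=0$). Then $\mathcal L^*_\lambda$ is $C^2$ and its Hessian is $\bar\rho$-Lipschitz, and with $\Lambda=\log\bigl(2+\kappa+\bar\ell+\frac1{\bar\ell}+\Delta+\frac1\Delta+\frac1\epsilon+R\bigr)$ every run of LFSBA satisfies: * the output $\hat x$ is an $\bigl(A\epsilon,\;A\,\kappa^{2.5}\bar\ell^{0.5}m^{0.5}\epsilon^{0.5}\bigr)$-SOSP of $\varphi$; * the number of first-order oracle calls is at most $A\,\Delta\,\kappa^3\bar\ell^{0.5}m^{0.5}\epsilon^{-1.5}\Lambda$; * the number of second-order oracle calls is at most $A\,(1+\Delta\,\kappa^{2.5}\bar\ell^{0.5}m^{-0.5}\epsilon^{-1.5})$; * if a first-order call costs $N\ge 0$, a second-order call costs $dN$, and $m\le B(1+d/\sqrt\kappa)$, $1+d/\sqrt\kappa\le Bm$, then the total cost is at most $$A\Bigl(Nd+N\bigl(\kappa^{0.5}+\kappa^{0.25}d^{0.5}\bigr)\Delta\,\kappa^{2.5}\bar\ell^{0.5}\epsilon^{-1.5}\Lambda\Bigr),$$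 and also at most $A\bigl(Nd+\frac{\kappa^{0.25}}{d^{0.5}}\,N(\kappa^{0.5}+d)\,\Delta\,\kappa^{2.5}\bar\ell^{0.5}\epsilon^{-1.5}\Lambda\bigr)$, i.e. apart from the term $Nd$ it gains a factor $d^{0.5}/\kappa^{0.25}$ over $N(\kappa^{0.5}+d)\,\Delta\,\kappa^{2.5}\bar\ell^{0.5}\epsilon^{-1.5}\Lambda$, the cost bound of the non-lazy method FSBA. -/

import Mathlib

open Set

noncomputable section

/-! ### Calculus on Euclidean spaces -/

/-- `ℝⁿ` with the Euclidean norm. -/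
abbrev Vec (n : ℕ) : Type := EuclideanSpace ℝ (Fin n)

/-- The Hessian of `h` at `p`, as a linear operator. Its operator norm is the spectral norm. -/
def hess {E : Type} [NormedAddCommGroup E] [InnerProductSpace ℝ E] [CompleteSpace E]
    (h : E → ℝ) (p : E) : E →L[ℝ] E :=
  fderiv ℝ (gradient h) p

/-- A function of two vector variables as a function on the Euclidean space `ℝ^{dx+dy}`. -/
def joint {dx dy : ℕ} (h : Vec dx → Vec dy → ℝ) : WithLp 2 (Vec dx × Vec dy) → ℝ :=
  fun p => h p.fst p.snd

/-- Partial gradient `∇ₓ h(x, y)`. -/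
def gradX {dx dy : ℕ} (h : Vec dx → Vec dy → ℝ) (x : Vec dx) (y : Vec dy) : Vec dx :=
  gradient (fun x' => h x' y) x

/-- Partial gradient `∇_y h(x, y)`. -/
def gradY {dx dy : ℕ} (h : Vec dx → Vec dy → ℝ) (x : Vec dx) (y : Vec dy) : Vec dy :=
  gradient (fun y' => h x y') y

/-- Hessian block `∇²ₓₓ h(x, y)`. -/
def hessXX {dx dy : ℕ} (h : Vec dx → Vec dy → ℝ) (x : Vec dx) (y : Vec dy) :
    Vec dx →L[ℝ] Vec dx :=
  fderiv ℝ (fun x' => gradX h x' y) x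

/-- Hessian block `∇²ₓᵧ h(x, y)`, a `dx × dy` matrix. Its transpose is `∇²ᵧₓ h(x, y)`. -/
def hessXY {dx dy : ℕ} (h : Vec dx → Vec dy → ℝ) (x : Vec dx) (y : Vec dy) :
    Vec dy →L[ℝ] Vec dx :=
  fderiv ℝ (fun y' => gradX h x y') y

/-- Hessian block `∇²ᵧᵧ h(x, y)`. -/
def hessYY {dx dy : ℕ} (h : Vec dx → Vec dy → ℝ) (x : Vec dx) (y : Vec dy) :
    Vec dy →L[ℝ] Vec dy :=
  fderiv ℝ (fun y' => gradY h x y') y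

/-- A global minimizer of `h` (an arbitrary point if there is none). -/
def argmin {E : Type} [Nonempty E] (h : E → ℝ) : E :=
  Classical.epsilon fun z => ∀ z', h z ≤ h z'

/-- `p` is an `(ε, τ)`-second-order stationary point of `h`: near `p` the function is twice
continuously differentiable, the gradient at `p` has norm at most `ε`, and the smallest
eigenvalue of the (symmetric) Hessian at `p` is at least `-τ`, that is, `∇²h(p) ≽ -τ I`. -/
def IsSOSP {E : Type} [NormedAddCommGroup E] [InnerProductSpace ℝ E] [CompleteSpace E]
    (h : E → ℝ) (ε τ : ℝ) (p : E) : Prop :=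
  ContDiffAt ℝ 2 h p ∧ ‖gradient h p‖ ≤ ε ∧
    ∀ v : E, -τ * ‖v‖ ^ 2 ≤ inner ℝ v (hess h p v)

/-! ### The bilevel problem -/

/-- The lower-level solution `y*(x)`. -/
def yStar {dx dy : ℕ} (g : Vec dx → Vec dy → ℝ) (x : Vec dx) : Vec dy :=
  argmin (g x)

/-- The hyper-objective `φ(x) = f(x, y*(x))`. -/
def hyperObj {dx dy : ℕ} (f g : Vec dx → Vec dy → ℝ) (x : Vec dx) : ℝ :=
  f x (yStar g x)

/-- The penalized function `L_λ(x, y) = f(x, y) + λ (g(x, y) - g(x, y*(x)))`. -/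
def penalty {dx dy : ℕ} (f g : Vec dx → Vec dy → ℝ) (lam : ℝ) (x : Vec dx) (y : Vec dy) : ℝ :=
  f x y + lam * (g x y - g x (yStar g x))

/-- `y*_λ(x)`, the minimizer of `L_λ(x, ·)`. -/
def yStarPen {dx dy : ℕ} (f g : Vec dx → Vec dy → ℝ) (lam : ℝ) (x : Vec dx) : Vec dy :=
  argmin (penalty f g lam x)

/-- The proxy `L*_λ(x) = L_λ(x, y*_λ(x))`. -/
def penaltyStar {dx dy : ℕ} (f g : Vec dx → Vec dy → ℝ) (lam : ℝ) (x : Vec dx) : ℝ :=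
  penalty f g lam x (yStarPen f g lam x)

/-- The standing assumptions on the upper-level function `f` and the lower-level function `g`.
Since the top derivatives are required to be Lipschitz, "`k` times differentiable" and
"`k` times continuously differentiable" are the same here. -/
structure BilevelAssumption {dx dy : ℕ} (f g : Vec dx → Vec dy → ℝ) (C ell rho nu mu : ℝ) :
    Prop where
  mu_pos : 0 < mu
  g_smooth : ContDiff ℝ 3 (joint g)
  g_strong : ∀ x, StrongConvexOn univ mu (g x)
  f_smooth : ContDiff ℝ 2 (joint f)
  f_lip : ∀ p q, ‖joint f p - joint f q‖ ≤ C * ‖p - q‖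
  f_grad_lip : ∀ p q, ‖gradient (joint f) p - gradient (joint f) q‖ ≤ ell * ‖p - q‖
  g_grad_lip : ∀ p q, ‖gradient (joint g) p - gradient (joint g) q‖ ≤ ell * ‖p - q‖
  f_hess_lip : ∀ p q, ‖hess (joint f) p - hess (joint f) q‖ ≤ rho * ‖p - q‖
  g_hess_lip : ∀ p q, ‖hess (joint g) p - hess (joint g) q‖ ≤ rho * ‖p - q‖
  g_third_lip : ∀ p q,
    ‖fderiv ℝ (hess (joint g)) p - fderiv ℝ (hess (joint g)) q‖ ≤ nu * ‖p - q‖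
  bdd_below : BddBelow (range (hyperObj f g))

/-- The largest smoothness constant `ℓ̄ = max {C, ℓ, ν, ρ}`. -/
def ellBar (C ell rho nu : ℝ) : ℝ := max (max C ell) (max nu rho)

/-- The gap `Δ = φ(x₀) - inf φ`. -/
def gap {dx dy : ℕ} (f g : Vec dx → Vec dy → ℝ) (x₀ : Vec dx) : ℝ :=
  hyperObj f g x₀ - ⨅ x, hyperObj f g x

/-- `R = max {‖y*(x₀)‖, ‖y*_λ(x₀)‖}`. -/
def initRadius {dx dy : ℕ} (f g : Vec dx → Vec dy → ℝ) (lam : ℝ) (x₀ : Vec dx) : ℝ :=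
  max ‖yStar g x₀‖ ‖yStarPen f g lam x₀‖

/-! ### Computations that count their oracle calls -/

/-- A value together with the numbers of first- and second-order oracle calls spent on it. -/
structure Counted (α : Type) where
  val : α
  first : ℕ
  second : ℕ

instance : Monad Counted where
  pure a := ⟨a, 0, 0⟩
  bind c k := ⟨(k c.val).val, c.first + (k c.val).first, c.second + (k c.val).second⟩

/-- One call of a first-order oracle (`∇ₓ` or `∇_y` of `f` or `g` at one point). -/
def call₁ {α : Type} (a : α) : Counted α := ⟨a, 1, 0⟩

/-- One call of a second-order oracle (a Hessian block of `f` or `g` at one point). -/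
def call₂ {α : Type} (a : α) : Counted α := ⟨a, 0, 1⟩

/-- `K` rounds of accelerated gradient descent from the pair `(z_k, z̃_k)`. -/
def agdLoop {E : Type} [NormedAddCommGroup E] [NormedSpace ℝ E] (grad : E → Counted E)
    (η θ : ℝ) : ℕ → E → E → Counted E
  | 0, z, _ => pure z
  | K + 1, z, zt => do
    let d ← grad zt
    let z' := zt - η • d
    agdLoop grad η θ K z' (z' + θ • (z' - z))

/-- Accelerated gradient descent `AGD(h, z₀, K, η, θ)`, given the oracle for `∇h`. -/
def agd {E : Type} [NormedAddCommGroup E] [NormedSpace ℝ E] (grad : E → Counted E)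
    (z₀ : E) (K : ℕ) (η θ : ℝ) : Counted E :=
  agdLoop grad η θ K z₀ z₀

/-- The gradient of `g(x, ·)` at `y`, by one oracle call. -/
def gradLower {dx dy : ℕ} (g : Vec dx → Vec dy → ℝ) (x : Vec dx) (y : Vec dy) :
    Counted (Vec dy) :=
  call₁ (gradY g x y)

/-- The gradient of `L_λ(x, ·)` at `y`, by two oracle calls. -/
def gradPenalty {dx dy : ℕ} (f g : Vec dx → Vec dy → ℝ) (lam : ℝ) (x : Vec dx) (y : Vec dy) :
    Counted (Vec dy) := do
  let a ← call₁ (gradY f x y)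
  let b ← call₁ (gradY g x y)
  return a + lam • b

/-- The gradient estimator
`g(x; y, w) = ∇ₓf(x, y) + λ (∇ₓg(x, y) - ∇ₓg(x, w))`. -/
def gradEst {dx dy : ℕ} (f g : Vec dx → Vec dy → ℝ) (lam : ℝ) (x : Vec dx) (y w : Vec dy) :
    Counted (Vec dx) := do
  let a ← call₁ (gradX f x y)
  let b ← call₁ (gradX g x y)
  let c ← call₁ (gradX g x w)
  return a + lam • (b - c)

/-- The Hessian estimator
`H(x; y, w) = ∇²ₓₓf(x, y) + λ (∇²ₓₓg(x, y) - ∇²ₓₓg(x, w))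
  - ∇²ₓᵧL_λ(x, y) [∇²ᵧᵧL_λ(x, y)]⁻¹ ∇²ᵧₓL_λ(x, y) + λ ∇²ₓᵧg(x, w) [∇²ᵧᵧg(x, w)]⁻¹ ∇²ᵧₓg(x, w)`. -/
def hessEst {dx dy : ℕ} (f g : Vec dx → Vec dy → ℝ) (lam : ℝ) (x : Vec dx) (y w : Vec dy) :
    Counted (Vec dx →L[ℝ] Vec dx) := do
  let fxx ← call₂ (hessXX f x y)
  let gxx ← call₂ (hessXX g x y)
  let gxx' ← call₂ (hessXX g x w)
  let fxy ← call₂ (hessXY f x y)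
  let gxy ← call₂ (hessXY g x y)
  let fyy ← call₂ (hessYY f x y)
  let gyy ← call₂ (hessYY g x y)
  let gxy' ← call₂ (hessXY g x w)
  let gyy' ← call₂ (hessYY g x w)
  let Lxy := fxy + lam • gxy
  let Lyy := fyy + lam • gyy
  return fxx + lam • (gxx - gxx')
    - Lxy ∘L Lyy.inverse ∘L ContinuousLinearMap.adjoint Lxy
    + lam • (gxy' ∘L gyy'.inverse ∘L ContinuousLinearMap.adjoint gxy')

/-! ### The lazy fully second-order bilevel approximation method (LFSBA) -/

/-- The inputs of LFSBA. The AGD lengths `K1 t s`, `K2 t s` may depend on the previous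
step `s = s_{t-1}` (which is `0` for `t = 0`). -/
structure LFSBAInput (dx : ℕ) where
  x₀ : Vec dx
  ell1 : ℝ
  ell2 : ℝ
  kappa1 : ℝ
  kappa2 : ℝ
  lam : ℝ
  rhoBar : ℝ
  m : ℕ
  ε : ℝ
  M : ℝ
  T : ℕ
  K1 : ℕ → Vec dx → ℕ
  K2 : ℕ → Vec dx → ℕ

/-- The memory of LFSBA at the start of iteration `t`: the iterate `x_t`, the auxiliary
variables `y_{t-1}`, `w_{t-1}`, the last step `s_{t-1}`, the snapshot point `x̃` and the
Hessian estimate `H̃` taken there. -/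
structure LFSBAState (dx dy : ℕ) where
  x : Vec dx
  y : Vec dy
  w : Vec dy
  s : Vec dx
  snap : Vec dx
  H : Vec dx →L[ℝ] Vec dx

/-- The momentum parameter `(√κ - 1) / (√κ + 1)`. -/
def momentum (kappa : ℝ) : ℝ := (√kappa - 1) / (√kappa + 1)

/-- The part of iteration `t` that calls oracles: it updates `w`, `y` by AGD, computes the
gradient estimate `g_t`, and refreshes the snapshot and the Hessian estimate if `m ∣ t`. -/
def lfsbaOracles {dx dy : ℕ} (f g : Vec dx → Vec dy → ℝ) (I : LFSBAInput dx) (t : ℕ)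
    (σ : LFSBAState dx dy) : Counted (Vec dx × LFSBAState dx dy) := do
  let w ← agd (gradLower g σ.x) σ.w (I.K1 t σ.s) (1 / I.ell1) (momentum I.kappa1)
  let y ← agd (gradPenalty f g I.lam σ.x) σ.y (I.K2 t σ.s) (1 / I.ell2) (momentum I.kappa2)
  let gt ← gradEst f g I.lam σ.x y w
  if t % I.m = 0 then
    let H ← hessEst f g I.lam σ.x y w
    return (gt, { σ with w := w, y := y, snap := σ.x, H := H })
  else
    return (gt, { σ with w := w, y := y })

/-- The cubic model `⟨g, s⟩ + ⟨s, H s⟩ / 2 + M ‖s‖³ / 6`. -/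
def cubicModel {dx : ℕ} (gt : Vec dx) (H : Vec dx →L[ℝ] Vec dx) (M : ℝ) (s : Vec dx) : ℝ :=
  inner ℝ gt s + 1 / 2 * inner ℝ s (H s) + M / 6 * ‖s‖ ^ 3

/-- The stopping test, for the step `s`, the snapshot point `snap` and the iterate `x`. -/
def lfsbaStop {dx : ℕ} (I : LFSBAInput dx) (s snap x : Vec dx) : Prop :=
  1 / I.M * (288 / 287) ^ 2 *
    ((I.M + 2 * I.rhoBar) / √2 * ‖s‖ + I.rhoBar * ‖snap - x‖) ^ 2 ≤ I.ε

/-- A complete run of LFSBA. The cubic subproblem may have several global minimizers and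
the run may use any of them. The loop is left after an iteration that passes the stopping
test, or after `T` iterations. -/
structure LFSBARun {dx dy : ℕ} (f g : Vec dx → Vec dy → ℝ) (I : LFSBAInput dx) where
  /-- number of executed iterations -/
  iters : ℕ
  /-- memory at the start of iteration `t` -/
  state : ℕ → LFSBAState dx dy
  init : state 0 = ⟨I.x₀, 0, 0, 0, I.x₀, 0⟩
  /-- `s_t`, stored in `state (t + 1)`, minimizes the cubic model -/
  minimizes : ∀ t < iters, ∀ v : Vec dx,
    cubicModel (lfsbaOracles f g I t (state t)).val.1
        (lfsbaOracles f g I t (state t)).val.2.H I.M (state (t + 1)).s ≤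
      cubicModel (lfsbaOracles f g I t (state t)).val.1
        (lfsbaOracles f g I t (state t)).val.2.H I.M v
  update : ∀ t < iters, state (t + 1) =
    { (lfsbaOracles f g I t (state t)).val.2 with
      s := (state (t + 1)).s
      x := (state t).x + (state (t + 1)).s }
  le_T : iters ≤ I.T
  not_stopped : ∀ t, t + 1 < iters →
    ¬ lfsbaStop I (state (t + 1)).s (state (t + 1)).snap (state t).x
  finished : iters = I.T ∨ ∃ t, t + 1 = iters ∧
    lfsbaStop I (state (t + 1)).s (state (t + 1)).snap (state t).x

/-- The output of a run: the iterate after the last executed iteration. -/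
def LFSBARun.output {dx dy : ℕ} {f g : Vec dx → Vec dy → ℝ} {I : LFSBAInput dx}
    (r : LFSBARun (dy := dy) f g I) : Vec dx :=
  (r.state r.iters).x

/-- Number of first-order oracle calls of a run. -/
def LFSBARun.firstCalls {dx dy : ℕ} {f g : Vec dx → Vec dy → ℝ} {I : LFSBAInput dx}
    (r : LFSBARun (dy := dy) f g I) : ℕ :=
  ∑ t ∈ Finset.range r.iters, (lfsbaOracles f g I t (r.state t)).first

/-- Number of second-order oracle calls of a run. -/
def LFSBARun.secondCalls {dx dy : ℕ} {f g : Vec dx → Vec dy → ℝ} {I : LFSBAInput dx}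
    (r : LFSBARun (dy := dy) f g I) : ℕ :=
  ∑ t ∈ Finset.range r.iters, (lfsbaOracles f g I t (r.state t)).second

/-- Total computational cost when a first-order call costs `N` and a second-order call costs
`N · max {dx, dy}`. -/
def LFSBARun.cost {dx dy : ℕ} {f g : Vec dx → Vec dy → ℝ} {I : LFSBAInput dx}
    (r : LFSBARun (dy := dy) f g I) (N : ℝ) : ℝ :=
  N * r.firstCalls + N * (max dx dy : ℕ) * r.secondCalls

/-! ### Parameter choices -/

/-- The factor in front of `‖y - y*_λ(x)‖` in the bound for `‖∇²L*_λ(x) - H(x; y, w)‖`. -/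
def hessErrFactor (ell rho mu lam : ℝ) : ℝ :=
  rho + lam * rho + (ell + lam * ell) *
    (4 * (rho + lam * rho) / (lam * mu)
      + 4 * (rho + lam * rho) * (ell + lam * ell) / (lam ^ 2 * mu ^ 2))

/-- `λ = max {ℓ̄ κ² / Δ, ℓ̄ κ³ / ε, ℓ̄ κ⁵ / √(M ε)}`. -/
def penaltyParam (lbar kappa Δ ε M : ℝ) : ℝ :=
  max (lbar * kappa ^ 2 / Δ) (max (lbar * kappa ^ 3 / ε) (lbar * kappa ^ 5 / √(M * ε)))

/-- `ε̃ = min {C_g ε / (4 λ ℓ̄), C_H √(M ε) / (2 C₂)}` with `C_g = 1/576`, `C_H = 1/288`. -/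
def innerTol (lbar lam ε M C₂ : ℝ) : ℝ :=
  min ((1 / 576) * ε / (4 * lam * lbar)) ((1 / 288) * √(M * ε) / (2 * C₂))

/-- The AGD lengths: `⌈2√κ₂ log(√(κ₂+1) R / ε̃)⌉` for `t = 0` and
`⌈2√κ₂ log(√(κ₂+1) (ε̃ + 4κ‖s_{t-1}‖) / ε̃)⌉` for `t ≥ 1` (and `0` where this is negative). -/
def innerLength {dx : ℕ} (kappa kappa2 tol R : ℝ) (t : ℕ) (s : Vec dx) : ℕ :=
  if t = 0 then ⌈2 * √kappa2 * Real.log (√(kappa2 + 1) / tol * R)⌉₊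
  else ⌈2 * √kappa2 * Real.log (√(kappa2 + 1) / tol * (tol + 4 * kappa * ‖s‖))⌉₊

/-- The inputs with which LFSBA is run: `κ₁ = κ`, `ℓ₁ = ℓ`, `κ₂ = 3κ`, `ℓ₂ = (1 + λ)ℓ`. -/
def lfsbaInput {dx dy : ℕ} (f g : Vec dx → Vec dy → ℝ) (x₀ : Vec dx)
    (ell lbar kappa lam rhoBar : ℝ) (m : ℕ) (ε M C₂ : ℝ) (T : ℕ) : LFSBAInput dx where
  x₀ := x₀
  ell1 := ell
  ell2 := (1 + lam) * ell
  kappa1 := kappa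
  kappa2 := 3 * kappa
  lam := lam
  rhoBar := rhoBar
  m := m
  ε := ε
  M := M
  T := T
  K1 := innerLength kappa (3 * kappa) (innerTol lbar lam ε M C₂) (initRadius f g lam x₀)
  K2 := innerLength kappa (3 * kappa) (innerTol lbar lam ε M C₂) (initRadius f g lam x₀)

/-- The logarithmic factor hidden by the `Õ` notation: the logarithm of the sum of the
problem parameters. -/
def logFactor (lbar kappa Δ ε R : ℝ) : ℝ :=
  Real.log (2 + kappa + lbar + 1 / lbar + Δ + 1 / Δ + 1 / ε + R)

end

set_option linter.unusedSectionVars false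

/-! LFSBA is cubic-regularized Newton with a lazily refreshed Hessian, run on the proxy
`penaltyStar` instead of the hyper-objective. Three facts carry the theorem, and a balance of costs
gives the last bounds.

The proxy is smooth uniformly in `lam`, and close to the hyper-objective. Its Hessian is a
difference of two Schur complements of order `lam`, so a direct estimate would grow with `lam`. The
large parts cancel: strong convexity gives `‖yl x - y x‖ ≤ k / lam` (`solution_gap`), so the
rescaled differences `hessGap` and `derivGap` stay bounded, and `proxyHess_eq` expresses the Hessian
through bounded quantities only. Lipschitz bounds for these, which use the Lipschitz third
derivative of `G`, give `proxyHess_lip`. Taylor expansion at the lower-level solution, with the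
leading terms cancelled by stationarity, gives gradient error `O(L k³ / lam)`
(`gradient_proxy_sub_hyper`) and Hessian error `O(L k⁵ / lam)` (`hess_proxy_sub_hyper`). The choice
of `lam` makes these `O(ε)` and `O(√(M ε))`, and keeps the initial gap of the proxy below `2 * Δ`.

The inner loops are accurate. A Lyapunov function contracts along AGD (`agd_step`), and the solution
maps are Lipschitz, so a warm start is off by at most the previous error plus a multiple of the last
step. By induction all inner errors stay below the tolerance (`inner_accuracy`), and the gradient
and Hessian estimates then meet the accuracy required by the outer method (`gradEst_error`,
`hessEst_error`).

Lazy inexact cubic Newton terminates. A global minimizer of the cubic model decreases the objective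
by `M / 4 * ‖s‖ ^ 3` up to errors. While the stopping test fails, `√(M ε)` is controlled by the step
and by the drift from the snapshot; the drift is summed over blocks of length `m` and is negligible
because `M ≥ 1000 m ρ̄`. Hence the total decrease bounds both the number of failed tests and `∑ ‖s‖
^ 3` (`lazy_cubic_descent`). The budget `T` exceeds that number, so the test passes, and a passed
test certifies stationarity of the proxy (`cubic_step_stationary`), which transfers to the
hyper-objective.

For the cost, bounded steps keep the logarithms in the inner lengths of order `logFactor`, so an
iteration needs `O(√κ · logFactor)` first-order calls, and nine second-order calls once per block.
The choice `m ≈ 1 + d / √κ` balances the two. -/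

noncomputable section

/-! ### Gradients, strong monotonicity and Taylor bounds -/

section Gradient

variable {E : Type} [NormedAddCommGroup E] [InnerProductSpace ℝ E] [CompleteSpace E]

lemma contDiff_gradient {h : E → ℝ} (n : ℕ) (hh : ContDiff ℝ (n + 1) h) :
    ContDiff ℝ n (gradient h) :=
  (InnerProductSpace.toDual ℝ E).symm.contDiff.comp (hh.fderiv_right le_rfl)

lemma hasFDerivAt_gradient {h : E → ℝ} (hh : ContDiff ℝ 2 h) (p : E) :
    HasFDerivAt (gradient h) (hess h p) p :=
  ((contDiff_gradient 1 (by exact_mod_cast hh)).differentiable (by simp) p).hasFDerivAt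

lemma contDiff_of_hasGradientAt {h : E → ℝ} {G : E → E} (n : ℕ)
    (hG : ∀ p, HasGradientAt h (G p) p) (hn : ContDiff ℝ n G) : ContDiff ℝ (n + 1) h := by
  refine contDiff_succ_iff_hasFDerivAt.2 ⟨fun p => InnerProductSpace.toDual ℝ E (G p),
    (InnerProductSpace.toDual ℝ E).contDiff.comp hn, fun p => (hG p).hasFDerivAt⟩

/-- Symmetry of the second Fréchet derivative, transported through the Riesz identification. -/
lemma hess_symm {h : E → ℝ} (hh : ContDiff ℝ 2 h) (p u v : E) :
    inner ℝ (hess h p u) v = inner ℝ u (hess h p v) := by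
  have key : ∀ u v, fderiv ℝ (fderiv ℝ h) p u v = inner ℝ (hess h p u) v := by
    intro u v
    have hd : DifferentiableAt ℝ (fderiv ℝ h) p :=
      (hh.fderiv_right (m := 1) (by norm_num)).differentiable (by simp) p
    have h1 := hd.hasFDerivAt.clm_apply (hasFDerivAt_const v p)
    have h2 := (hasFDerivAt_gradient hh p).inner ℝ (hasFDerivAt_const v p)
    have e : (fun q => fderiv ℝ h q v) = fun q => inner ℝ (gradient h q) v := by
      ext q; exact inner_gradient_left.symm
    rw [e] at h1
    have h3 := DFunLike.congr_fun (h1.unique h2) u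
    simpa using h3
  have hs := (hh.contDiffAt (x := p)).isSymmSndFDerivAt (by simp)
  rw [← key, hs.eq, key, real_inner_comm]

lemma hasFDerivAt_hess {h : E → ℝ} (hh : ContDiff ℝ 3 h) (p : E) :
    HasFDerivAt (hess h) (fderiv ℝ (hess h) p) p := by
  have h1 : ContDiff ℝ ((1 : ℕ) + 1) (gradient h) :=
    contDiff_gradient 2 (by exact_mod_cast hh)
  have h2 : ContDiff ℝ 1 (hess h) := h1.fderiv_right (by norm_num)
  exact (h2.differentiable (by simp) p).hasFDerivAt

lemma hasDerivAt_line {h : E → ℝ} {G : E → E} (hG : ∀ p, HasGradientAt h (G p) p) (y d : E)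
    (t : ℝ) : HasDerivAt (fun t : ℝ => h (y + t • d)) (inner ℝ (G (y + t • d)) d) t := by
  have h1 : HasDerivAt (fun t : ℝ => y + t • d) d t := by
    simpa using ((hasDerivAt_id t).smul_const d).const_add y
  have h2 := (hG (y + t • d)).hasFDerivAt.comp_hasDerivAt t h1
  simp only [InnerProductSpace.toDual_apply_apply] at h2
  exact h2

/-- Quadratic upper bound from a one-sided Lipschitz gradient; for negative `L` it is the
lower bound of strong convexity applied to `-h`. -/
lemma quadratic_upper_bound {h : E → ℝ} {G : E → E} (hG : ∀ p, HasGradientAt h (G p) p) {L : ℝ}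
    (hL : ∀ p q, inner ℝ (G p - G q) (p - q) ≤ L * ‖p - q‖ ^ 2) (y z : E) :
    h z ≤ h y + inner ℝ (G y) (z - y) + L / 2 * ‖z - y‖ ^ 2 := by
  set d := z - y with hd
  -- Up to the constant `h y`, this is the claimed bound minus `h` along the segment. Its derivative
  -- is nonnegative: the hypothesis at `y + t • d` and `y` carries a common factor `t`, which
  -- cancels.
  let ψ : ℝ → ℝ := fun t => t * inner ℝ (G y) d + L / 2 * t ^ 2 * ‖d‖ ^ 2 - h (y + t • d)
  have hψ : ∀ t, HasDerivAt ψ (inner ℝ (G y) d + L * t * ‖d‖ ^ 2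
      - inner ℝ (G (y + t • d)) d) t := by
    intro t
    have h1 := (((hasDerivAt_id t).mul_const (inner ℝ (G y) d)).add
      ((((hasDerivAt_id t).pow 2).const_mul (L / 2)).mul_const (‖d‖ ^ 2))).sub
      (hasDerivAt_line hG y d t)
    refine h1.congr_deriv ?_
    simp only [id_eq]; push_cast; ring
  have hmono : MonotoneOn ψ (Icc 0 1) := by
    refine monotoneOn_of_deriv_nonneg (convex_Icc 0 1)
      (fun t _ => (hψ t).continuousAt.continuousWithinAt)
      (fun t _ => (hψ t).differentiableAt.differentiableWithinAt) ?_
    intro t ht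
    rw [interior_Icc] at ht
    rw [(hψ t).deriv]
    have h2 := hL (y + t • d) y
    rw [add_sub_cancel_left, inner_smul_right, norm_smul, Real.norm_of_nonneg ht.1.le,
      inner_sub_left, mul_pow] at h2
    have h3 : t * (inner ℝ (G (y + t • d)) d - inner ℝ (G y) d) ≤ t * (L * t * ‖d‖ ^ 2) := by
      linarith [h2]
    have := le_of_mul_le_mul_left h3 ht.1
    linarith
  have := hmono (left_mem_Icc.2 zero_le_one) (right_mem_Icc.2 zero_le_one) zero_le_one
  simp only [ψ, zero_smul, add_zero, one_smul] at this
  have hz : y + d = z := by simp [hd]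
  rw [hz] at this
  linarith

lemma quadratic_lower_bound {h : E → ℝ} {G : E → E} (hG : ∀ p, HasGradientAt h (G p) p) {m : ℝ}
    (hm : ∀ p q, m * ‖p - q‖ ^ 2 ≤ inner ℝ (G p - G q) (p - q)) (y z : E) :
    h y + inner ℝ (G y) (z - y) + m / 2 * ‖z - y‖ ^ 2 ≤ h z := by
  have hG' : ∀ p, HasGradientAt (fun p => -h p) (-G p) p := by
    intro p
    rw [hasGradientAt_iff_hasFDerivAt, map_neg]
    exact (hG p).hasFDerivAt.neg
  have := quadratic_upper_bound hG' (L := -m) (fun p q => by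
    have := hm p q
    have e : -G p - -G q = -(G p - G q) := by abel
    rw [e, inner_neg_left]; linarith) y z
  rw [inner_neg_left] at this
  linarith

/-- The gradient of a strongly convex function is strongly monotone. -/
lemma StrongConvexOn.gradient_mono {h : E → ℝ} {m : ℝ} (hc : StrongConvexOn univ m h) {G : E → E}
    (hG : ∀ p, HasGradientAt h (G p) p) (p q : E) :
    m * ‖p - q‖ ^ 2 ≤ inner ℝ (G p - G q) (p - q) := by
  -- Divide the convexity inequality on `[y, z]` by `t` and let `t → 0+`. Adding the result for `(p,
  -- q)` and `(q, p)` combines two halves into the full modulus `m`.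
  have key : ∀ y z, inner ℝ (G y) (z - y) ≤ h z - h y - m / 2 * ‖z - y‖ ^ 2 := by
    intro y z
    have h1 : Filter.Tendsto (fun t : ℝ => t⁻¹ • (h (y + (0 + t) • (z - y)) - h (y + (0 : ℝ) • (z - y))))
        (nhdsWithin 0 (Ioi 0)) (nhds (inner ℝ (G (y + (0 : ℝ) • (z - y))) (z - y))) :=
      (hasDerivAt_line hG y (z - y) 0).tendsto_slope_zero_right
    have h2 : Filter.Tendsto (fun t : ℝ => h z - h y - (1 - t) * (m / 2 * ‖z - y‖ ^ 2))
        (nhdsWithin 0 (Ioi 0)) (nhds (h z - h y - (1 - 0) * (m / 2 * ‖z - y‖ ^ 2))) := by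
      refine Filter.Tendsto.mono_left ?_ nhdsWithin_le_nhds
      refine Continuous.tendsto ?_ 0
      fun_prop
    simp only [zero_smul, add_zero, zero_add] at h1
    rw [sub_zero, one_mul] at h2
    refine le_of_tendsto_of_tendsto h1 h2 ?_
    have hIoo : Ioo (0 : ℝ) 1 ∈ nhdsWithin 0 (Ioi 0) := Ioo_mem_nhdsGT one_pos
    filter_upwards [hIoo] with t ht
    have h3 := hc.2 (mem_univ y) (mem_univ z) (sub_nonneg.2 ht.2.le) ht.1.le (by ring)
    have e : (1 - t) • y + t • z = y + t • (z - y) := by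
      rw [smul_sub, sub_smul, one_smul]; abel
    rw [e, norm_sub_rev] at h3
    simp only [smul_eq_mul] at h3 ⊢
    rw [inv_mul_le_iff₀ ht.1]
    linarith [h3]
  have h1 := key p q
  have h2 := key q p
  have e : inner ℝ (G p - G q) (p - q) = -inner ℝ (G p) (q - p) - inner ℝ (G q) (p - q) := by
    rw [inner_sub_left, ← neg_sub q p, inner_neg_right, inner_neg_right]
  rw [norm_sub_rev q p] at h1
  rw [e]; linarith

/-- Monotonicity between `p + t • v` and `p`, divided by `t ^ 2`, in the limit `t → 0+`. -/
lemma coercive_of_strongly_mono {G : E → E} {m : ℝ}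
    (hm : ∀ p q, m * ‖p - q‖ ^ 2 ≤ inner ℝ (G p - G q) (p - q)) {A : E →L[ℝ] E} {p : E}
    (hA : HasFDerivAt G A p) (v : E) : m * ‖v‖ ^ 2 ≤ inner ℝ (A v) v := by
  have h1 : HasDerivAt (fun t : ℝ => p + t • v) v 0 := by
    simpa using ((hasDerivAt_id (0 : ℝ)).smul_const v).const_add p
  have h0 : HasFDerivAt G A (p + (0 : ℝ) • v) := by simpa using hA
  have h2 := (h0.comp_hasDerivAt (0 : ℝ) h1).tendsto_slope_zero_right
  have h3 := h2.inner (𝕜 := ℝ) (tendsto_const_nhds (x := v))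
  refine ge_of_tendsto h3 ?_
  filter_upwards [self_mem_nhdsWithin] with t ht
  have ht : 0 < t := ht
  have h4 := hm (p + t • v) p
  rw [add_sub_cancel_left, inner_smul_right, norm_smul, Real.norm_of_nonneg ht.le, mul_pow] at h4
  simp only [Function.comp, zero_add, zero_smul, add_zero, inner_smul_left]
  have h5 : t * (t * (m * ‖v‖ ^ 2)) ≤ t * inner ℝ (G (p + t • v) - G p) v := by linarith [h4]
  have := le_of_mul_le_mul_left h5 ht
  simpa [le_inv_mul_iff₀ ht] using this

/-- A strongly monotone gradient has a minimizer as its zero. -/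
lemma exists_minimizer [FiniteDimensional ℝ E] {h : E → ℝ} {G : E → E}
    (hG : ∀ p, HasGradientAt h (G p) p) {m : ℝ} (hm0 : 0 < m)
    (hm : ∀ p q, m * ‖p - q‖ ^ 2 ≤ inner ℝ (G p - G q) (p - q)) :
    ∃ z, ∀ z', h z ≤ h z' := by
  have hc : Continuous h := continuous_iff_continuousAt.2 fun p => (hG p).continuousAt
  refine hc.exists_forall_le ?_
  have h1 : ∀ z, h 0 + (m / 2 * ‖z‖ ^ 2 - ‖G 0‖ * ‖z‖) ≤ h z := by
    intro z
    have h2 := quadratic_lower_bound hG hm 0 z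
    rw [sub_zero] at h2
    have h3 := abs_le.1 (abs_real_inner_le_norm (G 0) z)
    linarith [h3.1]
  refine Filter.tendsto_atTop_mono h1 ?_
  have h4 : Filter.Tendsto (fun z : E => ‖z‖) (Filter.cocompact E) Filter.atTop :=
    tendsto_norm_cocompact_atTop
  have h5 : Filter.Tendsto (fun r : ℝ => h 0 + r * (m / 2 * r - ‖G 0‖)) Filter.atTop Filter.atTop := by
    refine Filter.tendsto_atTop_add_const_left _ _ (Filter.Tendsto.atTop_mul_atTop₀ Filter.tendsto_id ?_)
    refine Filter.tendsto_atTop_add_const_right _ _ ?_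
    exact Filter.tendsto_id.const_mul_atTop (by positivity)
  refine (h5.comp h4).congr fun z => ?_
  simp only [Function.comp]; ring

lemma gradient_eq_zero_of_minimizer {h : E → ℝ} {g z : E} (hG : HasGradientAt h g z)
    (hz : ∀ z', h z ≤ h z') : g = 0 := by
  have h1 : IsLocalMin h z := Filter.Eventually.of_forall hz
  have := h1.hasFDerivAt_eq_zero hG.hasFDerivAt
  simpa using this


lemma argmin_spec {h : E → ℝ} (hex : ∃ z, ∀ z', h z ≤ h z') (z' : E) : h (argmin h) ≤ h z' :=
  Classical.epsilon_spec hex z'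

/-- Mean value inequality for `f - f' x` on the segment, where the derivative moves by at most `r *
‖s‖`. The sharp factor `1 / 2` is lost, which the later constants can afford. -/
lemma taylor_of_lipschitz_fderiv {E F : Type} [NormedAddCommGroup E] [NormedSpace ℝ E]
    [NormedAddCommGroup F] [NormedSpace ℝ F] {f : E → F} {f' : E → E →L[ℝ] F}
    (hf : ∀ x, HasFDerivAt f (f' x) x) {r : ℝ} (hr : ∀ x x', ‖f' x - f' x'‖ ≤ r * ‖x - x'‖)
    (x s : E) : ‖f (x + s) - f x - f' x s‖ ≤ r * ‖s‖ ^ 2 := by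
  have hs0 : 0 ≤ r * ‖s‖ := by
    have := (norm_nonneg _).trans (hr (x + s) x)
    rwa [add_sub_cancel_left] at this
  have h1 := (convex_segment x (x + s)).norm_image_sub_le_of_norm_hasFDerivWithin_le'
    (f := f) (f' := f') (φ := f' x) (C := r * ‖s‖) (x := x) (y := x + s)
    (fun z _ => (hf z).hasFDerivWithinAt) (fun z hz => by
      obtain ⟨t, ht, rfl⟩ := (segment_eq_image' ℝ x (x + s) ▸ hz)
      refine (hr _ _).trans ?_
      simp only [add_sub_cancel_left, norm_smul, Real.norm_of_nonneg ht.1]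
      nlinarith [ht.2])
    (left_mem_segment ℝ _ _) (right_mem_segment ℝ _ _)
  rw [add_sub_cancel_left] at h1
  exact h1.trans_eq (by ring)

lemma taylor_gradient {V : E → ℝ} (hV : ContDiff ℝ 2 V) {r : ℝ}
    (hr : ∀ x x', ‖hess V x - hess V x'‖ ≤ r * ‖x - x'‖) (x s : E) :
    ‖gradient V (x + s) - gradient V x - hess V x s‖ ≤ r * ‖s‖ ^ 2 :=
  taylor_of_lipschitz_fderiv (hasFDerivAt_gradient hV) hr x s

lemma taylor_value {V : E → ℝ} (hV : ContDiff ℝ 2 V) {r : ℝ} (hr0 : 0 ≤ r)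
    (hr : ∀ x x', ‖hess V x - hess V x'‖ ≤ r * ‖x - x'‖) (x s : E) :
    V (x + s) ≤ V x + inner ℝ (gradient V x) s + 1 / 2 * inner ℝ s (hess V x s)
      + r * ‖s‖ ^ 3 := by
  let ψ : ℝ → ℝ := fun t => V (x + t • s) - t * inner ℝ (gradient V x) s
    - t ^ 2 / 2 * inner ℝ s (hess V x s)
  have hG : ∀ p, HasGradientAt V (gradient V p) p :=
    fun p => (hV.differentiable (by simp) p).hasGradientAt
  have hψ : ∀ t, HasDerivAt ψ (inner ℝ (gradient V (x + t • s)) s - inner ℝ (gradient V x) s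
      - t * inner ℝ s (hess V x s)) t := by
    intro t
    have h1 := ((hasDerivAt_line hG x s t).sub ((hasDerivAt_id t).mul_const
      (inner ℝ (gradient V x) s))).sub ((((hasDerivAt_id t).pow 2).div_const 2).mul_const
        (inner ℝ s (hess V x s)))
    refine h1.congr_deriv ?_
    simp only [id_eq]; push_cast; ring
  have hb : ∀ t ∈ Ico (0 : ℝ) 1, ‖inner ℝ (gradient V (x + t • s)) s - inner ℝ (gradient V x) s
      - t * inner ℝ s (hess V x s)‖ ≤ r * ‖s‖ ^ 3 := by
    intro t ht
    have e : inner ℝ (gradient V (x + t • s)) s - inner ℝ (gradient V x) s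
      - t * inner ℝ s (hess V x s) =
        inner ℝ (gradient V (x + t • s) - gradient V x - hess V x (t • s)) s := by
      rw [inner_sub_left, inner_sub_left, map_smul, inner_smul_left, real_inner_comm (hess V x s) s]
      simp
    rw [e]
    refine (norm_inner_le_norm _ _).trans ?_
    have h1 := taylor_gradient hV hr x (t • s)
    have h2 : ‖t • s‖ ≤ ‖s‖ := by
      rw [norm_smul, Real.norm_of_nonneg ht.1]
      nlinarith [norm_nonneg s, ht.2]
    have h3 : r * ‖t • s‖ ^ 2 ≤ r * ‖s‖ ^ 2 := by gcongr
    calc _ ≤ r * ‖s‖ ^ 2 * ‖s‖ := by gcongr; exact h1.trans h3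
      _ = _ := by ring
  have := norm_image_sub_le_of_norm_deriv_le_segment_01'
    (fun t _ => (hψ t).hasDerivWithinAt) hb
  have h2 := (abs_le.1 (by simpa [ψ] using this : |V (x + s) - inner ℝ (gradient V x) s
    - 2⁻¹ * inner ℝ s (hess V x s) - V x| ≤ r * ‖s‖ ^ 3)).2
  linarith

end Gradient

/-! ### Oracle counts of accelerated gradient descent -/

section Counting

lemma Counted.bind_val {α β : Type} (c : Counted α) (k : α → Counted β) :
    (c >>= k).val = (k c.val).val := rfl

lemma Counted.bind_first {α β : Type} (c : Counted α) (k : α → Counted β) :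
    (c >>= k).first = c.first + (k c.val).first := rfl

lemma Counted.bind_second {α β : Type} (c : Counted α) (k : α → Counted β) :
    (c >>= k).second = c.second + (k c.val).second := rfl

variable {E : Type} [NormedAddCommGroup E] [NormedSpace ℝ E]

lemma agdLoop_succ_val (grad : E → Counted E) (η θ : ℝ) (K : ℕ) (z zt : E) :
    (agdLoop grad η θ (K + 1) z zt).val =
      (agdLoop grad η θ K (zt - η • (grad zt).val)
        (zt - η • (grad zt).val + θ • (zt - η • (grad zt).val - z))).val := rfl

lemma agdLoop_first {grad : E → Counted E} {c : ℕ} (hc : ∀ z, (grad z).first = c) (η θ : ℝ)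
    (K : ℕ) : ∀ z zt : E, (agdLoop grad η θ K z zt).first = K * c := by
  induction K with
  | zero => intro z zt; simp [agdLoop, pure]
  | succ K ih =>
    intro z zt
    rw [agdLoop, Counted.bind_first, ih, hc]; ring

lemma agdLoop_second {grad : E → Counted E} (hc : ∀ z, (grad z).second = 0) (η θ : ℝ)
    (K : ℕ) : ∀ z zt : E, (agdLoop grad η θ K z zt).second = 0 := by
  induction K with
  | zero => intro z zt; simp [agdLoop, pure]
  | succ K ih =>
    intro z zt
    rw [agdLoop, Counted.bind_second, ih, hc]

end Counting

/-! ### Convergence of accelerated gradient descent -/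

section AGD

variable {E : Type} [NormedAddCommGroup E] [InnerProductSpace ℝ E] [CompleteSpace E]

/-- One step of accelerated gradient descent contracts the Lyapunov function
`h z - h z⋆ + L / 2 ‖(1 + q) z̃ - z - q z⋆‖²` by the factor `1 - q`. -/
lemma agd_step {h : E → ℝ} {G : E → E} (hG : ∀ p, HasGradientAt h (G p) p) {L m q θ : ℝ}
    (hL0 : 0 < L) (hq0 : 0 < q) (hq1 : q ≤ 1) (hmq : q ^ 2 * L ≤ m)
    (hθ : θ * (1 + q) = 1 - q)
    (hL : ∀ p p', inner ℝ (G p - G p') (p - p') ≤ L * ‖p - p'‖ ^ 2)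
    (hm : ∀ p p', m * ‖p - p'‖ ^ 2 ≤ inner ℝ (G p - G p') (p - p')) (zs z zt z' : E)
    (hz' : z' = zt - (1 / L) • G zt) :
    h z' - h zs + L / 2 * ‖(1 + q) • (z' + θ • (z' - z)) - z' - q • zs‖ ^ 2 ≤
      (1 - q) * (h z - h zs + L / 2 * ‖(1 + q) • zt - z - q • zs‖ ^ 2) := by
  set g := G zt with hg
  set u := zt - z with hu
  set v := zt - zs with hv
  have hm0 : 0 ≤ m := le_trans (by positivity) hmq
  have e1 : (1 + q) • (z' + θ • (z' - z)) - z' - q • zs = ((1 - q) • u + q • v) - (1 / L) • g := by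
    have : (1 + q) • (z' + θ • (z' - z)) = (1 + q) • z' + (1 - q) • (z' - z) := by
      rw [smul_add, smul_smul, mul_comm (1 + q) θ, hθ]
    rw [this, hz', hu, hv]; module
  have e2 : (1 + q) • zt - z - q • zs = u + q • v := by rw [hu, hv]; module
  rw [e1, e2]
  have i1 : h z' ≤ h zt - 1 / (2 * L) * ‖g‖ ^ 2 := by
    have := quadratic_upper_bound hG hL zt z'
    have e : z' - zt = -((1 / L) • g) := by rw [hz']; abel
    rw [e, inner_neg_right, inner_smul_right, real_inner_self_eq_norm_sq, norm_neg, norm_smul,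
      Real.norm_of_nonneg (by positivity), mul_pow] at this
    refine this.trans_eq ?_
    field_simp; ring
  -- Strong convexity is used only with modulus `q ^ 2 * L`: weighted by `q`, it cancels the `q ^ 3`
  -- term of `x5`.
  have i2 : h zt - inner ℝ g v + q ^ 2 * L / 2 * ‖v‖ ^ 2 ≤ h zs := by
    have := quadratic_lower_bound hG hm zt zs
    have e : zs - zt = -v := by rw [hv]; abel
    rw [e, inner_neg_right, norm_neg] at this
    nlinarith [sq_nonneg ‖v‖]
  have i3 : h zt - inner ℝ g u ≤ h z := by
    have := quadratic_lower_bound hG hm zt z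
    have e : z - zt = -u := by rw [hu]; abel
    rw [e, inner_neg_right, norm_neg] at this
    nlinarith [mul_nonneg hm0 (sq_nonneg ‖u‖)]
  have x1 : ‖((1 - q) • u + q • v) - (1 / L) • g‖ ^ 2 = ‖(1 - q) • u + q • v‖ ^ 2
      - 2 / L * ((1 - q) * inner ℝ g u + q * inner ℝ g v) + 1 / L ^ 2 * ‖g‖ ^ 2 := by
    rw [norm_sub_sq_real, inner_smul_right, norm_smul, Real.norm_of_nonneg (by positivity),
      real_inner_comm, inner_add_right, inner_smul_right, inner_smul_right]
    field_simp
  have x2 : ‖(1 - q) • u + q • v‖ ^ 2 = (1 - q) ^ 2 * ‖u‖ ^ 2 + 2 * (1 - q) * q * inner ℝ u v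
      + q ^ 2 * ‖v‖ ^ 2 := by
    rw [norm_add_sq_real, inner_smul_right, real_inner_smul_left, norm_smul, norm_smul, mul_pow,
      mul_pow, Real.norm_eq_abs, Real.norm_eq_abs, sq_abs, sq_abs]; ring
  have x3 : ‖u + q • v‖ ^ 2 = ‖u‖ ^ 2 + 2 * q * inner ℝ u v + q ^ 2 * ‖v‖ ^ 2 := by
    rw [norm_add_sq_real, inner_smul_right, norm_smul, mul_pow, Real.norm_eq_abs, sq_abs]; ring
  have x4 : L / 2 * ‖((1 - q) • u + q • v) - (1 / L) • g‖ ^ 2 =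
      L / 2 * ‖(1 - q) • u + q • v‖ ^ 2 - ((1 - q) * inner ℝ g u + q * inner ℝ g v)
        + 1 / (2 * L) * ‖g‖ ^ 2 := by
    rw [x1]; field_simp
  -- The right side exceeds the left by exactly `(1 - q) * q * ‖u‖ ^ 2`.
  have x5 : ‖(1 - q) • u + q • v‖ ^ 2 ≤ (1 - q) * ‖u + q • v‖ ^ 2 + q ^ 3 * ‖v‖ ^ 2 := by
    rw [x2, x3]
    nlinarith [mul_nonneg (mul_nonneg (sub_nonneg.2 hq1) hq0.le) (sq_nonneg ‖u‖)]
  rw [x4]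
  -- The combination `i1 + (1 - q) * i3 + q * i2` cancels the inner products with `g` and the `‖g‖ ^
  -- 2` terms of `x4`.
  have j3 := mul_le_mul_of_nonneg_left i3 (sub_nonneg.2 hq1)
  have j2 := mul_le_mul_of_nonneg_left i2 hq0.le
  have j5 := mul_le_mul_of_nonneg_left x5 (half_pos hL0).le
  linarith

lemma agdLoop_lyapunov {h : E → ℝ} {G : E → E} (hG : ∀ p, HasGradientAt h (G p) p) {L m q θ : ℝ}
    (hL0 : 0 < L) (hq0 : 0 < q) (hq1 : q ≤ 1) (hmq : q ^ 2 * L ≤ m)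
    (hθ : θ * (1 + q) = 1 - q)
    (hL : ∀ p p', inner ℝ (G p - G p') (p - p') ≤ L * ‖p - p'‖ ^ 2)
    (hm : ∀ p p', m * ‖p - p'‖ ^ 2 ≤ inner ℝ (G p - G p') (p - p')) (zs : E)
    {grad : E → Counted E} (hgrad : ∀ z, (grad z).val = G z) (K : ℕ) : ∀ z zt : E,
    h (agdLoop grad (1 / L) θ K z zt).val - h zs ≤
      (1 - q) ^ K * (h z - h zs + L / 2 * ‖(1 + q) • zt - z - q • zs‖ ^ 2) := by
  induction K with
  | zero =>
    intro z zt
    simp only [agdLoop, pure, pow_zero, one_mul]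
    have : 0 ≤ L / 2 * ‖(1 + q) • zt - z - q • zs‖ ^ 2 := by positivity
    linarith
  | succ K ih =>
    intro z zt
    rw [agdLoop_succ_val, hgrad]
    refine (ih _ _).trans ?_
    rw [pow_succ (1 - q), mul_assoc]
    exact mul_le_mul_of_nonneg_left
      (agd_step hG hL0 hq0 hq1 hmq hθ hL hm zs z zt _ rfl) (pow_nonneg (sub_nonneg.2 hq1) K)

/-- With `q = 1 / √k` and equal starting points, the initial Lyapunov value is at most `m / 2 * (k +
1) * ‖z - zs‖ ^ 2`: the value gap contributes `m * k / 2` and the quadratic term `m / 2`. Strong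
convexity converts the final value gap into a distance. -/
lemma agd_dist_sq {h : E → ℝ} {G : E → E} (hG : ∀ p, HasGradientAt h (G p) p) {L m k : ℝ}
    (hL0 : 0 < L) (hk : 1 ≤ k) (hmk : L ≤ m * k)
    (hL : ∀ p p', inner ℝ (G p - G p') (p - p') ≤ L * ‖p - p'‖ ^ 2)
    (hm : ∀ p p', m * ‖p - p'‖ ^ 2 ≤ inner ℝ (G p - G p') (p - p')) {zs : E} (hzs : G zs = 0)
    {grad : E → Counted E} (hgrad : ∀ z, (grad z).val = G z) (K : ℕ) (z : E) :
    ‖(agd grad z K (1 / L) (momentum k)).val - zs‖ ^ 2 ≤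
      (k + 1) * (1 - 1 / √k) ^ K * ‖z - zs‖ ^ 2 := by
  have hk0 : 0 < k := by linarith
  have hsk : 1 ≤ √k := Real.one_le_sqrt.2 hk
  have hsk0 : 0 < √k := by linarith
  have hq2 : (1 / √k) ^ 2 = 1 / k := by rw [div_pow, Real.sq_sqrt hk0.le, one_pow]
  have hq1 : 1 / √k ≤ 1 := by rw [div_le_one hsk0]; exact hsk
  have hmq : (1 / √k) ^ 2 * L ≤ m := by
    rw [hq2, one_div, inv_mul_le_iff₀ hk0]; linarith
  have h1 := agdLoop_lyapunov hG hL0 (by positivity) hq1 hmq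
    (θ := momentum k) (by unfold momentum; field_simp) hL hm zs hgrad K z z
  have hm0 : 0 < m := lt_of_lt_of_le (by positivity) hmq
  set val := (agdLoop grad (1 / L) (momentum k) K z z).val with hval
  have h2 := quadratic_lower_bound hG hm zs val
  have h3 := quadratic_upper_bound hG hL zs z
  rw [hzs, inner_zero_left, add_zero] at h2 h3
  have e : (1 + 1 / √k) • z - z - (1 / √k) • zs = (1 / √k) • (z - zs) := by module
  rw [e, norm_smul, mul_pow, Real.norm_eq_abs, sq_abs, hq2] at h1
  have hr : 0 ≤ (1 - 1 / √k) ^ K := pow_nonneg (sub_nonneg.2 hq1) K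
  have h4 : m / 2 * ‖val - zs‖ ^ 2 ≤
      (1 - 1 / √k) ^ K * (m / 2 * (k + 1) * ‖z - zs‖ ^ 2) := by
    refine le_trans (by linarith) (h1.trans (mul_le_mul_of_nonneg_left ?_ hr))
    have h5 : L / k ≤ m := by rwa [div_le_iff₀ hk0]
    have h6 : L / 2 * (1 / k * ‖z - zs‖ ^ 2) ≤ m / 2 * ‖z - zs‖ ^ 2 := by
      have : L / 2 * (1 / k * ‖z - zs‖ ^ 2) = L / k / 2 * ‖z - zs‖ ^ 2 := by field_simp
      rw [this]; gcongr
    have h7 : L / 2 * ‖z - zs‖ ^ 2 ≤ m * k / 2 * ‖z - zs‖ ^ 2 := by gcongr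
    linarith
  have h8 : m / 2 * ‖val - zs‖ ^ 2 ≤
      m / 2 * ((k + 1) * (1 - 1 / √k) ^ K * ‖z - zs‖ ^ 2) := by linarith
  exact le_of_mul_le_mul_left h8 (by positivity)

/-- The length is phrased with any `k₂ ≥ k`, so that one formula serves both inner problems. It
forces the contraction below `(arg ^ 2)⁻¹`, which cancels the prefactor `(k + 1) * a ^ 2` up to `tol
^ 2`. -/
lemma agd_accuracy {h : E → ℝ} {G : E → E} (hG : ∀ p, HasGradientAt h (G p) p) {L m k : ℝ}
    (hL0 : 0 < L) (hk : 1 ≤ k) (hmk : L ≤ m * k)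
    (hL : ∀ p p', inner ℝ (G p - G p') (p - p') ≤ L * ‖p - p'‖ ^ 2)
    (hm : ∀ p p', m * ‖p - p'‖ ^ 2 ≤ inner ℝ (G p - G p') (p - p')) {zs : E} (hzs : G zs = 0)
    {grad : E → Counted E} (hgrad : ∀ z, (grad z).val = G z) {K : ℕ} {z : E} {k₂ tol a : ℝ}
    (hk₂ : k ≤ k₂) (htol : 0 < tol) (ha : ‖z - zs‖ ≤ a)
    (hK : 2 * √k₂ * Real.log (√(k₂ + 1) / tol * a) ≤ K) :
    ‖(agd grad z K (1 / L) (momentum k)).val - zs‖ ≤ tol := by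
  have h1 := agd_dist_sq hG hL0 hk hmk hL hm hzs hgrad K z
  refine le_of_sq_le_sq ?_ htol.le
  refine h1.trans ?_
  have hk0 : 0 < k := by linarith
  have hk20 : 0 < k₂ := by linarith
  have hsk : 1 ≤ √k := Real.one_le_sqrt.2 hk
  have hsk2 : √k ≤ √k₂ := Real.sqrt_le_sqrt hk₂
  have ha0 : 0 ≤ a := (norm_nonneg _).trans ha
  -- For `a = 0` the value `log 0 = 0` says nothing about `K`, but the start is already the
  -- minimizer.
  rcases ha0.eq_or_lt with ha' | ha'
  · have : ‖z - zs‖ = 0 := le_antisymm (ha' ▸ ha) (norm_nonneg _)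
    rw [this]; simp; positivity
  set arg := √(k₂ + 1) / tol * a with harg
  have harg0 : 0 < arg := by positivity
  have h2 : (1 - 1 / √k) ^ K ≤ (arg ^ 2)⁻¹ := by
    have h3 : 1 - 1 / √k ≤ Real.exp (-(1 / √k₂)) := by
      have := Real.add_one_le_exp (-(1 / √k₂))
      have h4 : 1 / √k₂ ≤ 1 / √k := one_div_le_one_div_of_le (by linarith) hsk2
      linarith
    have h5 : 0 ≤ 1 - 1 / √k := by
      rw [sub_nonneg, div_le_one (by linarith)]; exact hsk
    calc (1 - 1 / √k) ^ K ≤ Real.exp (-(1 / √k₂)) ^ K := pow_le_pow_left₀ h5 h3 K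
      _ = Real.exp (-(K / √k₂)) := by rw [← Real.exp_nat_mul]; congr 1; ring
      _ ≤ Real.exp (-(2 * Real.log arg)) := by
        rw [Real.exp_le_exp, neg_le_neg_iff, le_div_iff₀ (by linarith)]
        linarith
      _ = (arg ^ 2)⁻¹ := by
        rw [Real.exp_neg, two_mul, Real.exp_add, Real.exp_log harg0, sq]
  calc (k + 1) * (1 - 1 / √k) ^ K * ‖z - zs‖ ^ 2 ≤ (k₂ + 1) * (arg ^ 2)⁻¹ * a ^ 2 := by
        have h6 : 0 ≤ (1 - 1 / √k) ^ K := by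
          refine pow_nonneg ?_ K
          rw [sub_nonneg, div_le_one (by linarith)]; exact hsk
        gcongr
    _ = tol ^ 2 := by
      rw [harg, mul_pow, div_pow, Real.sq_sqrt (by linarith)]
      field_simp

end AGD

/-! ### Global minimizers of the cubic model -/

section Cubic

variable {d : ℕ} {g s : Vec d} {H : Vec d →L[ℝ] Vec d} {M : ℝ}

lemma hasGradientAt_quadratic (hH : ∀ u v, inner ℝ (H u) v = inner ℝ u (H v)) (s : Vec d) :
    HasGradientAt (fun s => inner ℝ g s + 1 / 2 * inner ℝ s (H s)) (g + H s) s := by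
  rw [hasGradientAt_iff_hasFDerivAt]
  have h1 := ((hasFDerivAt_const g s).inner ℝ (hasFDerivAt_id s)).add
    (((hasFDerivAt_id s).inner ℝ (H.hasFDerivAt (x := s))).const_mul (1 / 2))
  refine h1.congr_fderiv ?_
  ext v
  have := hH s v
  have h2 := hH v s
  have h3 : inner ℝ v (H s) = inner ℝ (H v) s := h2.symm ▸ rfl
  simp only [one_div, id_eq, add_apply, ContinuousLinearMap.comp_apply,
    ContinuousLinearMap.prod_apply, zero_apply, ContinuousLinearMap.id_apply, fderivInnerCLM_apply,
    inner_zero_left, add_zero, smul_apply, smul_eq_mul, InnerProductSpace.toDual_apply_apply,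
    inner_add_left]
  rw [← hH s v, real_inner_comm (H s) v]; ring

lemma cubic_first_order (hH : ∀ u v, inner ℝ (H u) v = inner ℝ u (H v))
    (hs : ∀ v, cubicModel g H M s ≤ cubicModel g H M v) : g + H s = -((M / 2 * ‖s‖) • s) := by
  have h1 : HasFDerivAt (fun v : Vec d => ‖v‖ ^ 3) ((3 * ‖s‖) • innerSL ℝ s) s := by
    have := hasFDerivAt_norm_rpow s (p := 3) (by norm_num)
    have e : (fun v : Vec d => ‖v‖ ^ (3 : ℝ)) = fun v => ‖v‖ ^ 3 := by ext v; norm_cast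
    rwa [show (3 : ℝ) - 2 = 1 by norm_num, Real.rpow_one, e] at this
  have h2 : HasGradientAt (cubicModel g H M) (g + H s + (M / 2 * ‖s‖) • s) s := by
    rw [hasGradientAt_iff_hasFDerivAt]
    refine ((hasGradientAt_quadratic hH s).hasFDerivAt.add (h1.const_mul (M / 6))).congr_fderiv ?_
    ext v
    simp; ring
  exact eq_neg_of_add_eq_zero_left (gradient_eq_zero_of_minimizer h2 hs)

lemma cubic_second_order (hH : ∀ u v, inner ℝ (H u) v = inner ℝ u (H v))
    (hs : ∀ v, cubicModel g H M s ≤ cubicModel g H M v) (v : Vec d) :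
    0 ≤ inner ℝ v (H v) + M / 2 * ‖s‖ * ‖v‖ ^ 2 := by
  have hfo := cubic_first_order hH hs
  -- At `s = 0` the sphere degenerates; there `g = 0`, and comparison with small multiples of `v`
  -- suffices.
  rcases eq_or_ne s 0 with h0 | h0
  · subst h0
    have hg : g = 0 := by simpa using hfo
    have h1 : ∀ t : ℝ, 0 < t → 0 ≤ inner ℝ v (H v) + M / 3 * t * ‖v‖ ^ 3 := by
      intro t ht
      have := hs (t • v)
      simp only [cubicModel, hg, inner_zero_left, map_zero, inner_zero_right, norm_zero, map_smul,
        inner_smul_right, real_inner_smul_left, norm_smul, Real.norm_of_nonneg ht.le, zero_add] at this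
      have h2 : 0 ≤ t ^ 2 / 2 * (inner ℝ v (H v) + M / 3 * t * ‖v‖ ^ 3) := by
        ring_nf at this ⊢; linarith
      exact nonneg_of_mul_nonneg_right h2 (by positivity)
    have h3 : Filter.Tendsto (fun t : ℝ => inner ℝ v (H v) + M / 3 * t * ‖v‖ ^ 3)
        (nhdsWithin 0 (Ioi 0)) (nhds (inner ℝ v (H v) + M / 3 * 0 * ‖v‖ ^ 3)) :=
      (Continuous.tendsto (by fun_prop) 0).mono_left nhdsWithin_le_nhds
    have h4 := ge_of_tendsto h3 (by filter_upwards [self_mem_nhdsWithin] with t ht using h1 t ht)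
    simpa using h4
  have key : ∀ e : Vec d, inner ℝ s e ≠ 0 → 0 ≤ inner ℝ e (H e) + M / 2 * ‖s‖ * ‖e‖ ^ 2 := by
    intro e he
    have he0 : e ≠ 0 := by rintro rfl; simp at he
    have hne : 0 < ‖e‖ := norm_pos_iff.2 he0
    -- The nonzero root of `‖s + α • e‖ = ‖s‖`.
    obtain ⟨α, hα⟩ : ∃ α : ℝ, inner ℝ s e = -α * ‖e‖ ^ 2 / 2 :=
      ⟨-2 * inner ℝ s e / ‖e‖ ^ 2, by field_simp⟩
    have hα0 : α ≠ 0 := by rintro rfl; simp at hα; exact he hα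
    have hnorm : ‖s + α • e‖ = ‖s‖ := by
      have : ‖s + α • e‖ ^ 2 = ‖s‖ ^ 2 := by
        rw [norm_add_sq_real, inner_smul_right, norm_smul, mul_pow, Real.norm_eq_abs, sq_abs, hα]
        ring
      exact (sq_eq_sq₀ (norm_nonneg _) (norm_nonneg _)).1 this
    have h1 := hs (s + α • e)
    have h2 : inner ℝ g e = -inner ℝ (H s) e - M / 2 * ‖s‖ * inner ℝ s e := by
      have : g = -(M / 2 * ‖s‖) • s - H s := by rw [neg_smul, ← hfo]; abel
      rw [this, inner_sub_left, real_inner_smul_left]; ring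
    have h3 : inner ℝ s (H e) = inner ℝ (H s) e := (hH s e).symm
    have h4 : inner ℝ e (H s) = inner ℝ (H s) e := real_inner_comm _ _
    simp only [cubicModel, hnorm, map_add, map_smul, inner_add_left, inner_add_right,
      inner_smul_right, real_inner_smul_left, h2, h3, h4] at h1
    rw [hα] at h1
    have h5 : 0 ≤ α ^ 2 / 2 * (inner ℝ e (H e) + M / 2 * ‖s‖ * ‖e‖ ^ 2) := by linarith
    exact nonneg_of_mul_nonneg_right h5 (by positivity)
  by_cases hv : inner ℝ s v = 0
  · have h3 : Filter.Tendsto (fun t : ℝ => inner ℝ (v + t • s) (H (v + t • s))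
        + M / 2 * ‖s‖ * ‖v + t • s‖ ^ 2) (nhdsWithin 0 (Ioi 0))
        (nhds (inner ℝ (v + (0 : ℝ) • s) (H (v + (0 : ℝ) • s))
          + M / 2 * ‖s‖ * ‖v + (0 : ℝ) • s‖ ^ 2)) :=
      (Continuous.tendsto (by fun_prop) 0).mono_left nhdsWithin_le_nhds
    have h4 := ge_of_tendsto h3 (by
      filter_upwards [self_mem_nhdsWithin] with t ht
      refine key _ ?_
      rw [inner_add_right, hv, zero_add, inner_smul_right, real_inner_self_eq_norm_sq]
      have : 0 < t := ht
      have := norm_pos_iff.2 h0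
      positivity)
    simpa using h4
  · exact key v hv

/-- The first-order condition tested against `s` eliminates `g`; the second-order condition at `v =
s` bounds the remaining `-⟨s, H s⟩ / 2` by `M / 4 * ‖s‖ ^ 3`. -/
lemma cubicModel_le (hH : ∀ u v, inner ℝ (H u) v = inner ℝ u (H v))
    (hs : ∀ v, cubicModel g H M s ≤ cubicModel g H M v) :
    inner ℝ g s + 1 / 2 * inner ℝ s (H s) ≤ -(M / 4) * ‖s‖ ^ 3 := by
  have h1 := cubic_second_order hH hs s
  have h2 : inner ℝ g s = -inner ℝ s (H s) - M / 2 * ‖s‖ * ‖s‖ ^ 2 := by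
    have : g = -(M / 2 * ‖s‖) • s - H s := by
      rw [neg_smul, ← cubic_first_order hH hs]; abel
    rw [this, inner_sub_left, real_inner_smul_left, real_inner_self_eq_norm_sq,
      real_inner_comm (H s)]
    ring
  rw [h2]
  linarith

end Cubic

/-! ### Inexact cubic Newton with lazy Hessians -/

section LazyCubicNewton

/-- `m * (t / m)` is the start of the block of `t`, so an inner sum has fewer than `m` terms and the
power mean inequality costs `m ^ 2`. Each `j` occurs in fewer than `m` inner sums, which costs the
last factor `m`. -/
lemma sum_block_cube_le {u : ℕ → ℝ} (hu : ∀ t, 0 ≤ u t) {m : ℕ} (hm : 1 ≤ m) (n : ℕ) :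
    ∑ t ∈ Finset.range n, (∑ j ∈ Finset.Ico (m * (t / m)) t, u j) ^ 3 ≤
      (m : ℝ) ^ 3 * ∑ t ∈ Finset.range n, u t ^ 3 := by
  have hm0 : (0 : ℝ) < m := by exact_mod_cast hm
  have h1 : ∀ t ∈ Finset.range n, (∑ j ∈ Finset.Ico (m * (t / m)) t, u j) ^ 3 ≤
      (m : ℝ) ^ 2 * ∑ j ∈ Finset.range n, if j < t ∧ t < j + m then u j ^ 3 else 0 := by
    intro t ht
    have hc : (Finset.Ico (m * (t / m)) t).card ≤ m := by
      rw [Nat.card_Ico]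
      have := Nat.div_add_mod t m
      have := Nat.mod_lt t (show m > 0 by omega)
      omega
    have h2 : (∑ j ∈ Finset.Ico (m * (t / m)) t, u j) ^ 3 ≤
        ((Finset.Ico (m * (t / m)) t).card : ℝ) ^ 2 *
          ∑ j ∈ Finset.Ico (m * (t / m)) t, u j ^ 3 := by
      rcases Nat.eq_zero_or_pos (Finset.Ico (m * (t / m)) t).card with h0 | h0
      · rw [Finset.card_eq_zero] at h0; simp [h0]
      · have h3 := pow_sum_div_card_le_sum_pow (s := Finset.Ico (m * (t / m)) t) (f := u) (n := 2)
          (fun i _ => hu i)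
        rw [div_le_iff₀ (by positivity)] at h3
        linarith
    refine h2.trans ?_
    have hc' : ((Finset.Ico (m * (t / m)) t).card : ℝ) ^ 2 ≤ (m : ℝ) ^ 2 := by gcongr
    refine mul_le_mul hc' ?_ (Finset.sum_nonneg fun i _ => pow_nonneg (hu i) 3)
      (by positivity)
    rw [← Finset.sum_filter]
    refine Finset.sum_le_sum_of_subset_of_nonneg ?_ fun i _ _ => pow_nonneg (hu i) 3
    intro j hj
    rw [Finset.mem_Ico] at hj
    rw [Finset.mem_range] at ht
    rw [Finset.mem_filter, Finset.mem_range]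
    have := Nat.div_add_mod t m
    have := Nat.mod_lt t (show m > 0 by omega)
    omega
  refine (Finset.sum_le_sum h1).trans ?_
  rw [← Finset.mul_sum, Finset.sum_comm, show (m : ℝ) ^ 3 = m ^ 2 * m by ring, mul_assoc]
  refine mul_le_mul_of_nonneg_left ?_ (by positivity)
  rw [Finset.mul_sum]
  refine Finset.sum_le_sum fun j _ => ?_
  rw [← Finset.sum_filter, Finset.sum_const, nsmul_eq_mul]
  refine mul_le_mul_of_nonneg_right ?_ (pow_nonneg (hu j) 3)
  have : (Finset.filter (fun t => j < t ∧ t < j + m) (Finset.range n)) ⊆ Finset.Ioo j (j + m) := by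
    intro t ht
    rw [Finset.mem_filter] at ht
    exact Finset.mem_Ioo.2 ht.2
  have h2 := Finset.card_le_card this
  rw [Nat.card_Ioo] at h2
  exact_mod_cast h2.trans (by omega)

lemma norm_sub_snapshot_le {E : Type} [NormedAddCommGroup E] {x s : ℕ → E} {n : ℕ}
    (hx : ∀ t < n, x (t + 1) = x t + s t) {k t : ℕ} (hkt : k ≤ t) (htn : t ≤ n) :
    ‖x k - x t‖ ≤ ∑ j ∈ Finset.Ico k t, ‖s j‖ := by
  induction t, hkt using Nat.le_induction with
  | base => simp
  | succ t hkt ih =>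
    rw [Finset.sum_Ico_succ_top hkt, hx t (by omega)]
    have : x k - (x t + s t) = (x k - x t) - s t := by abel
    rw [this]
    exact (norm_sub_le _ _).trans (by gcongr; exact ih (by omega))

variable {d : ℕ} {V : Vec d → ℝ} {r M ε : ℝ}

lemma abs_inner_apply_le (A : Vec d →L[ℝ] Vec d) (v : Vec d) :
    |inner ℝ v (A v)| ≤ ‖A‖ * ‖v‖ ^ 2 :=
  (abs_real_inner_le_norm _ _).trans (by
    have := A.le_opNorm v
    nlinarith [norm_nonneg v])

/-- Descent of one inexact cubic step with gradient error `δg` and Hessian error `δH`. -/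
lemma cubic_step_descent (hV : ContDiff ℝ 2 V) (hr0 : 0 ≤ r)
    (hr : ∀ x x', ‖hess V x - hess V x'‖ ≤ r * ‖x - x'‖) {x s g : Vec d} {H : Vec d →L[ℝ] Vec d}
    (hH : ∀ u v, inner ℝ (H u) v = inner ℝ u (H v))
    (hs : ∀ v, cubicModel g H M s ≤ cubicModel g H M v) {δg δH : ℝ}
    (hg : ‖g - gradient V x‖ ≤ δg) (hδ : ‖H - hess V x‖ ≤ δH) :
    V (x + s) ≤ V x - M / 4 * ‖s‖ ^ 3 + δg * ‖s‖ + 1 / 2 * δH * ‖s‖ ^ 2 + r * ‖s‖ ^ 3 := by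
  have h1 := taylor_value hV hr0 hr x s
  have h2 := cubicModel_le hH hs
  have h3 : inner ℝ (gradient V x) s ≤ inner ℝ g s + δg * ‖s‖ := by
    have := (abs_le.1 (abs_real_inner_le_norm (g - gradient V x) s)).1
    rw [inner_sub_left] at this
    nlinarith [norm_nonneg s]
  have h4 : inner ℝ s (hess V x s) ≤ inner ℝ s (H s) + δH * ‖s‖ ^ 2 := by
    have := (abs_le.1 (abs_inner_apply_le (H - hess V x) s)).1
    rw [sub_apply, inner_sub_right] at this
    nlinarith [sq_nonneg ‖s‖]
  linarith

/-- If the test fails, the decrease is controlled by the cubes of `a = M ‖s‖` and `b = r D`. -/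
lemma failed_test_bounds {u D : ℝ} (hM : 0 < M) (hε : 0 < ε) (hr0 : 0 ≤ r) (hrM : 1000 * r ≤ M)
    (hu : 0 ≤ u) (hD : 0 ≤ D)
    (htest : ¬ (1 / M * (288 / 287) ^ 2 * ((M + 2 * r) / √2 * u + r * D) ^ 2 ≤ ε)) :
    √(M * ε) ^ 3 ≤ 2 * (M * u) ^ 3 + 5 * (r * D) ^ 3 ∧
    M ^ 2 * (ε / 576 * u + 1 / 2 * (√(M * ε) / 288 + r * D) * u ^ 2 + r * u ^ 3) ≤
      1 / 20 * (M * u) ^ 3 + 2000 * (r * D) ^ 3 := by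
  set e := √(M * ε) with he
  have he2 : e ^ 2 = M * ε := Real.sq_sqrt (by positivity)
  have he0 : 0 ≤ e := Real.sqrt_nonneg _
  set a := M * u with ha
  set b := r * D with hb
  have ha0 : 0 ≤ a := by positivity
  have hb0 : 0 ≤ b := by positivity
  have hsq : (1414 / 1000 : ℝ) ≤ √2 := by
    apply Real.le_sqrt_of_sq_le; norm_num
  have hP : (M + 2 * r) / √2 * u + r * D ≤ 71 / 100 * a + b := by
    have : (M + 2 * r) / √2 ≤ 71 / 100 * M := by
      rw [div_le_iff₀ (by positivity)]
      nlinarith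
    rw [ha, hb]
    nlinarith
  have hP0 : 0 ≤ (M + 2 * r) / √2 * u + r * D := by positivity
  -- The failed test bounds `e` by `288 / 287` times the expression in `hP`; 0.72 and 1.01 leave
  -- room for that factor.
  have hle : e ≤ 72 / 100 * a + 101 / 100 * b := by
    rw [not_le, mul_assoc, one_div, lt_inv_mul_iff₀ hM, ← he2, ← mul_pow] at htest
    have := (lt_of_pow_lt_pow_left₀ 2 (by positivity) htest).le
    linarith
  have hab1 : a * b ^ 2 ≤ (a ^ 3 + 2 * b ^ 3) / 3 := by
    nlinarith [mul_nonneg (add_nonneg ha0 (add_nonneg hb0 hb0)) (sq_nonneg (a - b))]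
  have hab2 : a ^ 2 * b ≤ (2 * a ^ 3 + b ^ 3) / 3 := by
    nlinarith [mul_nonneg (add_nonneg hb0 (add_nonneg ha0 ha0)) (sq_nonneg (a - b))]
  -- AM-GM weighted by 100: only `1 / 300` of `a ^ 3` is spent on `a ^ 2 * b / 2`, at the price of a
  -- large multiple of `b ^ 3`, which the drift estimate makes harmless.
  have hab3 : a ^ 2 * b ≤ (2 * a ^ 3 + 1000000 * b ^ 3) / 300 := by
    nlinarith [mul_nonneg (add_nonneg (mul_nonneg (by norm_num : (0:ℝ) ≤ 100) hb0)
      (add_nonneg ha0 ha0)) (sq_nonneg (a - 100 * b))]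
  constructor
  · calc e ^ 3 ≤ (72 / 100 * a + 101 / 100 * b) ^ 3 := by gcongr
      _ ≤ 2 * a ^ 3 + 5 * b ^ 3 := by
        have : (72 / 100 * a + 101 / 100 * b) ^ 3 = (72/100)^3 * a ^ 3
          + 3 * (72/100)^2*(101/100) * (a ^ 2 * b) + 3 * (72/100) * (101/100)^2 * (a * b ^ 2)
          + (101/100)^3 * b ^ 3 := by ring
        rw [this]
        nlinarith [pow_nonneg ha0 3, pow_nonneg hb0 3]
  · have e1 : M ^ 2 * (ε / 576 * u + 1 / 2 * (e / 288 + b) * u ^ 2 + r * u ^ 3) =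
        (e ^ 2 * a) / 576 + (e * a ^ 2) / 576 + 1 / 2 * (a ^ 2 * b) + r * (a ^ 2 * u) := by
      rw [he2, ha]; ring
    rw [e1]
    have i1 : e ^ 2 * a ≤ 2 * a ^ 3 + 2 * b ^ 3 := by
      have h1 : e ^ 2 ≤ (72 / 100 * a + 101 / 100 * b) ^ 2 := by gcongr
      have h2 := mul_le_mul_of_nonneg_right h1 ha0
      have h3 : (72 / 100 * a + 101 / 100 * b) ^ 2 * a = (72/100)^2 * a ^ 3
        + 2 * (72/100) * (101/100) * (a ^ 2 * b) + (101/100)^2 * (a * b ^ 2) := by ring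
      nlinarith [pow_nonneg ha0 3, pow_nonneg hb0 3]
    have i2 : e * a ^ 2 ≤ 2 * a ^ 3 + 2 * b ^ 3 := by
      have h2 := mul_le_mul_of_nonneg_right hle (sq_nonneg a)
      have h3 : (72 / 100 * a + 101 / 100 * b) * a ^ 2 = 72 / 100 * a ^ 3
        + 101 / 100 * (a ^ 2 * b) := by ring
      nlinarith [pow_nonneg ha0 3, pow_nonneg hb0 3]
    have i3 : r * (a ^ 2 * u) ≤ 1 / 1000 * a ^ 3 := by
      have : r * (a ^ 2 * u) ≤ M / 1000 * (a ^ 2 * u) := by gcongr; linarith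
      refine this.trans_eq ?_
      rw [ha]; ring
    nlinarith [pow_nonneg ha0 3, pow_nonneg hb0 3]

variable {m n : ℕ} {x s g : ℕ → Vec d} {H : ℕ → Vec d →L[ℝ] Vec d}

/-- While the stopping test of lazy cubic Newton fails, the objective decreases by a multiple of
`∑ ‖s‖³`, which in turn bounds the number of steps. -/
lemma lazy_cubic_descent (hV : ContDiff ℝ 2 V) (hr0 : 0 ≤ r)
    (hr : ∀ x x', ‖hess V x - hess V x'‖ ≤ r * ‖x - x'‖) (hm : 1 ≤ m) (hM : 0 < M)
    (hrM : 1000 * (m * r) ≤ M) (hε : 0 < ε)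
    (hx : ∀ t < n, x (t + 1) = x t + s t)
    (hsym : ∀ t < n, ∀ u v, inner ℝ (H t u) v = inner ℝ u (H t v))
    (hmin : ∀ t < n, ∀ v, cubicModel (g t) (H t) M (s t) ≤ cubicModel (g t) (H t) M v)
    (hg : ∀ t < n, ‖g t - gradient V (x t)‖ ≤ ε / 576)
    (hH : ∀ t < n, ‖H t - hess V (x (m * (t / m)))‖ ≤ √(M * ε) / 288)
    (htest : ∀ t < n, ¬ (1 / M * (288 / 287) ^ 2 *
      ((M + 2 * r) / √2 * ‖s t‖ + r * ‖x (m * (t / m)) - x t‖) ^ 2 ≤ ε)) :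
    n * √(M * ε) ^ 3 ≤ 18 * M ^ 2 * (V (x 0) - V (x n)) ∧
      M * ∑ t ∈ Finset.range n, ‖s t‖ ^ 3 ≤ 6 * (V (x 0) - V (x n)) := by
  have hm1 : (1 : ℝ) ≤ m := by exact_mod_cast hm
  have hrM' : 1000 * r ≤ M := by nlinarith
  set D : ℕ → ℝ := fun t => ‖x (m * (t / m)) - x t‖ with hD
  -- The model decrease `1 / 4` minus the error share `1 / 20` leaves `1 / 5`.
  have hstep : ∀ t ∈ Finset.range n, 1 / 5 * (M * ‖s t‖) ^ 3 - 2000 * (r * D t) ^ 3 ≤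
      M ^ 2 * (V (x t) - V (x (t + 1))) := by
    intro t ht
    rw [Finset.mem_range] at ht
    have h1 : ‖H t - hess V (x t)‖ ≤ √(M * ε) / 288 + r * D t := by
      have e : H t - hess V (x t) = (H t - hess V (x (m * (t / m))))
        + (hess V (x (m * (t / m))) - hess V (x t)) := by abel
      rw [e]
      exact (norm_add_le _ _).trans (add_le_add (hH t ht) (hr _ _))
    have h2 := cubic_step_descent hV hr0 hr (hsym t ht) (hmin t ht) (hg t ht) h1
    have h3 : M ^ 2 * (ε / 576 * ‖s t‖ + 1 / 2 * (√(M * ε) / 288 + r * D t) * ‖s t‖ ^ 2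
        + r * ‖s t‖ ^ 3) ≤ 1 / 20 * (M * ‖s t‖) ^ 3 + 2000 * (r * D t) ^ 3 :=
      (failed_test_bounds hM hε hr0 hrM' (norm_nonneg (s t)) (norm_nonneg _) (htest t ht)).2
    rw [← hx t ht] at h2
    have h4 : M ^ 2 * (M / 4 * ‖s t‖ ^ 3 - (ε / 576 * ‖s t‖
        + 1 / 2 * (√(M * ε) / 288 + r * D t) * ‖s t‖ ^ 2 + r * ‖s t‖ ^ 3)) ≤
        M ^ 2 * (V (x t) - V (x (t + 1))) :=
      mul_le_mul_of_nonneg_left (by linarith) (by positivity)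
    linarith
  have hcount : ∀ t ∈ Finset.range n,
      √(M * ε) ^ 3 ≤ 2 * (M * ‖s t‖) ^ 3 + 5 * (r * D t) ^ 3 := fun t ht =>
    (failed_test_bounds hM hε hr0 hrM' (norm_nonneg (s t)) (norm_nonneg _)
      (htest t (Finset.mem_range.1 ht))).1
  -- The drift is at most the sum of the steps since the snapshot. As `m * r ≤ M / 1000`, its cubes
  -- sum to a `1e-9` fraction of the step cubes, so the stale Hessian costs almost nothing in either
  -- bound.
  have hDsum : ∑ t ∈ Finset.range n, (r * D t) ^ 3 ≤
      1 / 1000000000 * ∑ t ∈ Finset.range n, (M * ‖s t‖) ^ 3 := by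
    have h1 : ∑ t ∈ Finset.range n, D t ^ 3 ≤
        (m : ℝ) ^ 3 * ∑ t ∈ Finset.range n, ‖s t‖ ^ 3 := by
      refine le_trans (Finset.sum_le_sum fun t ht => ?_)
        (sum_block_cube_le (fun t => norm_nonneg (s t)) hm n)
      have := norm_sub_snapshot_le hx (Nat.mul_div_le t m) (Finset.mem_range.1 ht).le
      gcongr
    simp only [mul_pow, ← Finset.mul_sum]
    have h0 : 0 ≤ ∑ t ∈ Finset.range n, ‖s t‖ ^ 3 :=
      Finset.sum_nonneg fun _ _ => by positivity
    have h2 : (m * r) ^ 3 ≤ (M / 1000) ^ 3 := by gcongr; linarith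
    calc r ^ 3 * ∑ t ∈ Finset.range n, D t ^ 3
        ≤ r ^ 3 * ((m : ℝ) ^ 3 * ∑ t ∈ Finset.range n, ‖s t‖ ^ 3) := by gcongr
      _ = (m * r) ^ 3 * ∑ t ∈ Finset.range n, ‖s t‖ ^ 3 := by ring
      _ ≤ (M / 1000) ^ 3 * ∑ t ∈ Finset.range n, ‖s t‖ ^ 3 := by gcongr
      _ = _ := by ring
  have hS0 : 0 ≤ ∑ t ∈ Finset.range n, (M * ‖s t‖) ^ 3 :=
    Finset.sum_nonneg fun _ _ => by positivity
  have hsum := Finset.sum_le_sum hstep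
  rw [Finset.sum_sub_distrib, ← Finset.mul_sum, ← Finset.mul_sum, ← Finset.mul_sum,
    Finset.sum_range_sub'] at hsum
  have hsum2 := Finset.sum_le_sum hcount
  rw [Finset.sum_const, Finset.card_range, nsmul_eq_mul, Finset.sum_add_distrib, ← Finset.mul_sum,
    ← Finset.mul_sum] at hsum2
  constructor
  · linarith
  · have h1 : ∑ t ∈ Finset.range n, (M * ‖s t‖) ^ 3 =
        M ^ 2 * (M * ∑ t ∈ Finset.range n, ‖s t‖ ^ 3) := by
      simp only [mul_pow, ← Finset.mul_sum]; ring
    rw [h1] at hsum hDsum hS0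
    have h2 : M ^ 2 * (M * ∑ t ∈ Finset.range n, ‖s t‖ ^ 3) ≤
        M ^ 2 * (6 * (V (x 0) - V (x n))) := by linarith
    exact le_of_mul_le_mul_left h2 (by positivity)

/-- An inexact cubic step that passes the stopping test ends at a second-order stationary
point. -/
lemma cubic_step_stationary (hV : ContDiff ℝ 2 V) (hr0 : 0 ≤ r)
    (hr : ∀ x x', ‖hess V x - hess V x'‖ ≤ r * ‖x - x'‖) (hM : 0 < M)
    (hrM : 1000 * r ≤ M) (hε : 0 < ε) {x s g x₀ : Vec d} {H : Vec d →L[ℝ] Vec d}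
    (hH : ∀ u v, inner ℝ (H u) v = inner ℝ u (H v))
    (hs : ∀ v, cubicModel g H M s ≤ cubicModel g H M v)
    (hg : ‖g - gradient V x‖ ≤ ε / 576) (hδ : ‖H - hess V x₀‖ ≤ √(M * ε) / 288)
    (htest : 1 / M * (288 / 287) ^ 2 *
      ((M + 2 * r) / √2 * ‖s‖ + r * ‖x₀ - x‖) ^ 2 ≤ ε) :
    ‖gradient V (x + s)‖ ≤ 4 * ε ∧
      ∀ v, -(2 * √(M * ε)) * ‖v‖ ^ 2 ≤ inner ℝ v (hess V (x + s) v) := by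
  set e := √(M * ε) with he
  have he2 : e ^ 2 = M * ε := Real.sq_sqrt (by positivity)
  have he0 : 0 ≤ e := Real.sqrt_nonneg _
  set u := ‖s‖ with hu
  have hu0 : 0 ≤ u := norm_nonneg _
  set D := ‖x₀ - x‖ with hD
  have hD0 : 0 ≤ D := norm_nonneg _
  have hP : (M + 2 * r) / √2 * u + r * D ≤ e := by
    rw [mul_assoc, one_div, inv_mul_le_iff₀ hM, ← he2, ← mul_pow] at htest
    have h1 := le_of_sq_le_sq htest he0
    have h2 : 0 ≤ (M + 2 * r) / √2 * u + r * D := by positivity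
    linarith
  have hsq : √2 ≤ (1415 / 1000 : ℝ) := by
    rw [Real.sqrt_le_left (by norm_num)]; norm_num
  have hMu : M * u ≤ 1415 / 1000 * e := by
    have h1 : M / √2 * u ≤ e := by
      refine le_trans ?_ hP
      have : M / √2 * u ≤ (M + 2 * r) / √2 * u := by gcongr; linarith
      nlinarith [mul_nonneg hr0 hD0]
    have h2 : M * u = √2 * (M / √2 * u) := by field_simp
    rw [h2]
    exact mul_le_mul hsq h1 (by positivity) (by norm_num)
  have hrD : r * D ≤ e := by
    have : 0 ≤ (M + 2 * r) / √2 * u := by positivity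
    linarith
  have hru : r * u ≤ 1 / 500 * e := by nlinarith
  have hHx : ‖H - hess V x‖ ≤ e / 288 + r * D := by
    have e : H - hess V x = (H - hess V x₀) + (hess V x₀ - hess V x) := by abel
    rw [e]
    exact (norm_add_le _ _).trans (add_le_add hδ (hr _ _))
  constructor
  · have h1 := taylor_gradient hV hr x s
    have h2 : ‖g + H s‖ = |M| / 2 * u ^ 2 := by
      rw [cubic_first_order hH hs, norm_neg, norm_smul, Real.norm_eq_abs, abs_mul, abs_div,
        abs_norm, abs_two]; ring
    rw [abs_of_pos hM] at h2
    -- The new gradient is the Taylor remainder plus the residual `g + H s`, whose norm is `M / 2 *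
    -- ‖s‖ ^ 2`, minus the two estimation errors.
    have h3 : gradient V (x + s) = (gradient V (x + s) - gradient V x - hess V x s)
      + (g + H s) - (g - gradient V x) - (H - hess V x) s := by
      rw [sub_apply]; abel
    have h4 : ‖gradient V (x + s)‖ ≤ r * u ^ 2 + M / 2 * u ^ 2 + ε / 576
        + (e / 288 + r * D) * u := by
      rw [h3]
      refine (norm_sub_le _ _).trans (add_le_add ((norm_sub_le _ _).trans (add_le_add
        ((norm_add_le _ _).trans (add_le_add h1 h2.le)) hg)) ?_)
      exact ((H - hess V x).le_opNorm s).trans (by gcongr)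
    refine h4.trans ?_
    have h5 : M * (r * u ^ 2 + M / 2 * u ^ 2 + ε / 576 + (e / 288 + r * D) * u) ≤ M * (4 * ε) := by
      have j1 : (M * u) ^ 2 ≤ (1415 / 1000 * e) ^ 2 := by gcongr
      have j2 : (r * u) * (M * u) ≤ (1 / 500 * e) * (1415 / 1000 * e) := by gcongr
      have j3 : (e / 288 + r * D) * (M * u) ≤ (e / 288 + e) * (1415 / 1000 * e) := by gcongr
      nlinarith [sq_nonneg e]
    exact le_of_mul_le_mul_left h5 hM
  · intro v
    have h1 := cubic_second_order hH hs v
    have h2 : ‖H - hess V (x + s)‖ ≤ e / 288 + r * D + r * u := by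
      have e : H - hess V (x + s) = (H - hess V x) + (hess V x - hess V (x + s)) := by abel
      rw [e]
      refine (norm_add_le _ _).trans (add_le_add hHx ((hr _ _).trans_eq ?_))
      rw [sub_add_cancel_left, norm_neg]
    have h3 := (abs_le.1 (abs_inner_apply_le (H - hess V (x + s)) v)).2
    rw [sub_apply, inner_sub_right] at h3
    have h4 : ‖H - hess V (x + s)‖ * ‖v‖ ^ 2 ≤ (e / 288 + r * D + r * u) * ‖v‖ ^ 2 := by gcongr
    have h5 : (M / 2 * u + (e / 288 + r * D + r * u)) * ‖v‖ ^ 2 ≤ (2 * e) * ‖v‖ ^ 2 := by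
      gcongr; linarith
    linarith

end LazyCubicNewton

open ContinuousLinearMap

/-! ### Schur complements and their perturbation -/

section Schur

lemma norm_adjoint_le {E F : Type} [NormedAddCommGroup E] [InnerProductSpace ℝ E] [CompleteSpace E]
    [NormedAddCommGroup F] [InnerProductSpace ℝ F] [CompleteSpace F] {j : E →L[ℝ] F}
    (hj : ‖j‖ ≤ 1) : ‖adjoint j‖ ≤ 1 := by
  rwa [LinearIsometryEquiv.norm_map]

variable {X Y P : Type} [NormedAddCommGroup X] [InnerProductSpace ℝ X] [CompleteSpace X]
  [NormedAddCommGroup Y] [InnerProductSpace ℝ Y] [CompleteSpace Y] [FiniteDimensional ℝ Y]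
  [NormedAddCommGroup P] [InnerProductSpace ℝ P] [CompleteSpace P]

lemma coercive_antilipschitz {B : Y →L[ℝ] Y} {m : ℝ}
    (hB : ∀ v, m * ‖v‖ ^ 2 ≤ inner ℝ (B v) v) (v : Y) : m * ‖v‖ ≤ ‖B v‖ := by
  rcases eq_or_ne v 0 with rfl | hv
  · simp
  · have h1 := (hB v).trans (real_inner_le_norm (B v) v)
    rw [sq, ← mul_assoc] at h1
    exact le_of_mul_le_mul_right h1 (norm_pos_iff.2 hv)

/-- Injectivity suffices in finite dimension. It also ensures that `ContinuousLinearMap.inverse`,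
zero at non-invertible operators, is here a true inverse. -/
lemma coercive_exists_equiv {B : Y →L[ℝ] Y} {m : ℝ} (hm : 0 < m)
    (hB : ∀ v, m * ‖v‖ ^ 2 ≤ inner ℝ (B v) v) : ∃ e : Y ≃L[ℝ] Y, (e : Y →L[ℝ] Y) = B := by
  have hinj : Function.Injective (B : Y →ₗ[ℝ] Y) := by
    rw [← LinearMap.ker_eq_bot, LinearMap.ker_eq_bot']
    intro v hv
    have h1 := coercive_antilipschitz hB v
    have h2 : B v = 0 := hv
    rw [h2, norm_zero] at h1
    exact norm_le_zero_iff.1 (nonpos_of_mul_nonpos_right h1 hm)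
  refine ⟨(LinearEquiv.ofInjectiveEndo (B : Y →ₗ[ℝ] Y) hinj).toContinuousLinearEquiv, ?_⟩
  ext v
  simp

lemma coercive_opNorm_le {B : Y →L[ℝ] Y} {m : ℝ} (hm : 0 < m)
    (hB : ∀ v, m * ‖v‖ ^ 2 ≤ inner ℝ (B v) v) (D : X →L[ℝ] Y) : m * ‖D‖ ≤ ‖B ∘L D‖ := by
  rw [← le_div_iff₀' hm]
  refine D.opNorm_le_bound (by positivity) fun u => ?_
  have h1 := coercive_antilipschitz hB (D u)
  have h2 := (B ∘L D).le_opNorm u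
  rw [div_mul_eq_mul_div, le_div_iff₀' hm]
  exact h1.trans h2

/-- The block `j† A j`. -/
def yyBlock (j : Y →L[ℝ] P) (A : P →L[ℝ] P) : Y →L[ℝ] Y := adjoint j ∘L A ∘L j

/-- The solution operator `-(j† A j)⁻¹ j† A i`. -/
def implicitDeriv (i : X →L[ℝ] P) (j : Y →L[ℝ] P) (A : P →L[ℝ] P) : X →L[ℝ] Y :=
  -((yyBlock j A).inverse ∘L adjoint j ∘L A ∘L i)

/-- The derivative `i - j (j† A j)⁻¹ j† A i` of the graph of an implicit function. -/
def graphDeriv (i : X →L[ℝ] P) (j : Y →L[ℝ] P) (A : P →L[ℝ] P) : X →L[ℝ] P :=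
  i + j ∘L implicitDeriv i j A

variable {i : X →L[ℝ] P} {j : Y →L[ℝ] P} {A A' : P →L[ℝ] P} {m K : ℝ}

lemma yyBlock_coercive (hA : ∀ v, m * ‖v‖ ^ 2 ≤ inner ℝ (A (j v)) (j v)) (v : Y) :
    m * ‖v‖ ^ 2 ≤ inner ℝ (yyBlock j A v) v := by
  simpa [yyBlock, adjoint_inner_left] using hA v

/-- The correction along `j` is chosen so that `A` sends graph directions into the orthogonal
complement of the range of `j`. The later estimates rest on this orthogonality rather than on bounds
for differences of inverses. -/
lemma adjoint_comp_graphDeriv (hm : 0 < m) (hA : ∀ v, m * ‖v‖ ^ 2 ≤ inner ℝ (A (j v)) (j v)) :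
    adjoint j ∘L A ∘L graphDeriv i j A = 0 := by
  obtain ⟨e, he⟩ := coercive_exists_equiv hm (yyBlock_coercive hA)
  have h2 : ∀ w, adjoint j (A (j w)) = e w := fun w => by
    have := DFunLike.congr_fun he w
    simpa [yyBlock] using this.symm
  ext u
  simp [graphDeriv, implicitDeriv, ← he, h2]

lemma inner_graphDeriv (hm : 0 < m) (hA : ∀ v, m * ‖v‖ ^ 2 ≤ inner ℝ (A (j v)) (j v)) (u : X)
    (v : Y) : inner ℝ (A (graphDeriv i j A u)) (j v) = 0 := by
  rw [← adjoint_inner_left]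
  have := DFunLike.congr_fun (adjoint_comp_graphDeriv (i := i) hm hA) u
  simp only [ContinuousLinearMap.comp_apply, zero_apply] at this
  rw [this, inner_zero_left]

lemma norm_implicitDeriv_le (hi : ‖i‖ ≤ 1) (hj : ‖j‖ ≤ 1) (hm : 0 < m)
    (hA : ∀ v, m * ‖v‖ ^ 2 ≤ inner ℝ (A (j v)) (j v)) (hK : ‖A‖ ≤ K) :
    ‖implicitDeriv i j A‖ ≤ K / m := by
  rw [le_div_iff₀' hm]
  refine (coercive_opNorm_le hm (yyBlock_coercive hA) _).trans ?_
  have h1 := adjoint_comp_graphDeriv (i := i) hm hA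
  have h2 : yyBlock j A ∘L implicitDeriv i j A = -(adjoint j ∘L A ∘L i) := by
    rw [eq_neg_iff_add_eq_zero, ← h1]
    ext u
    simp [graphDeriv, yyBlock, add_comm]
  rw [h2, norm_neg]
  have h3 := (opNorm_comp_le (adjoint j) (A ∘L i)).trans
    (mul_le_mul (norm_adjoint_le hj) (opNorm_comp_le A i) (norm_nonneg _) zero_le_one)
  have := norm_nonneg A
  nlinarith [norm_nonneg i]

lemma norm_graphDeriv_le (hi : ‖i‖ ≤ 1) (hj : ‖j‖ ≤ 1) (hm : 0 < m)
    (hA : ∀ v, m * ‖v‖ ^ 2 ≤ inner ℝ (A (j v)) (j v)) (hK : ‖A‖ ≤ K) :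
    ‖graphDeriv i j A‖ ≤ 1 + K / m := by
  refine (norm_add_le _ _).trans (add_le_add hi ((opNorm_comp_le _ _).trans ?_))
  have := norm_implicitDeriv_le hi hj hm hA hK
  calc ‖j‖ * ‖implicitDeriv i j A‖ ≤ 1 * (K / m) := by gcongr
    _ = _ := one_mul _

/-- Perturbation bound for the Schur complement `i† A Z(A)`. -/
lemma schur_sub_le (hi : ‖i‖ ≤ 1) (hj : ‖j‖ ≤ 1) (hm : 0 < m)
    (hA : ∀ v, m * ‖v‖ ^ 2 ≤ inner ℝ (A (j v)) (j v)) (hK : ‖A‖ ≤ K)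
    (hA' : ∀ v, m * ‖v‖ ^ 2 ≤ inner ℝ (A' (j v)) (j v)) (hK' : ‖A'‖ ≤ K)
    (hs' : ∀ u v, inner ℝ (A' u) v = inner ℝ u (A' v)) :
    ‖adjoint i ∘L A ∘L graphDeriv i j A - adjoint i ∘L A' ∘L graphDeriv i j A'‖ ≤
      ‖A - A'‖ * (1 + K / m) ^ 2 := by
  -- By orthogonality to the range of `j`, the outer `i` may be replaced by the other graph
  -- operator; self-adjointness of `A'` does the same on the inner side. The difference becomes
  -- linear in `A - A'`.
  have key : adjoint i ∘L A ∘L graphDeriv i j A - adjoint i ∘L A' ∘L graphDeriv i j A' =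
      adjoint (graphDeriv i j A') ∘L (A - A') ∘L graphDeriv i j A := by
    ext1 u
    refine ext_inner_right ℝ fun v => ?_
    have hv : ∀ B : P →L[ℝ] P, graphDeriv i j B v = i v + j (implicitDeriv i j B v) := fun B => rfl
    have h1 : inner ℝ (A (graphDeriv i j A u)) (i v) =
        inner ℝ (A (graphDeriv i j A u)) (graphDeriv i j A' v) := by
      rw [hv A', inner_add_right, inner_graphDeriv hm hA, add_zero]
    have h2 : inner ℝ (A' (graphDeriv i j A' u)) (i v) =
        inner ℝ (A' (graphDeriv i j A u)) (graphDeriv i j A' v) := by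
      have e1 : inner ℝ (A' (graphDeriv i j A' u)) (i v) =
          inner ℝ (A' (graphDeriv i j A' u)) (graphDeriv i j A' v) := by
        rw [hv A', inner_add_right, inner_graphDeriv hm hA', add_zero]
      have e2 : inner ℝ (A' (graphDeriv i j A u)) (graphDeriv i j A' v) =
          inner ℝ (A' (graphDeriv i j A' v)) (i u) := by
        rw [hs', real_inner_comm]
        change inner ℝ _ (i u + j (implicitDeriv i j A u)) = _
        rw [inner_add_right, inner_graphDeriv hm hA', add_zero]
      have e3 : inner ℝ (A' (graphDeriv i j A' u)) (graphDeriv i j A' v) =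
          inner ℝ (A' (graphDeriv i j A' v)) (i u) := by
        rw [hs', real_inner_comm]
        change inner ℝ _ (i u + j (implicitDeriv i j A' u)) = _
        rw [inner_add_right, inner_graphDeriv hm hA', add_zero]
      rw [e1, e2, e3]
    simp only [sub_apply, ContinuousLinearMap.comp_apply, inner_sub_left, adjoint_inner_left, h1, h2]
  rw [key]
  have hK0 : 0 ≤ K := (norm_nonneg _).trans hK
  have z1 := norm_graphDeriv_le hi hj hm hA hK
  have z2 := norm_graphDeriv_le hi hj hm hA' hK'
  calc _ ≤ ‖adjoint (graphDeriv i j A')‖ * (‖A - A'‖ * ‖graphDeriv i j A‖) :=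
        (opNorm_comp_le _ _).trans (by gcongr; exact opNorm_comp_le _ _)
    _ ≤ (1 + K / m) * (‖A - A'‖ * (1 + K / m)) := by
        rw [LinearIsometryEquiv.norm_map]; gcongr
    _ = _ := by ring

lemma norm_comp_sub_comp_le {E F G : Type} [NormedAddCommGroup E] [NormedSpace ℝ E]
    [NormedAddCommGroup F] [NormedSpace ℝ F] [NormedAddCommGroup G] [NormedSpace ℝ G]
    {A A' : F →L[ℝ] G} {B B' : E →L[ℝ] F} {a b la lb : ℝ} (hla : ‖A - A'‖ ≤ la)
    (hb : ‖B‖ ≤ b) (ha : ‖A'‖ ≤ a) (hlb : ‖B - B'‖ ≤ lb) :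
    ‖A ∘L B - A' ∘L B'‖ ≤ la * b + a * lb := by
  have e : A ∘L B - A' ∘L B' = (A - A') ∘L B + A' ∘L (B - B') := by ext; simp
  rw [e]
  have h1 := (norm_nonneg _).trans hla
  have h2 := (norm_nonneg _).trans ha
  exact (norm_add_le _ _).trans (add_le_add
    ((opNorm_comp_le _ _).trans (by gcongr)) ((opNorm_comp_le _ _).trans (by gcongr)))

end Schur

/-! ### Solution maps of strongly monotone equations -/

section Implicit

variable {X Y P : Type} [NormedAddCommGroup X] [InnerProductSpace ℝ X] [CompleteSpace X]
  [NormedAddCommGroup Y] [InnerProductSpace ℝ Y] [CompleteSpace Y] [FiniteDimensional ℝ Y]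
  [NormedAddCommGroup P] [InnerProductSpace ℝ P] [CompleteSpace P]

/-- `y` solves `j† Γ(i x + j (y x)) = 0`, where `Γ` has the bounded derivative `A` and
is strongly monotone along `j`. -/
structure ImplicitSolution (i : X →L[ℝ] P) (j : Y →L[ℝ] P) (Γ : P → P) (A : P → P →L[ℝ] P)
    (m K : ℝ) (y : X → Y) : Prop where
  norm_i : ‖i‖ ≤ 1
  norm_j : ‖j‖ ≤ 1
  m_pos : 0 < m
  deriv : ∀ p, HasFDerivAt Γ (A p) p
  bound : ∀ p, ‖A p‖ ≤ K
  mono : ∀ p v, m * ‖v‖ ^ 2 ≤ inner ℝ (Γ (p + j v) - Γ p) (j v)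
  crit : ∀ x v, inner ℝ (Γ (i x + j (y x))) (j v) = 0

namespace ImplicitSolution

variable {i : X →L[ℝ] P} {j : Y →L[ℝ] P} {Γ : P → P} {A : P → P →L[ℝ] P} {m K : ℝ} {y : X → Y}

lemma coercive (S : ImplicitSolution i j Γ A m K y) (p : P) (v : Y) :
    m * ‖v‖ ^ 2 ≤ inner ℝ (A p (j v)) (j v) := by
  have h0 : HasFDerivAt Γ (A p) (p + j 0) := by simpa using S.deriv p
  have h1 : HasFDerivAt (fun w => p + j w) j 0 := (j.hasFDerivAt).const_add p
  have h2 : HasFDerivAt (fun w => adjoint j (Γ (p + j w))) (yyBlock j (A p)) 0 :=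
    ((adjoint j).hasFDerivAt.comp _ (h0.comp (0 : Y) h1))
  have := coercive_of_strongly_mono (G := fun w => adjoint j (Γ (p + j w))) (m := m)
    (fun w w' => by
      have := S.mono (p + j w') (w - w')
      rw [← map_sub, adjoint_inner_left]
      simpa [add_assoc] using this) h2 v
  simpa [yyBlock, adjoint_inner_left] using this

lemma K_nonneg (S : ImplicitSolution i j Γ A m K y) : 0 ≤ K :=
  (norm_nonneg _).trans (S.bound 0)

lemma norm_i_le (S : ImplicitSolution i j Γ A m K y) (u : X) : ‖i u‖ ≤ ‖u‖ :=
  (i.le_of_opNorm_le S.norm_i u).trans_eq (one_mul _)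

lemma norm_j_le (S : ImplicitSolution i j Γ A m K y) (v : Y) : ‖j v‖ ≤ ‖v‖ :=
  (j.le_of_opNorm_le S.norm_j v).trans_eq (one_mul _)

lemma lipschitz_field (S : ImplicitSolution i j Γ A m K y) (p q : P) :
    ‖Γ p - Γ q‖ ≤ K * ‖p - q‖ :=
  convex_univ.norm_image_sub_le_of_norm_hasFDerivWithin_le
    (fun p _ => (S.deriv p).hasFDerivWithinAt) (fun p _ => S.bound p) (mem_univ q) (mem_univ p)

/-- Both equations hold, so the field at `(x, y x')` tested against `y x - y x'` only sees its
change from `(x', y x')`, which is at most `K * ‖x - x'‖`; strong monotonicity bounds the same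
pairing from below. -/
lemma norm_sub_le (S : ImplicitSolution i j Γ A m K y) (x x' : X) :
    ‖y x - y x'‖ ≤ K / m * ‖x - x'‖ := by
  set v := y x - y x' with hv
  have e : i x + j (y x') + j v = i x + j (y x) := by rw [hv, map_sub]; abel
  have h1 := S.mono (i x + j (y x')) v
  rw [e, inner_sub_left, S.crit, zero_sub] at h1
  have h2 : -inner ℝ (Γ (i x + j (y x'))) (j v) =
      inner ℝ (Γ (i x' + j (y x')) - Γ (i x + j (y x'))) (j v) := by
    rw [inner_sub_left, S.crit, zero_sub]
  rw [h2] at h1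
  have h3 := S.lipschitz_field (i x' + j (y x')) (i x + j (y x'))
  rw [add_sub_add_right_eq_sub, ← map_sub] at h3
  have h4 : m * ‖v‖ ^ 2 ≤ (K * ‖x - x'‖) * ‖v‖ := by
    refine h1.trans ((real_inner_le_norm _ _).trans ?_)
    have := S.K_nonneg
    rw [norm_sub_rev x x']
    exact mul_le_mul (h3.trans (by gcongr; exact S.norm_i_le _)) (S.norm_j_le v) (norm_nonneg _)
      (by positivity)
  rw [div_mul_eq_mul_div, le_div_iff₀' S.m_pos]
  rcases (norm_nonneg v).eq_or_lt with h0 | h0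
  · rw [← h0, mul_zero]
    exact mul_nonneg S.K_nonneg (norm_nonneg _)
  · rw [sq, ← mul_assoc] at h4
    exact le_of_mul_le_mul_right h4 h0

lemma graph_norm_sub_le (S : ImplicitSolution i j Γ A m K y) (x x' : X) :
    ‖(i x + j (y x)) - (i x' + j (y x'))‖ ≤ (1 + K / m) * ‖x - x'‖ := by
  have e : (i x + j (y x)) - (i x' + j (y x')) = i (x - x') + j (y x - y x') := by
    rw [map_sub, map_sub]; abel
  rw [e, add_mul, one_mul]
  exact (norm_add_le _ _).trans (add_le_add (S.norm_i_le _)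
    ((S.norm_j_le _).trans (S.norm_sub_le x x')))

lemma continuous (S : ImplicitSolution i j Γ A m K y) : Continuous y :=
  (LipschitzWith.of_dist_le_mul (K := ⟨K / m, div_nonneg S.K_nonneg S.m_pos.le⟩) fun x x' => by
    rw [dist_eq_norm, dist_eq_norm]; exact S.norm_sub_le x x').continuous

/-- The solution map is global and already known to be Lipschitz, so no implicit function theorem is
needed. The linearization error of `Γ` along the graph is `o(x' - x)`, and `j†` followed by the
inverse block maps it to the linearization error of `y`, up to sign. -/
lemma hasFDerivAt (S : ImplicitSolution i j Γ A m K y) (x : X) :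
    HasFDerivAt y (implicitDeriv i j (A (i x + j (y x)))) x := by
  set p := i x + j (y x) with hp
  obtain ⟨e, he⟩ := coercive_exists_equiv S.m_pos (yyBlock_coercive (S.coercive p))
  have hcont : Filter.Tendsto (fun x' => i x' + j (y x')) (nhds x) (nhds p) :=
    ((i.continuous.add (j.continuous.comp S.continuous)).tendsto x)
  have h1 := ((S.deriv p).isLittleO.comp_tendsto hcont).trans_isBigO
    (k := fun x' => x' - x) (Asymptotics.IsBigO.of_bound (1 + K / m)
      (Filter.Eventually.of_forall fun x' => S.graph_norm_sub_le x' x))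
  have h2 := (((e.symm : Y →L[ℝ] Y) ∘L adjoint j).isBigO_comp
    (fun x' => Γ (i x' + j (y x')) - Γ p - A p (i x' + j (y x') - p)) (nhds x)).trans_isLittleO h1
  refine HasFDerivAt.of_isLittleO ?_
  refine h2.neg_left.congr_left fun x' => ?_
  have c1 : ∀ x, adjoint j (Γ (i x + j (y x))) = 0 := fun x =>
    ext_inner_right ℝ fun v => by rw [adjoint_inner_left, S.crit, inner_zero_left]
  have c2 : i x' + j (y x') - p = i (x' - x) + j (y x' - y x) := by
    rw [hp, map_sub, map_sub]; abel
  have c3 : adjoint j (A p (j (y x' - y x))) = e (y x' - y x) := by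
    have := DFunLike.congr_fun he (y x' - y x)
    simpa [yyBlock] using this.symm
  rw [c2]
  simp only [ContinuousLinearMap.comp_apply, map_sub (adjoint j), c1, map_add, c3]
  rw [hp, c1]
  simp [implicitDeriv, ← hp, ← he]
  abel

lemma hasFDerivAt_graph (S : ImplicitSolution i j Γ A m K y) (x : X) :
    HasFDerivAt (fun x => i x + j (y x)) (graphDeriv i j (A (i x + j (y x)))) x :=
  i.hasFDerivAt.add (j.hasFDerivAt.comp x (S.hasFDerivAt x))

/-- Bootstrapping: the derivative is a smooth expression in `A` along the graph, hence as regular as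
`A` and `y` are. -/
lemma contDiff_succ (S : ImplicitSolution i j Γ A m K y) {n : ℕ} (hA : ContDiff ℝ n A)
    (hy : ContDiff ℝ n y) : ContDiff ℝ (n + 1) y := by
  refine contDiff_succ_iff_hasFDerivAt.2
    ⟨fun x => implicitDeriv i j (A (i x + j (y x))), ?_, S.hasFDerivAt⟩
  have hs : ContDiff ℝ n (fun x => i x + j (y x)) := i.contDiff.add (j.contDiff.comp hy)
  have hA' := hA.comp hs
  have hB : ContDiff ℝ n (fun x => yyBlock j (A (i x + j (y x)))) :=
    contDiff_const.clm_comp (hA'.clm_comp contDiff_const)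
  have hI : ContDiff ℝ n (fun x => (yyBlock j (A (i x + j (y x)))).inverse) := by
    refine contDiff_iff_contDiffAt.2 fun x => ?_
    obtain ⟨e, he⟩ := coercive_exists_equiv S.m_pos (yyBlock_coercive (S.coercive (i x + j (y x))))
    have h1 : ContDiffAt ℝ n ContinuousLinearMap.inverse (yyBlock j (A (i x + j (y x)))) := by
      rw [← he]; exact contDiffAt_map_inverse e
    exact h1.comp x hB.contDiffAt
  exact (hI.clm_comp (contDiff_const.clm_comp (hA'.clm_comp contDiff_const))).neg

lemma contDiff_one (S : ImplicitSolution i j Γ A m K y) (hA : Continuous A) :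
    ContDiff ℝ 1 y := by
  have := S.contDiff_succ (n := 0) (contDiff_zero.2 hA) (contDiff_zero.2 S.continuous)
  simpa using this

lemma contDiff_two (S : ImplicitSolution i j Γ A m K y) (hA : ContDiff ℝ 1 A) :
    ContDiff ℝ 2 y := by
  have := S.contDiff_succ (n := 1) (by exact_mod_cast hA)
    (by exact_mod_cast S.contDiff_one hA.continuous)
  simpa [one_add_one_eq_two] using this

end ImplicitSolution

end Implicit

/-! ### The penalized problem, uniformly in the penalty -/

section Penalty

variable {X Y P : Type} [NormedAddCommGroup X] [InnerProductSpace ℝ X] [CompleteSpace X]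
  [NormedAddCommGroup Y] [InnerProductSpace ℝ Y] [CompleteSpace Y] [FiniteDimensional ℝ Y]
  [NormedAddCommGroup P] [InnerProductSpace ℝ P] [CompleteSpace P]

/-- The gradient of `F + lam • G`. -/
def penGrad (F G : P → ℝ) (lam : ℝ) (p : P) : P := gradient F p + lam • gradient G p

/-- The Hessian of `F + lam • G`. -/
def penHess (F G : P → ℝ) (lam : ℝ) (p : P) : P →L[ℝ] P := hess F p + lam • hess G p

/-- The lower-level solution map `y` and the penalized solution map `yl`, with the bounds on
`F` and `G` in terms of a single smoothness constant `L = k * mu`. -/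
structure PenaltySystem (i : X →L[ℝ] P) (j : Y →L[ℝ] P) (F G : P → ℝ) (L mu k lam : ℝ)
    (y yl : X → Y) : Prop where
  lower : ImplicitSolution i j (gradient G) (hess G) mu L y
  upper : ImplicitSolution i j (penGrad F G lam) (penHess F G lam) (lam * mu / 2)
    ((1 + lam) * L) yl
  L_eq : L = k * mu
  one_le_k : 1 ≤ k
  two_le_lam : 2 ≤ lam
  F_smooth : ContDiff ℝ 2 F
  G_smooth : ContDiff ℝ 3 G
  F_grad : ∀ p, ‖gradient F p‖ ≤ L
  F_hess : ∀ p, ‖hess F p‖ ≤ L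
  F_hess_lip : ∀ p q, ‖hess F p - hess F q‖ ≤ L * ‖p - q‖
  G_hess_lip : ∀ p q, ‖hess G p - hess G q‖ ≤ L * ‖p - q‖
  G_third_lip : ∀ p q, ‖fderiv ℝ (hess G) p - fderiv ℝ (hess G) q‖ ≤ L * ‖p - q‖

namespace PenaltySystem

variable {i : X →L[ℝ] P} {j : Y →L[ℝ] P} {F G : P → ℝ} {L mu k lam : ℝ} {y yl : X → Y}

/-- The graph map `x ↦ (x, y x)`. -/
def graph (i : X →L[ℝ] P) (j : Y →L[ℝ] P) (y : X → Y) (x : X) : P := i x + j (y x)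

/-- Derivative of `x ↦ (x, y x)` for the lower-level solution `y`. -/
def lowerDeriv (i : X →L[ℝ] P) (j : Y →L[ℝ] P) (G : P → ℝ) (y : X → Y) (x : X) : X →L[ℝ] P :=
  graphDeriv i j (hess G (graph i j y x))

/-- Derivative of `x ↦ (x, yl x)` for the penalized solution `yl`. -/
def upperDeriv (i : X →L[ℝ] P) (j : Y →L[ℝ] P) (F G : P → ℝ) (lam : ℝ) (yl : X → Y) (x : X) :
    X →L[ℝ] P :=
  graphDeriv i j (penHess F G lam (graph i j yl x))

/-- `lam • (D yl - D y)`. -/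
def derivGap (i : X →L[ℝ] P) (j : Y →L[ℝ] P) (F G : P → ℝ) (lam : ℝ) (y yl : X → Y) (x : X) :
    X →L[ℝ] Y :=
  lam • (implicitDeriv i j (penHess F G lam (graph i j yl x)) -
    implicitDeriv i j (hess G (graph i j y x)))

/-- `∇²F + lam (∇²G(x, yl x) - ∇²G(x, y x))`. -/
def hessGap (i : X →L[ℝ] P) (j : Y →L[ℝ] P) (F G : P → ℝ) (lam : ℝ) (y yl : X → Y) (x : X) :
    P →L[ℝ] P :=
  hess F (graph i j yl x) + lam • (hess G (graph i j yl x) - hess G (graph i j y x))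

/-- The Hessian of the proxy `F(x, yl x) + lam (G(x, yl x) - G(x, y x))`. -/
def proxyHess (i : X →L[ℝ] P) (j : Y →L[ℝ] P) (F G : P → ℝ) (lam : ℝ) (y yl : X → Y) (x : X) :
    X →L[ℝ] X :=
  adjoint i ∘L penHess F G lam (graph i j yl x) ∘L upperDeriv i j F G lam yl x
    - lam • (adjoint i ∘L hess G (graph i j y x) ∘L lowerDeriv i j G y x)

/-- The gradient of the proxy. -/
def proxyGrad (i : X →L[ℝ] P) (j : Y →L[ℝ] P) (F G : P → ℝ) (lam : ℝ) (y yl : X → Y) (x : X) : X :=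
  adjoint i (penGrad F G lam (graph i j yl x) - lam • gradient G (graph i j y x))

/-- The proxy `F(x, yl x) + lam (G(x, yl x) - G(x, y x))`. -/
def proxy (i : X →L[ℝ] P) (j : Y →L[ℝ] P) (F G : P → ℝ) (lam : ℝ) (y yl : X → Y) (x : X) : ℝ :=
  F (graph i j yl x) + lam * (G (graph i j yl x) - G (graph i j y x))

section Bounds

variable (S : PenaltySystem i j F G L mu k lam y yl)
include S

lemma mu_pos : 0 < mu := S.lower.m_pos
lemma k_pos : 0 < k := by linarith [S.one_le_k]
lemma lam_pos : 0 < lam := by linarith [S.two_le_lam]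
lemma L_pos : 0 < L := by rw [S.L_eq]; exact mul_pos S.k_pos S.mu_pos

/-- Tested against `yl x - y x`, stationarity of the penalized problem balances the strong
monotonicity of `lam • ∇G` against `∇F`, whose norm is at most `L`. -/
lemma solution_gap (x : X) : ‖yl x - y x‖ ≤ k / lam := by
  set v := yl x - y x with hv
  have e : i x + j (y x) + j v = i x + j (yl x) := by rw [hv, map_sub]; abel
  have h1 := S.lower.mono (i x + j (y x)) v
  rw [e, inner_sub_left, S.lower.crit, sub_zero] at h1
  have h2 := S.upper.crit x v
  rw [penGrad, inner_add_left, real_inner_smul_left] at h2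
  have h3 : lam * (mu * ‖v‖ ^ 2) ≤ L * ‖v‖ := by
    have h4 := neg_le_of_abs_le (abs_real_inner_le_norm (gradient F (i x + j (yl x))) (j v))
    have h5 : ‖gradient F (i x + j (yl x))‖ * ‖j v‖ ≤ L * ‖v‖ :=
      mul_le_mul (S.F_grad _) (S.lower.norm_j_le v) (norm_nonneg _) S.L_pos.le
    have h6 := mul_le_mul_of_nonneg_left h1 S.lam_pos.le
    linarith
  rw [le_div_iff₀ S.lam_pos]
  rcases (norm_nonneg v).eq_or_lt with h0 | h0
  · rw [← h0, zero_mul]; exact S.k_pos.le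
  · rw [S.L_eq] at h3
    have h4 : (mu * ‖v‖) * (‖v‖ * lam) ≤ (mu * ‖v‖) * k := by linarith
    exact le_of_mul_le_mul_left h4 (mul_pos S.mu_pos h0)

lemma graph_gap (x : X) : ‖graph i j yl x - graph i j y x‖ ≤ k / lam := by
  have e : graph i j yl x - graph i j y x = j (yl x - y x) := by
    rw [graph, graph, map_sub]; abel
  rw [e]
  exact (S.lower.norm_j_le _).trans (S.solution_gap x)

lemma lower_ratio : L / mu = k := by
  rw [S.L_eq, mul_div_assoc, div_self S.mu_pos.ne', mul_one]

lemma upper_ratio : (1 + lam) * L / (lam * mu / 2) ≤ 3 * k := by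
  have := S.mu_pos
  have := S.lam_pos
  have := S.two_le_lam
  rw [div_le_iff₀ (by positivity), S.L_eq]
  nlinarith [mul_pos S.k_pos S.mu_pos]

lemma norm_lowerDeriv_le (x : X) : ‖lowerDeriv i j G y x‖ ≤ 2 * k := by
  have := norm_graphDeriv_le S.lower.norm_i S.lower.norm_j S.mu_pos (S.lower.coercive
    (graph i j y x)) (S.lower.bound _)
  rw [S.lower_ratio] at this
  exact this.trans (by linarith [S.one_le_k])

lemma norm_upperDeriv_le (x : X) : ‖upperDeriv i j F G lam yl x‖ ≤ 4 * k := by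
  have := norm_graphDeriv_le S.lower.norm_i S.lower.norm_j S.upper.m_pos (S.upper.coercive
    (graph i j yl x)) (S.upper.bound _)
  exact this.trans (by linarith [S.one_le_k, S.upper_ratio])

lemma lower_graph_lip (x x' : X) : ‖graph i j y x - graph i j y x'‖ ≤ 2 * k * ‖x - x'‖ := by
  refine (S.lower.graph_norm_sub_le x x').trans ?_
  rw [S.lower_ratio]
  gcongr
  linarith [S.one_le_k]

lemma upper_graph_lip (x x' : X) : ‖graph i j yl x - graph i j yl x'‖ ≤ 4 * k * ‖x - x'‖ := by
  refine (S.upper.graph_norm_sub_le x x').trans ?_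
  gcongr
  linarith [S.one_le_k, S.upper_ratio]

lemma upperDeriv_sub (x : X) : upperDeriv i j F G lam yl x - lowerDeriv i j G y x =
    (1 / lam) • (j ∘L derivGap i j F G lam y yl x) := by
  have := S.lam_pos.ne'
  ext u
  simp [upperDeriv, lowerDeriv, graphDeriv, derivGap, smul_smul, this]

lemma hasFDerivAt_lower (x : X) :
    HasFDerivAt (graph i j y) (lowerDeriv i j G y x) x := S.lower.hasFDerivAt_graph x

lemma hasFDerivAt_upper (x : X) :
    HasFDerivAt (graph i j yl) (upperDeriv i j F G lam yl x) x := S.upper.hasFDerivAt_graph x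

lemma norm_hess_gap_le (x : X) :
    ‖lam • (hess G (graph i j yl x) - hess G (graph i j y x))‖ ≤ L * k := by
  have := S.lam_pos
  rw [norm_smul, Real.norm_of_nonneg S.lam_pos.le]
  calc _ ≤ lam * (L * (k / lam)) := by
        gcongr
        exact (S.G_hess_lip _ _).trans (mul_le_mul_of_nonneg_left (S.graph_gap x) S.L_pos.le)
    _ = L * k := by field_simp

lemma norm_hessGap_le (x : X) : ‖hessGap i j F G lam y yl x‖ ≤ 2 * L * k := by
  refine (norm_add_le _ _).trans ((add_le_add (S.F_hess _) (S.norm_hess_gap_le x)).trans ?_)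
  nlinarith [S.L_pos, S.one_le_k]

lemma lower_orth (x : X) : adjoint j ∘L hess G (graph i j y x) ∘L lowerDeriv i j G y x = 0 :=
  adjoint_comp_graphDeriv S.mu_pos (S.lower.coercive _)

lemma upper_orth (x : X) :
    adjoint j ∘L penHess F G lam (graph i j yl x) ∘L upperDeriv i j F G lam yl x = 0 :=
  adjoint_comp_graphDeriv S.upper.m_pos (S.upper.coercive _)

lemma penHess_eq (x : X) : penHess F G lam (graph i j yl x) =
    hessGap i j F G lam y yl x + lam • hess G (graph i j y x) := by
  simp only [penHess, hessGap, smul_sub]; abel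

/-- Difference of the two orthogonality relations, with the penalized Hessian split into `hessGap`
and `lam • ∇²G`. It exhibits `derivGap` as the solution of a linear equation whose data do not grow
with `lam`. -/
lemma yyBlock_derivGap (x : X) :
    yyBlock j (hess G (graph i j y x)) ∘L derivGap i j F G lam y yl x =
      -(adjoint j ∘L hessGap i j F G lam y yl x ∘L upperDeriv i j F G lam yl x) := by
  have hl := S.lam_pos.ne'
  have h1 : j ∘L derivGap i j F G lam y yl x =
      lam • (upperDeriv i j F G lam yl x - lowerDeriv i j G y x) := by
    rw [S.upperDeriv_sub, smul_smul, mul_one_div_cancel hl, one_smul]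
  have h2 := S.upper_orth x
  have h3 := S.lower_orth x
  rw [S.penHess_eq] at h2
  have h4 : yyBlock j (hess G (graph i j y x)) ∘L derivGap i j F G lam y yl x =
      adjoint j ∘L hess G (graph i j y x) ∘L (j ∘L derivGap i j F G lam y yl x) := rfl
  rw [h4, h1, eq_neg_iff_add_eq_zero, ← h2]
  ext u : 1
  have h5 := DFunLike.congr_fun h3 u
  simp only [ContinuousLinearMap.comp_apply, zero_apply] at h5
  simp [smul_sub, h5, add_comm]

lemma norm_derivGap_le (x : X) : ‖derivGap i j F G lam y yl x‖ ≤ 8 * k ^ 3 := by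
  have h1 := coercive_opNorm_le S.mu_pos (yyBlock_coercive (S.lower.coercive (graph i j y x)))
    (derivGap i j F G lam y yl x)
  rw [S.yyBlock_derivGap, norm_neg] at h1
  have h2 : ‖adjoint j ∘L hessGap i j F G lam y yl x ∘L upperDeriv i j F G lam yl x‖ ≤
      1 * ((2 * L * k) * (4 * k)) := by
    have := S.L_pos
    have := S.k_pos
    refine (opNorm_comp_le _ _).trans (mul_le_mul (norm_adjoint_le S.lower.norm_j)
      ((opNorm_comp_le _ _).trans ?_) (norm_nonneg _) zero_le_one)
    exact mul_le_mul (S.norm_hessGap_le x) (S.norm_upperDeriv_le x) (norm_nonneg _) (by positivity)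
  have h3 : mu * ‖derivGap i j F G lam y yl x‖ ≤ mu * (8 * k ^ 3) := by
    refine h1.trans (h2.trans_eq ?_)
    rw [S.L_eq]; ring
  exact le_of_mul_le_mul_left h3 S.mu_pos

lemma penHess_lip (p q : P) :
    ‖penHess F G lam p - penHess F G lam q‖ ≤ (1 + lam) * L * ‖p - q‖ := by
  have e : penHess F G lam p - penHess F G lam q =
      (hess F p - hess F q) + lam • (hess G p - hess G q) := by
    simp only [penHess, smul_sub]; abel
  rw [e]
  refine (norm_add_le _ _).trans ((add_le_add (S.F_hess_lip p q) ?_).trans_eq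
    (b := L * ‖p - q‖ + lam * (L * ‖p - q‖)) (by ring))
  rw [norm_smul, Real.norm_of_nonneg S.lam_pos.le]
  exact mul_le_mul_of_nonneg_left (S.G_hess_lip p q) S.lam_pos.le

/-- Subtracting orthogonality relations at two base points gives an equation for the difference. The
`lam` in the Lipschitz constant of the penalized Hessian cancels against the modulus `lam * mu / 2`.
-/
lemma upperDeriv_lip (x x' : X) :
    ‖upperDeriv i j F G lam yl x - upperDeriv i j F G lam yl x'‖ ≤ 48 * k ^ 3 * ‖x - x'‖ := by
  set A := penHess F G lam (graph i j yl x) with hA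
  set A' := penHess F G lam (graph i j yl x') with hA'
  set D := implicitDeriv i j A - implicitDeriv i j A' with hD
  have e1 : upperDeriv i j F G lam yl x - upperDeriv i j F G lam yl x' = j ∘L D := by
    ext u; simp [upperDeriv, graphDeriv, hD, hA, hA']
  have h1 := coercive_opNorm_le S.upper.m_pos (yyBlock_coercive (S.upper.coercive
    (graph i j yl x))) D
  have h2 : yyBlock j A ∘L D = -(adjoint j ∘L (A - A') ∘L upperDeriv i j F G lam yl x') := by
    have h3 : yyBlock j A ∘L D = adjoint j ∘L A ∘L (j ∘L D) := rfl
    have h4 := S.upper_orth x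
    have h5 := S.upper_orth x'
    rw [← hA] at h4
    rw [← hA'] at h5
    rw [h3, ← e1]
    ext u : 1
    have h6 := DFunLike.congr_fun h4 u
    have h7 := DFunLike.congr_fun h5 u
    simp only [ContinuousLinearMap.comp_apply, zero_apply] at h6 h7
    simp [h6, h7]
  rw [← hA, h2, norm_neg] at h1
  have hm := S.upper.m_pos
  have := S.L_pos
  have := S.k_pos
  have := S.lam_pos
  have h8 : ‖A - A'‖ ≤ 3 / 2 * lam * L * (4 * k * ‖x - x'‖) := by
    refine (S.penHess_lip _ _).trans ?_
    have h9 : (1 + lam) * L ≤ 3 / 2 * lam * L := by nlinarith [S.two_le_lam]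
    exact mul_le_mul h9 (S.upper_graph_lip x x') (norm_nonneg _) (by positivity)
  have h9 : ‖adjoint j ∘L (A - A') ∘L upperDeriv i j F G lam yl x'‖ ≤
      1 * ((3 / 2 * lam * L * (4 * k * ‖x - x'‖)) * (4 * k)) := by
    refine (opNorm_comp_le _ _).trans (mul_le_mul (norm_adjoint_le S.lower.norm_j)
      ((opNorm_comp_le _ _).trans ?_) (norm_nonneg _) zero_le_one)
    exact mul_le_mul h8 (S.norm_upperDeriv_le x') (norm_nonneg _) (by positivity)
  have h10 : lam * mu / 2 * ‖D‖ ≤ lam * mu / 2 * (48 * k ^ 3 * ‖x - x'‖) := by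
    refine h1.trans (h9.trans_eq ?_)
    rw [S.L_eq]; ring
  rw [e1]
  refine (opNorm_comp_le _ _).trans ?_
  calc ‖j‖ * ‖D‖ ≤ 1 * (48 * k ^ 3 * ‖x - x'‖) := by
        gcongr
        · exact S.lower.norm_j
        · exact le_of_mul_le_mul_left h10 hm
    _ = _ := one_mul _

lemma norm_third_le (p : P) : ‖fderiv ℝ (hess G) p‖ ≤ L :=
  (hasFDerivAt_hess S.G_smooth p).le_of_lip' S.L_pos.le
    (Filter.Eventually.of_forall fun q => S.G_hess_lip q p)

/-- Mean value inequality: the derivative is `lam` times a difference of two products whose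
corresponding factors differ by `O(1 / lam)`. For the third-derivative factors this uses
`G_third_lip`. -/
lemma hess_gap_lip (x x' : X) :
    ‖lam • (hess G (graph i j yl x) - hess G (graph i j y x)) -
      lam • (hess G (graph i j yl x') - hess G (graph i j y x'))‖ ≤
        12 * L * k ^ 3 * ‖x - x'‖ := by
  have hl := S.lam_pos
  have hL := S.L_pos
  have hk := S.k_pos
  have hd : ∀ x, HasFDerivAt (fun x => lam • (hess G (graph i j yl x) - hess G (graph i j y x)))
      (lam • ((fderiv ℝ (hess G) (graph i j yl x)) ∘L upperDeriv i j F G lam yl x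
        - (fderiv ℝ (hess G) (graph i j y x)) ∘L lowerDeriv i j G y x)) x := fun x =>
    (((hasFDerivAt_hess S.G_smooth _).comp x (S.hasFDerivAt_upper x)).sub
      ((hasFDerivAt_hess S.G_smooth _).comp x (S.hasFDerivAt_lower x))).const_smul lam
  refine convex_univ.norm_image_sub_le_of_norm_hasFDerivWithin_le
    (f := fun x => lam • (hess G (graph i j yl x) - hess G (graph i j y x)))
    (fun x _ => (hd x).hasFDerivWithinAt) (fun x _ => ?_) (mem_univ x') (mem_univ x)
  rw [norm_smul, Real.norm_of_nonneg hl.le]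
  have h1 : ‖upperDeriv i j F G lam yl x - lowerDeriv i j G y x‖ ≤ 8 * k ^ 3 / lam := by
    rw [S.upperDeriv_sub, norm_smul, Real.norm_of_nonneg (by positivity), one_div,
      inv_mul_le_iff₀ hl, mul_div_cancel₀ _ hl.ne']
    refine (opNorm_comp_le _ _).trans ?_
    calc ‖j‖ * ‖derivGap i j F G lam y yl x‖ ≤ 1 * (8 * k ^ 3) := by
          gcongr
          · exact S.lower.norm_j
          · exact S.norm_derivGap_le x
      _ = _ := one_mul _
  have h2 := norm_comp_sub_comp_le ((S.G_third_lip (graph i j yl x) (graph i j y x)).trans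
    (mul_le_mul_of_nonneg_left (S.graph_gap x) hL.le)) (S.norm_upperDeriv_le x)
    (S.norm_third_le (graph i j y x)) h1
  refine (mul_le_mul_of_nonneg_left h2 hl.le).trans ?_
  have e : lam * (L * (k / lam) * (4 * k) + L * (8 * k ^ 3 / lam)) =
      L * (4 * k ^ 2 + 8 * k ^ 3) := by field_simp
  rw [e]
  have : k ^ 2 ≤ k ^ 3 := pow_le_pow_right₀ S.one_le_k (by norm_num)
  nlinarith

lemma hessGap_lip (x x' : X) :
    ‖hessGap i j F G lam y yl x - hessGap i j F G lam y yl x'‖ ≤ 16 * L * k ^ 3 * ‖x - x'‖ := by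
  have e : hessGap i j F G lam y yl x - hessGap i j F G lam y yl x' =
      (hess F (graph i j yl x) - hess F (graph i j yl x')) +
      (lam • (hess G (graph i j yl x) - hess G (graph i j y x)) -
      lam • (hess G (graph i j yl x') - hess G (graph i j y x'))) := by
    simp only [hessGap]; abel
  rw [e]
  have hL := S.L_pos
  have h1 := (S.F_hess_lip (graph i j yl x) (graph i j yl x')).trans
    (mul_le_mul_of_nonneg_left (S.upper_graph_lip x x') hL.le)
  refine (norm_add_le _ _).trans ((add_le_add h1 (S.hess_gap_lip x x')).trans ?_)
  have : k ≤ k ^ 3 := le_self_pow₀ S.one_le_k (by norm_num)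
  have h2 : 0 ≤ L * ‖x - x'‖ := by positivity
  nlinarith

lemma derivGap_lip (x x' : X) :
    ‖derivGap i j F G lam y yl x - derivGap i j F G lam y yl x'‖ ≤ 176 * k ^ 5 * ‖x - x'‖ := by
  set δ := ‖x - x'‖ with hδ
  have hL := S.L_pos
  have hk := S.k_pos
  have hδ0 : 0 ≤ δ := norm_nonneg _
  set e := derivGap i j F G lam y yl x with he
  set e' := derivGap i j F G lam y yl x' with he'
  set B := yyBlock j (hess G (graph i j y x)) with hB
  set B' := yyBlock j (hess G (graph i j y x')) with hB'
  have h1 := coercive_opNorm_le S.mu_pos (yyBlock_coercive (S.lower.coercive (graph i j y x)))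
    (e - e')
  -- Difference of `yyBlock_derivGap` at the two points: its right sides contribute `16 * 4 + 2 * 48
  -- = 160`, the change of block `2 * 8 = 16`.
  have h2 : B ∘L (e - e') = (B ∘L e - B' ∘L e') - (B - B') ∘L e' := by ext; simp
  have hBB : ‖B - B'‖ ≤ 2 * L * k * δ := by
    have e1 : B - B' = adjoint j ∘L (hess G (graph i j y x) - hess G (graph i j y x')) ∘L j := by
      ext; simp [hB, hB', yyBlock]
    rw [e1]
    refine (opNorm_comp_le _ _).trans ?_
    have h3 : ‖hess G (graph i j y x) - hess G (graph i j y x')‖ ≤ L * (2 * k * δ) :=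
      (S.G_hess_lip _ _).trans (mul_le_mul_of_nonneg_left (S.lower_graph_lip x x') hL.le)
    calc _ ≤ 1 * ((L * (2 * k * δ)) * 1) := by
          refine mul_le_mul (norm_adjoint_le S.lower.norm_j) ((opNorm_comp_le _ _).trans ?_)
            (norm_nonneg _) zero_le_one
          exact mul_le_mul h3 S.lower.norm_j (norm_nonneg _) (by positivity)
      _ = _ := by ring
  have h3 : ‖B ∘L e - B' ∘L e'‖ ≤ 160 * L * k ^ 4 * δ := by
    rw [hB, hB', he, he', S.yyBlock_derivGap, S.yyBlock_derivGap, neg_sub_neg, norm_sub_rev]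
    have h4 := norm_comp_sub_comp_le (S.hessGap_lip x x') (S.norm_upperDeriv_le x)
      (S.norm_hessGap_le x') (S.upperDeriv_lip x x')
    rw [← comp_sub]
    refine (opNorm_comp_le _ _).trans ?_
    calc _ ≤ 1 * (16 * L * k ^ 3 * δ * (4 * k) + 2 * L * k * (48 * k ^ 3 * δ)) :=
          mul_le_mul (norm_adjoint_le S.lower.norm_j) h4 (norm_nonneg _) zero_le_one
      _ = _ := by ring
  have h5 : ‖(B - B') ∘L e'‖ ≤ 2 * L * k * δ * (8 * k ^ 3) :=
    (opNorm_comp_le _ _).trans (mul_le_mul hBB (S.norm_derivGap_le x') (norm_nonneg _)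
      (by positivity))
  have h6 : mu * ‖e - e'‖ ≤ mu * (176 * k ^ 5 * δ) := by
    refine h1.trans ?_
    rw [← hB, h2]
    refine (norm_sub_le _ _).trans ((add_le_add h3 h5).trans_eq ?_)
    rw [S.L_eq]; ring
  exact le_of_mul_le_mul_left h6 S.mu_pos

/-- The two Schur complements of order `lam` recombine into factors that are bounded and Lipschitz
uniformly in `lam`. -/
lemma proxyHess_eq (x : X) : proxyHess i j F G lam y yl x =
    adjoint i ∘L (hessGap i j F G lam y yl x ∘L upperDeriv i j F G lam yl x
      + hess G (graph i j y x) ∘L j ∘L derivGap i j F G lam y yl x) := by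
  have hl := S.lam_pos.ne'
  have h1 : j ∘L derivGap i j F G lam y yl x =
      lam • (upperDeriv i j F G lam yl x - lowerDeriv i j G y x) := by
    rw [S.upperDeriv_sub, smul_smul, mul_one_div_cancel hl, one_smul]
  rw [h1, proxyHess, S.penHess_eq]
  ext1 u
  simp [smul_sub]
  abel

/-- The Hessian of the proxy is `352 L k⁵`-Lipschitz, uniformly in `lam`. -/
lemma proxyHess_lip (x x' : X) :
    ‖proxyHess i j F G lam y yl x - proxyHess i j F G lam y yl x'‖ ≤
      352 * L * k ^ 5 * ‖x - x'‖ := by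
  have hL := S.L_pos
  have hk := S.k_pos
  rw [S.proxyHess_eq, S.proxyHess_eq, ← comp_sub]
  have h1 := norm_comp_sub_comp_le (S.hessGap_lip x x') (S.norm_upperDeriv_le x)
      (S.norm_hessGap_le x') (S.upperDeriv_lip x x')
  have hje : ‖j ∘L derivGap i j F G lam y yl x‖ ≤ 8 * k ^ 3 :=
    (opNorm_comp_le _ _).trans ((mul_le_mul S.lower.norm_j (S.norm_derivGap_le x) (norm_nonneg _)
      zero_le_one).trans_eq (one_mul _))
  have hje2 : ‖j ∘L derivGap i j F G lam y yl x - j ∘L derivGap i j F G lam y yl x'‖ ≤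
      176 * k ^ 5 * ‖x - x'‖ := by
    rw [← comp_sub]
    exact (opNorm_comp_le _ _).trans ((mul_le_mul S.lower.norm_j (S.derivGap_lip x x')
      (norm_nonneg _) zero_le_one).trans_eq (one_mul _))
  have h2 := norm_comp_sub_comp_le ((S.G_hess_lip (graph i j y x) (graph i j y x')).trans
    (mul_le_mul_of_nonneg_left (S.lower_graph_lip x x') hL.le)) hje
    (S.lower.bound (graph i j y x')) hje2
  refine (opNorm_comp_le _ _).trans ?_
  rw [add_sub_add_comm]
  calc _ ≤ 1 * ((16 * L * k ^ 3 * ‖x - x'‖ * (4 * k) + 2 * L * k * (48 * k ^ 3 * ‖x - x'‖)) +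
        (L * (2 * k * ‖x - x'‖) * (8 * k ^ 3) + L * (176 * k ^ 5 * ‖x - x'‖))) :=
        mul_le_mul (norm_adjoint_le S.lower.norm_i) ((norm_add_le _ _).trans (add_le_add h1 h2))
          (norm_nonneg _) zero_le_one
    _ = (176 * k ^ 4 + 176 * k ^ 5) * (L * ‖x - x'‖) := by ring
    _ ≤ (352 * k ^ 5) * (L * ‖x - x'‖) := by
        have : k ^ 4 ≤ k ^ 5 := pow_le_pow_right₀ S.one_le_k (by norm_num)
        gcongr; linarith
    _ = _ := by ring

/-- Envelope theorem: both solution maps are stationary along `j`, so their derivatives drop out. -/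
lemma hasGradientAt_proxy (x : X) :
    HasGradientAt (proxy i j F G lam y yl) (proxyGrad i j F G lam y yl x) x := by
  have hF : ∀ p, HasFDerivAt F (InnerProductSpace.toDual ℝ P (gradient F p)) p := fun p =>
    (S.F_smooth.differentiable (by simp) p).hasGradientAt.hasFDerivAt
  have hG : ∀ p, HasFDerivAt G (InnerProductSpace.toDual ℝ P (gradient G p)) p := fun p =>
    (S.G_smooth.differentiable (by simp) p).hasGradientAt.hasFDerivAt
  have h1 := ((hF _).comp x (S.hasFDerivAt_upper x)).add ((((hG _).comp x
    (S.hasFDerivAt_upper x)).sub ((hG _).comp x (S.hasFDerivAt_lower x))).const_mul lam)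
  rw [hasGradientAt_iff_hasFDerivAt]
  refine h1.congr_fderiv ?_
  ext u
  have h2 := S.upper.crit x (implicitDeriv i j (penHess F G lam (graph i j yl x)) u)
  have h3 := S.lower.crit x (implicitDeriv i j (hess G (graph i j y x)) u)
  change inner ℝ (penGrad F G lam (graph i j yl x)) _ = 0 at h2
  change inner ℝ (gradient G (graph i j y x)) _ = 0 at h3
  rw [penGrad, inner_add_left, real_inner_smul_left] at h2
  simp only [proxyGrad, penGrad, InnerProductSpace.toDual_apply_apply, add_apply, sub_apply,
    smul_apply, ContinuousLinearMap.comp_apply, adjoint_inner_left, inner_sub_left,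
    inner_add_left, real_inner_smul_left, upperDeriv, lowerDeriv, graphDeriv, inner_add_right,
    smul_eq_mul]
  rw [h3]
  linarith

lemma hasFDerivAt_proxyGrad (x : X) :
    HasFDerivAt (proxyGrad i j F G lam y yl) (proxyHess i j F G lam y yl x) x := by
  have h1 := (adjoint i).hasFDerivAt.comp x (((S.upper.deriv _).comp x
    (S.hasFDerivAt_upper x)).sub (((S.lower.deriv _).comp x (S.hasFDerivAt_lower x)).const_smul lam))
  refine h1.congr_fderiv ?_
  ext u
  simp [proxyHess]

lemma gradient_proxy : gradient (proxy i j F G lam y yl) = proxyGrad i j F G lam y yl :=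
  gradient_eq S.hasGradientAt_proxy

lemma hess_proxy (x : X) :
    hess (proxy i j F G lam y yl) x = proxyHess i j F G lam y yl x := by
  rw [hess, S.gradient_proxy]
  exact (S.hasFDerivAt_proxyGrad x).fderiv

lemma contDiff_proxy : ContDiff ℝ 2 (proxy i j F G lam y yl) := by
  have h1 : ContDiff ℝ (1 : ℕ) (proxyGrad i j F G lam y yl) := by
    have h2 : ContDiff ℝ ((0 : ℕ) + 1) (proxyGrad i j F G lam y yl) := by
      refine contDiff_succ_iff_hasFDerivAt.2 ⟨proxyHess i j F G lam y yl, contDiff_zero.2 ?_, S.hasFDerivAt_proxyGrad⟩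
      refine (LipschitzWith.of_dist_le_mul (K := ⟨352 * L * k ^ 5, ?_⟩) fun x x' => ?_).continuous
      · have := S.L_pos
        have := S.k_pos
        positivity
      · rw [dist_eq_norm, dist_eq_norm]; exact S.proxyHess_lip x x'
    simpa using h2
  have := contDiff_of_hasGradientAt 1 S.hasGradientAt_proxy h1
  simpa [one_add_one_eq_two] using this

end Bounds

end PenaltySystem

end Penalty

/-! ### Symmetry of the third derivative -/

section Third

variable {P : Type} [NormedAddCommGroup P] [InnerProductSpace ℝ P] [CompleteSpace P]

lemma third_swap {G : P → ℝ} (hG : ContDiff ℝ 3 G) (p a b : P) :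
    fderiv ℝ (hess G) p a b = fderiv ℝ (hess G) p b a := by
  have h1 : ContDiff ℝ 2 (gradient G) := contDiff_gradient 2 (by exact_mod_cast hG)
  exact (h1.contDiffAt (x := p)).isSymmSndFDerivAt (by simp) a b

lemma third_symm {G : P → ℝ} (hG : ContDiff ℝ 3 G) (p a b c : P) :
    inner ℝ (fderiv ℝ (hess G) p a b) c = inner ℝ b (fderiv ℝ (hess G) p a c) := by
  have hd := hasFDerivAt_hess hG p
  have h1 := (hd.clm_apply (hasFDerivAt_const b p)).inner ℝ (hasFDerivAt_const c p)
  have h2 := (hasFDerivAt_const b p).inner ℝ (hd.clm_apply (hasFDerivAt_const c p))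
  have e : (fun q => inner ℝ (hess G q b) c) = fun q => inner ℝ b (hess G q c) :=
    funext fun q => hess_symm (hG.of_le (by norm_num)) q b c
  rw [e] at h1
  have h3 := DFunLike.congr_fun (h1.unique h2) a
  simpa using h3

lemma gradient_lipschitz {F : P → ℝ} (hF : ContDiff ℝ 2 F) {L : ℝ} (hL : ∀ p, ‖hess F p‖ ≤ L)
    (p q : P) : ‖gradient F p - gradient F q‖ ≤ L * ‖p - q‖ :=
  convex_univ.norm_image_sub_le_of_norm_hasFDerivWithin_le
    (fun p _ => (hasFDerivAt_gradient hF p).hasFDerivWithinAt) (fun p _ => hL p) (mem_univ q)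
    (mem_univ p)

end Third

/-! ### Distance from the proxy to the hyper-objective -/

namespace PenaltySystem

variable {X Y P : Type} [NormedAddCommGroup X] [InnerProductSpace ℝ X] [CompleteSpace X]
  [NormedAddCommGroup Y] [InnerProductSpace ℝ Y] [CompleteSpace Y] [FiniteDimensional ℝ Y]
  [NormedAddCommGroup P] [InnerProductSpace ℝ P] [CompleteSpace P]

variable {i : X →L[ℝ] P} {j : Y →L[ℝ] P} {F G : P → ℝ} {L mu k lam : ℝ} {y yl : X → Y}

/-- The hyper-objective `F(x, y x)`. -/
def hyper (i : X →L[ℝ] P) (j : Y →L[ℝ] P) (F : P → ℝ) (y : X → Y) (x : X) : ℝ :=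
  F (graph i j y x)

variable (S : PenaltySystem i j F G L mu k lam y yl)
include S

lemma contDiff_hessG : ContDiff ℝ 1 (hess G) := by
  have h1 : ContDiff ℝ ((1 : ℕ) + 1) (gradient G) :=
    contDiff_gradient 2 (by exact_mod_cast S.G_smooth)
  exact h1.fderiv_right (by norm_num)

lemma contDiff_y : ContDiff ℝ 2 y := S.lower.contDiff_two S.contDiff_hessG

lemma contDiff_hyper : ContDiff ℝ 2 (hyper i j F y) :=
  S.F_smooth.comp (i.contDiff.add (j.contDiff.comp S.contDiff_y))

lemma lowerDeriv_apply (x u : X) : lowerDeriv i j G y x u =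
    i u + j (implicitDeriv i j (hess G (graph i j y x)) u) := rfl

lemma hasGradientAt_hyper (x : X) :
    HasGradientAt (hyper i j F y) (adjoint (lowerDeriv i j G y x) (gradient F (graph i j y x))) x := by
  have hF := (S.F_smooth.differentiable (by simp) (graph i j y x)).hasGradientAt.hasFDerivAt
  rw [hasGradientAt_iff_hasFDerivAt]
  refine (hF.comp x (S.hasFDerivAt_lower x)).congr_fderiv ?_
  ext u
  simp [adjoint_inner_left]

lemma differentiableAt_implicitDeriv (x : X) : DifferentiableAt ℝ
    (fun x => implicitDeriv i j (hess G (graph i j y x))) x := by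
  have h1 : fderiv ℝ y = fun x => implicitDeriv i j (hess G (graph i j y x)) :=
    funext fun x => (S.lower.hasFDerivAt x).fderiv
  have h2 : ContDiff ℝ 1 (fderiv ℝ y) := S.contDiff_y.fderiv_right (by norm_num)
  rw [h1] at h2
  exact h2.differentiable (by simp) x

/-- Second derivative of the lower-level solution map in the direction `v`. -/
lemma exists_second_deriv (x v : X) : ∃ w : Y,
    (∀ v' : Y, inner ℝ (fderiv ℝ (hess G) (graph i j y x) (lowerDeriv i j G y x v)
      (lowerDeriv i j G y x v)) (j v') + inner ℝ (hess G (graph i j y x) (j w)) (j v') = 0) ∧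
    inner ℝ v (hess (hyper i j F y) x v) =
      inner ℝ (hess F (graph i j y x) (lowerDeriv i j G y x v)) (lowerDeriv i j G y x v)
        + inner ℝ (gradient F (graph i j y x)) (j w) := by
  have hQ := (S.differentiableAt_implicitDeriv x).hasFDerivAt
  set Q' := fderiv ℝ (fun x => implicitDeriv i j (hess G (graph i j y x))) x with hQ'
  have hZ : HasFDerivAt (fun x => lowerDeriv i j G y x v)
      (j ∘L (Q'.flip v)) x := by
    have h1 := (j.hasFDerivAt.comp x (hQ.clm_apply (hasFDerivAt_const v x))).const_add (i v)
    refine h1.congr_fderiv ?_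
    ext u
    simp
  -- `w` is the second derivative of `y` in the direction `(v, v)`. Differentiating the
  -- orthogonality relation along `v` gives the first claim, differentiating the chain rule the
  -- second.
  refine ⟨Q' v v, fun v' => ?_, ?_⟩
  · have h1 := ((hasFDerivAt_hess S.G_smooth _).comp x (S.hasFDerivAt_lower x)).clm_apply hZ
    have h2 := h1.inner ℝ (hasFDerivAt_const (j v') x)
    have e : (fun x => inner ℝ (hess G (graph i j y x) (lowerDeriv i j G y x v)) (j v')) =
        fun _ => (0 : ℝ) :=
      funext fun x => inner_graphDeriv S.mu_pos (S.lower.coercive _) v v'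
    have h3 := h2.unique (by
      simp only [Function.comp]
      rw [e]; exact hasFDerivAt_const (0 : ℝ) x)
    have h4 := DFunLike.congr_fun h3 v
    simp only [Function.comp, ContinuousLinearMap.comp_apply, fderivInnerCLM_apply,
      ContinuousLinearMap.prod_apply, add_apply, zero_apply, inner_zero_right, zero_add,
      flip_apply, inner_add_left] at h4
    linarith
  · have h1 := ((hasFDerivAt_gradient S.F_smooth _).comp x (S.hasFDerivAt_lower x)).inner ℝ hZ
    have h2 := (hasFDerivAt_gradient S.contDiff_hyper x).inner ℝ (hasFDerivAt_const v x)
    have e : (fun x => inner ℝ (gradient (hyper i j F y) x) v) =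
        fun x => inner ℝ (gradient F (graph i j y x)) (lowerDeriv i j G y x v) := by
      ext x
      rw [(S.hasGradientAt_hyper x).gradient, adjoint_inner_left]
    rw [e] at h2
    have h3 := DFunLike.congr_fun (h2.unique h1) v
    simp only [Function.comp, ContinuousLinearMap.comp_apply, fderivInnerCLM_apply,
      ContinuousLinearMap.prod_apply, zero_apply, inner_zero_right, zero_add,
      flip_apply] at h3
    rw [real_inner_comm, h3]; ring

lemma grad_remainder (x : X) : ‖gradient G (graph i j yl x) - gradient G (graph i j y x)
    - hess G (graph i j y x) (j (yl x - y x))‖ ≤ L * (k / lam) ^ 2 := by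
  have e : graph i j yl x = graph i j y x + j (yl x - y x) := by
    rw [graph, graph, map_sub]; abel
  rw [e]
  refine (taylor_gradient (S.G_smooth.of_le (by norm_num)) S.G_hess_lip _ _).trans ?_
  have := S.L_pos
  have h := (S.lower.norm_j_le (yl x - y x)).trans (S.solution_gap x)
  gcongr

lemma hess_remainder (x : X) : ‖hess G (graph i j yl x) - hess G (graph i j y x)
    - fderiv ℝ (hess G) (graph i j y x) (j (yl x - y x))‖ ≤ L * (k / lam) ^ 2 := by
  have e : graph i j yl x = graph i j y x + j (yl x - y x) := by
    rw [graph, graph, map_sub]; abel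
  rw [e]
  refine (taylor_of_lipschitz_fderiv (hasFDerivAt_hess S.G_smooth) S.G_third_lip _ _).trans ?_
  have := S.L_pos
  have h := (S.lower.norm_j_le (yl x - y x)).trans (S.solution_gap x)
  gcongr

lemma hessG_symm (p u v : P) : inner ℝ (hess G p u) v = inner ℝ u (hess G p v) :=
  hess_symm (S.G_smooth.of_le (by norm_num)) p u v

lemma penHess_symm (p u v : P) :
    inner ℝ (penHess F G lam p u) v = inner ℝ u (penHess F G lam p v) := by
  simp only [penHess, add_apply, smul_apply, inner_add_left, inner_add_right,
    real_inner_smul_left, real_inner_smul_right, hess_symm S.F_smooth, S.hessG_symm]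

lemma lower_inner_zero (x u : X) (v : Y) :
    inner ℝ (hess G (graph i j y x) (lowerDeriv i j G y x u)) (j v) = 0 :=
  inner_graphDeriv S.mu_pos (S.lower.coercive _) u v

lemma upper_inner_zero (x u : X) (v : Y) :
    inner ℝ (penHess F G lam (graph i j yl x) (upperDeriv i j F G lam yl x u)) (j v) = 0 :=
  inner_graphDeriv S.upper.m_pos (S.upper.coercive _) u v

lemma gradF_gap (x : X) :
    ‖gradient F (graph i j yl x) - gradient F (graph i j y x)‖ ≤ L * (k / lam) :=
  (gradient_lipschitz S.F_smooth S.F_hess _ _).trans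
    (mul_le_mul_of_nonneg_left (S.graph_gap x) S.L_pos.le)

/-- Once stationarity is used, the difference tested against itself contains `∇F(yl) - ∇F(y)` and
`lam` times the expansion of `∇G` at the lower solution. The linear term of that expansion is
orthogonal to the range of `lowerDeriv`, so only the remainder of order `1 / lam ^ 2` meets the
factor `lam`. -/
lemma gradient_proxy_sub_hyper (x : X) :
    ‖gradient (proxy i j F G lam y yl) x - gradient (hyper i j F y) x‖ ≤
      4 * (L * k ^ 3 / lam) := by
  have hl := S.lam_pos
  have hL := S.L_pos
  have hk := S.k_pos
  set D := gradient (proxy i j F G lam y yl) x - gradient (hyper i j F y) x with hD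
  set R := gradient G (graph i j yl x) - gradient G (graph i j y x)
    - hess G (graph i j y x) (j (yl x - y x)) with hR
  set z := lowerDeriv i j G y x D with hz
  have key : inner ℝ D D = inner ℝ (gradient F (graph i j yl x) - gradient F (graph i j y x)
      + lam • R) z := by
    have c1 := S.upper.crit x (implicitDeriv i j (hess G (graph i j y x)) D)
    have c2 := S.lower.crit x (implicitDeriv i j (hess G (graph i j y x)) D)
    change inner ℝ (penGrad F G lam (graph i j yl x)) _ = 0 at c1
    change inner ℝ (gradient G (graph i j y x)) _ = 0 at c2
    have c3 : inner ℝ (hess G (graph i j y x) (j (yl x - y x))) z = 0 := by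
      rw [S.hessG_symm, real_inner_comm, S.lower_inner_zero]
    have c4 : inner ℝ D D = inner ℝ (penGrad F G lam (graph i j yl x)
        - lam • gradient G (graph i j y x)) (i D) - inner ℝ (gradient F (graph i j y x)) z := by
      have c5 : ∀ u, inner ℝ D u = inner ℝ (penGrad F G lam (graph i j yl x)
          - lam • gradient G (graph i j y x)) (i u)
          - inner ℝ (gradient F (graph i j y x)) (lowerDeriv i j G y x u) := fun u => by
        rw [hD, inner_sub_left, S.gradient_proxy, (S.hasGradientAt_hyper x).gradient,
          proxyGrad, adjoint_inner_left, adjoint_inner_left]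
      exact c5 D
    rw [c4, hR]
    simp only [hz, lowerDeriv_apply S, penGrad, inner_add_left, inner_sub_left,
      inner_add_right, real_inner_smul_left] at c1 c2 c3 ⊢
    linear_combination -c1 + lam * c2 + lam * c3
  have hzn : ‖z‖ ≤ 2 * k * ‖D‖ := le_of_opNorm_le _ (S.norm_lowerDeriv_le x) D
  have hb : ‖gradient F (graph i j yl x) - gradient F (graph i j y x) + lam • R‖ ≤
      L * (k / lam) + lam * (L * (k / lam) ^ 2) := by
    refine (norm_add_le _ _).trans (add_le_add (S.gradF_gap x) ?_)
    rw [norm_smul, Real.norm_of_nonneg hl.le]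
    exact mul_le_mul_of_nonneg_left (S.grad_remainder x) hl.le
  rw [real_inner_self_eq_norm_sq] at key
  have h1 : ‖D‖ ^ 2 ≤ (L * (k / lam) + lam * (L * (k / lam) ^ 2)) * (2 * k * ‖D‖) := by
    rw [key]
    exact (real_inner_le_norm _ _).trans (mul_le_mul hb hzn (norm_nonneg _) (by positivity))
  have h2 : (L * (k / lam) + lam * (L * (k / lam) ^ 2)) * (2 * k) ≤ 4 * (L * k ^ 3 / lam) := by
    have e : (L * (k / lam) + lam * (L * (k / lam) ^ 2)) * (2 * k) =
        L / lam * (2 * k ^ 2 + 2 * k ^ 3) := by field_simp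
    have : k ^ 2 ≤ k ^ 3 := pow_le_pow_right₀ S.one_le_k (by norm_num)
    rw [e]
    calc L / lam * (2 * k ^ 2 + 2 * k ^ 3) ≤ L / lam * (4 * k ^ 3) := by gcongr; linarith
      _ = _ := by ring
  rcases (norm_nonneg D).eq_or_lt with h0 | h0
  · rw [← h0]; positivity
  · refine le_of_mul_le_mul_right ?_ h0
    calc ‖D‖ * ‖D‖ = ‖D‖ ^ 2 := (sq _).symm
      _ ≤ _ := h1
      _ = ((L * (k / lam) + lam * (L * (k / lam) ^ 2)) * (2 * k)) * ‖D‖ := by ring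
      _ ≤ _ := by gcongr

/-- After terms orthogonal to the range of `j` are discarded, both Schur complements are evaluated
at `z`, up to the correction `j E / lam`. The contributions `lam * ⟨∇²G z, z⟩` cancel and leave the
bounded operator `hessGap`. -/
lemma proxyHess_quadratic (x v : X) : inner ℝ v (proxyHess i j F G lam y yl x v) =
    inner ℝ (hessGap i j F G lam y yl x (lowerDeriv i j G y x v)) (lowerDeriv i j G y x v)
    + 1 / lam * inner ℝ (hessGap i j F G lam y yl x (lowerDeriv i j G y x v))
        (j (derivGap i j F G lam y yl x v)) := by
  have hl := S.lam_pos
  set z := lowerDeriv i j G y x v with hz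
  set E := derivGap i j F G lam y yl x v with hE
  set c := hess G (graph i j y x) with hc
  set A := penHess F G lam (graph i j yl x) with hA
  set B := hessGap i j F G lam y yl x with hB
  have e1 : upperDeriv i j F G lam yl x v = z + (1 / lam) • j E := by
    have := DFunLike.congr_fun (S.upperDeriv_sub x) v
    simp only [sub_apply, smul_apply, ContinuousLinearMap.comp_apply] at this
    rw [hz, hE, ← this]; abel
  have e2 : i v = z - j (implicitDeriv i j c v) := by
    rw [hz, lowerDeriv_apply S]; abel
  have o1 : ∀ w, inner ℝ (c z) (j w) = 0 := fun w => S.lower_inner_zero x v w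
  have o2 : ∀ w, inner ℝ (A (z + (1 / lam) • j E)) (j w) = 0 := fun w => by
    rw [← e1]; exact S.upper_inner_zero x v w
  have hAB : ∀ p, A p = B p + lam • c p := fun p => by
    have := DFunLike.congr_fun (S.penHess_eq x) p
    simpa using this
  have h1 : inner ℝ v (proxyHess i j F G lam y yl x v) =
      inner ℝ (A (z + (1 / lam) • j E)) (i v) - lam * inner ℝ (c z) (i v) := by
    rw [← e1, real_inner_comm, proxyHess]
    simp [inner_sub_left, real_inner_smul_left, adjoint_inner_left, hA, hc, hz]
  have h2 : inner ℝ (A (j E)) z = inner ℝ (B z) (j E) := by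
    rw [hA, S.penHess_symm, ← hA, hAB, inner_add_right, real_inner_smul_right,
      real_inner_comm (c z), o1, real_inner_comm (B z)]
    ring
  rw [h1, e2, inner_sub_right, o2, inner_sub_right, o1, map_add, map_smul, inner_add_left,
    real_inner_smul_left, h2, hAB, inner_add_left, real_inner_smul_left]
  ring

/-- The Hessians of the proxy and of the hyper-objective differ by `O(L k⁵ / lam)`. -/
lemma hess_proxy_sub_hyper (x v : X) :
    |inner ℝ v (hess (proxy i j F G lam y yl) x v) - inner ℝ v (hess (hyper i j F y) x v)| ≤
      48 * (L * k ^ 5 / lam) * ‖v‖ ^ 2 := by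
  have hl := S.lam_pos
  have hL := S.L_pos
  have hk := S.k_pos
  have hk1 := S.one_le_k
  have hmu := S.mu_pos
  obtain ⟨w, hw, hhyp⟩ := S.exists_second_deriv x v
  rw [S.hess_proxy, S.proxyHess_quadratic, hhyp]
  set z := lowerDeriv i j G y x v with hz
  set E := derivGap i j F G lam y yl x v with hE
  set c := hess G (graph i j y x) with hc
  set T := fderiv ℝ (hess G) (graph i j y x) with hT
  set η := yl x - y x with hη
  set R := gradient G (graph i j yl x) - gradient G (graph i j y x) - c (j η) with hR
  set RH := hess G (graph i j yl x) - c - T (j η) with hRH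
  set B := hessGap i j F G lam y yl x with hB
  have nz : ‖z‖ ≤ 2 * k * ‖v‖ := le_of_opNorm_le _ (S.norm_lowerDeriv_le x) v
  have nE : ‖j E‖ ≤ 8 * k ^ 3 * ‖v‖ :=
    (S.lower.norm_j_le _).trans (le_of_opNorm_le _ (S.norm_derivGap_le x) v)
  have nw : ‖w‖ ≤ 4 * k ^ 3 * ‖v‖ ^ 2 := by
    have h1 := S.lower.coercive (graph i j y x) w
    have h2 : inner ℝ (hess G (graph i j y x) (j w)) (j w) = -inner ℝ (T z z) (j w) := by
      linarith [hw w]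
    have h3 : ‖T z z‖ ≤ L * (2 * k * ‖v‖) * (2 * k * ‖v‖) := by
      refine (le_of_opNorm_le _ (le_of_opNorm_le _ (S.norm_third_le _) z) z).trans ?_
      gcongr
    rw [h2] at h1
    have h4 : mu * ‖w‖ ^ 2 ≤ (L * (2 * k * ‖v‖) * (2 * k * ‖v‖)) * ‖w‖ :=
      h1.trans ((neg_le_of_abs_le (abs_real_inner_le_norm _ _) |> neg_le.1).trans
        (mul_le_mul h3 (S.lower.norm_j_le w) (norm_nonneg _) (by positivity)))
    rcases (norm_nonneg w).eq_or_lt with h0 | h0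
    · rw [← h0]; positivity
    · have h5 : (mu * ‖w‖) * ‖w‖ ≤ (mu * ‖w‖) * (4 * k ^ 3 * ‖v‖ ^ 2) := by
        rw [S.L_eq] at h4; linarith
      exact le_of_mul_le_mul_left h5 (by positivity)
  have njw : ‖j w‖ ≤ 4 * k ^ 3 * ‖v‖ ^ 2 := (S.lower.norm_j_le w).trans nw
  -- Stationarity trades `∇F` on `j w` for `-lam * ∇G(yl)`, up to the change of `∇F`. The linear
  -- part of the latter becomes `lam * ⟨T (j η) z, z⟩` by the equation for `w` and the symmetry of
  -- the third derivative. The same term arises from `hessGap` in `hBz`, so these contributions, not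
  -- small in `1 / lam`, cancel.
  have hgrad : inner ℝ (gradient F (graph i j y x)) (j w) =
      lam * inner ℝ (T (j η) z) z
      - inner ℝ (gradient F (graph i j yl x) - gradient F (graph i j y x) + lam • R) (j w) := by
    have c1 := S.upper.crit x w
    have c2 := S.lower.crit x w
    change inner ℝ (penGrad F G lam (graph i j yl x)) _ = 0 at c1
    change inner ℝ (gradient G (graph i j y x)) _ = 0 at c2
    have c3 : inner ℝ (c (j η)) (j w) = -inner ℝ (T (j η) z) z := by
      rw [hc, S.hessG_symm, real_inner_comm, ← hc]
      have h1 : inner ℝ (T z z) (j η) = inner ℝ (T (j η) z) z := by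
        rw [hT, third_symm S.G_smooth, third_swap S.G_smooth, real_inner_comm]
      linarith [hw η]
    rw [hR]
    simp only [penGrad, inner_add_left, inner_sub_left, real_inner_smul_left] at c1 ⊢
    rw [c3]
    linear_combination -lam * c2 + c1
  have hBz : inner ℝ (B z) z = inner ℝ (hess F (graph i j yl x) z) z
      + lam * inner ℝ (RH z) z + lam * inner ℝ (T (j η) z) z := by
    simp only [hB, hRH, hessGap, add_apply, smul_apply, sub_apply, inner_add_left, inner_sub_left,
      real_inner_smul_left]
    ring
  have hdiff : inner ℝ (B z) z + 1 / lam * inner ℝ (B z) (j E)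
      - (inner ℝ (hess F (graph i j y x) z) z + inner ℝ (gradient F (graph i j y x)) (j w)) =
      inner ℝ ((hess F (graph i j yl x) - hess F (graph i j y x)) z) z
      + lam * inner ℝ (RH z) z + 1 / lam * inner ℝ (B z) (j E)
      + inner ℝ (gradient F (graph i j yl x) - gradient F (graph i j y x) + lam • R) (j w) := by
    have hs : inner ℝ ((hess F (graph i j yl x) - hess F (graph i j y x)) z) z =
        inner ℝ (hess F (graph i j yl x) z) z - inner ℝ (hess F (graph i j y x) z) z := by
      rw [sub_apply, inner_sub_left]
    rw [hBz, hgrad, hs]; ring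
  rw [hdiff]
  have t1 : |inner ℝ ((hess F (graph i j yl x) - hess F (graph i j y x)) z) z| ≤
      L * (k / lam) * (2 * k * ‖v‖) * (2 * k * ‖v‖) := by
    refine (abs_real_inner_le_norm _ _).trans (mul_le_mul ?_ nz (norm_nonneg _) (by positivity))
    refine (le_of_opNorm_le _ ((S.F_hess_lip _ _).trans
      (mul_le_mul_of_nonneg_left (S.graph_gap x) hL.le)) z).trans ?_
    gcongr
  have t2 : |lam * inner ℝ (RH z) z| ≤
      lam * (L * (k / lam) ^ 2 * (2 * k * ‖v‖) * (2 * k * ‖v‖)) := by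
    rw [abs_mul, abs_of_pos hl]
    refine mul_le_mul_of_nonneg_left ?_ hl.le
    refine (abs_real_inner_le_norm _ _).trans (mul_le_mul ?_ nz (norm_nonneg _) (by positivity))
    refine (le_of_opNorm_le _ (S.hess_remainder x) z).trans ?_
    gcongr
  have t3 : |1 / lam * inner ℝ (B z) (j E)| ≤
      1 / lam * (2 * L * k * (2 * k * ‖v‖) * (8 * k ^ 3 * ‖v‖)) := by
    rw [abs_mul, abs_of_pos (by positivity : 0 < 1 / lam)]
    refine mul_le_mul_of_nonneg_left ?_ (by positivity)
    refine (abs_real_inner_le_norm _ _).trans (mul_le_mul ?_ nE (norm_nonneg _) (by positivity))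
    refine (le_of_opNorm_le _ (S.norm_hessGap_le x) z).trans ?_
    gcongr
  have t4 : |inner ℝ (gradient F (graph i j yl x) - gradient F (graph i j y x) + lam • R) (j w)| ≤
      (L * (k / lam) + lam * (L * (k / lam) ^ 2)) * (4 * k ^ 3 * ‖v‖ ^ 2) := by
    refine (abs_real_inner_le_norm _ _).trans (mul_le_mul ?_ njw (norm_nonneg _) (by positivity))
    refine (norm_add_le _ _).trans (add_le_add (S.gradF_gap x) ?_)
    rw [norm_smul, Real.norm_of_nonneg hl.le]
    exact mul_le_mul_of_nonneg_left (S.grad_remainder x) hl.le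
  refine (abs_add_le _ _).trans ((add_le_add ((abs_add_le _ _).trans (add_le_add
    ((abs_add_le _ _).trans (add_le_add t1 t2)) t3)) t4).trans ?_)
  -- The four bounds contribute `4k³`, `4k⁴`, `32k⁵` and `4k⁴ + 4k⁵`.
  have e : L * (k / lam) * (2 * k * ‖v‖) * (2 * k * ‖v‖) +
      lam * (L * (k / lam) ^ 2 * (2 * k * ‖v‖) * (2 * k * ‖v‖)) +
      1 / lam * (2 * L * k * (2 * k * ‖v‖) * (8 * k ^ 3 * ‖v‖)) +
      (L * (k / lam) + lam * (L * (k / lam) ^ 2)) * (4 * k ^ 3 * ‖v‖ ^ 2) =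
      (4 * k ^ 3 + 8 * k ^ 4 + 36 * k ^ 5) * (L / lam * ‖v‖ ^ 2) := by field_simp; ring
  rw [e]
  have h3 : k ^ 3 ≤ k ^ 5 := pow_le_pow_right₀ hk1 (by norm_num)
  have h4 : k ^ 4 ≤ k ^ 5 := pow_le_pow_right₀ hk1 (by norm_num)
  calc (4 * k ^ 3 + 8 * k ^ 4 + 36 * k ^ 5) * (L / lam * ‖v‖ ^ 2) ≤
      (48 * k ^ 5) * (L / lam * ‖v‖ ^ 2) := by gcongr; linarith
    _ = _ := by ring

end PenaltySystem

/-! ### Partial derivatives as blocks on the Euclidean product -/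

section Blocks

variable {dx dy : ℕ}

/-- The inclusion `x ↦ (x, 0)`. -/
def inX (dx dy : ℕ) : Vec dx →L[ℝ] WithLp 2 (Vec dx × Vec dy) :=
  ((WithLp.prodContinuousLinearEquiv 2 ℝ (Vec dx) (Vec dy)).symm : _ →L[ℝ] _) ∘L
    ContinuousLinearMap.inl ℝ (Vec dx) (Vec dy)

/-- The inclusion `y ↦ (0, y)`. -/
def inY (dx dy : ℕ) : Vec dy →L[ℝ] WithLp 2 (Vec dx × Vec dy) :=
  ((WithLp.prodContinuousLinearEquiv 2 ℝ (Vec dx) (Vec dy)).symm : _ →L[ℝ] _) ∘L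
    ContinuousLinearMap.inr ℝ (Vec dx) (Vec dy)

lemma inX_apply (x : Vec dx) : inX dx dy x = WithLp.toLp 2 (x, 0) := rfl
lemma inY_apply (y : Vec dy) : inY dx dy y = WithLp.toLp 2 (0, y) := rfl

lemma norm_inX_apply (x : Vec dx) : ‖inX dx dy x‖ = ‖x‖ := by
  rw [inX_apply]; exact WithLp.norm_toLp_fst 2 (Vec dx) (Vec dy) x

lemma norm_inY_apply (y : Vec dy) : ‖inY dx dy y‖ = ‖y‖ := by
  rw [inY_apply]; exact WithLp.norm_toLp_snd 2 (Vec dx) (Vec dy) y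

lemma norm_inX_le : ‖inX dx dy‖ ≤ 1 :=
  opNorm_le_bound _ zero_le_one fun x => by rw [norm_inX_apply, one_mul]

lemma norm_inY_le : ‖inY dx dy‖ ≤ 1 :=
  opNorm_le_bound _ zero_le_one fun x => by rw [norm_inY_apply, one_mul]

lemma joint_apply (h : Vec dx → Vec dy → ℝ) (x : Vec dx) (y : Vec dy) :
    joint h (inX dx dy x + inY dx dy y) = h x y := by
  simp [joint, inX_apply, inY_apply]

lemma exists_eq_inX_add_inY (p : WithLp 2 (Vec dx × Vec dy)) :
    ∃ x y, p = inX dx dy x + inY dx dy y := by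
  refine ⟨p.fst, p.snd, ?_⟩
  rw [inX_apply, inY_apply, ← WithLp.toLp_add]
  simp
  rfl

variable {h : Vec dx → Vec dy → ℝ}

lemma hasGradientAt_fst (hh : Differentiable ℝ (joint h)) (x : Vec dx) (y : Vec dy) :
    HasGradientAt (fun x' => h x' y)
      (adjoint (inX dx dy) (gradient (joint h) (inX dx dy x + inY dx dy y))) x := by
  have h1 := (hh (inX dx dy x + inY dx dy y)).hasGradientAt.hasFDerivAt
  have h2 : HasFDerivAt (fun x' => inX dx dy x' + inY dx dy y) (inX dx dy) x :=
    (inX dx dy).hasFDerivAt.add_const _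
  have h3 := h1.comp x h2
  rw [hasGradientAt_iff_hasFDerivAt]
  have e : (joint h ∘ fun x' => inX dx dy x' + inY dx dy y) = fun x' => h x' y :=
    funext fun x' => joint_apply h x' y
  rw [e] at h3
  refine h3.congr_fderiv ?_
  ext u
  simp [adjoint_inner_left, -WithLp.prod_inner_apply]

lemma hasGradientAt_snd (hh : Differentiable ℝ (joint h)) (x : Vec dx) (y : Vec dy) :
    HasGradientAt (h x)
      (adjoint (inY dx dy) (gradient (joint h) (inX dx dy x + inY dx dy y))) y := by
  have h1 := (hh (inX dx dy x + inY dx dy y)).hasGradientAt.hasFDerivAt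
  have h2 : HasFDerivAt (fun y' => inX dx dy x + inY dx dy y') (inY dx dy) y :=
    (inY dx dy).hasFDerivAt.const_add _
  have h3 := h1.comp y h2
  rw [hasGradientAt_iff_hasFDerivAt]
  have e : (joint h ∘ fun y' => inX dx dy x + inY dx dy y') = h x :=
    funext fun y' => joint_apply h x y'
  rw [e] at h3
  refine h3.congr_fderiv ?_
  ext u
  simp [adjoint_inner_left, -WithLp.prod_inner_apply]

lemma gradX_eq (hh : Differentiable ℝ (joint h)) (x : Vec dx) (y : Vec dy) : gradX h x y =
    adjoint (inX dx dy) (gradient (joint h) (inX dx dy x + inY dx dy y)) :=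
  (hasGradientAt_fst hh x y).gradient

lemma gradY_eq (hh : Differentiable ℝ (joint h)) (x : Vec dx) (y : Vec dy) : gradY h x y =
    adjoint (inY dx dy) (gradient (joint h) (inX dx dy x + inY dx dy y)) :=
  (hasGradientAt_snd hh x y).gradient

lemma hasGradientAt_gradY (hh : Differentiable ℝ (joint h)) (x : Vec dx) (y : Vec dy) :
    HasGradientAt (h x) (gradY h x y) y := by
  rw [gradY_eq hh]; exact hasGradientAt_snd hh x y

lemma hessXX_eq (hh : ContDiff ℝ 2 (joint h)) (x : Vec dx) (y : Vec dy) : hessXX h x y =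
    adjoint (inX dx dy) ∘L hess (joint h) (inX dx dy x + inY dx dy y) ∘L inX dx dy := by
  have h2 : HasFDerivAt (fun x' => inX dx dy x' + inY dx dy y) (inX dx dy) x :=
    (inX dx dy).hasFDerivAt.add_const _
  have h3 := (adjoint (inX dx dy)).hasFDerivAt.comp x ((hasFDerivAt_gradient hh _).comp x h2)
  rw [hessXX, funext fun x' => gradX_eq (hh.differentiable (by simp)) x' y]
  exact h3.fderiv

lemma hessXY_eq (hh : ContDiff ℝ 2 (joint h)) (x : Vec dx) (y : Vec dy) : hessXY h x y =
    adjoint (inX dx dy) ∘L hess (joint h) (inX dx dy x + inY dx dy y) ∘L inY dx dy := by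
  have h2 : HasFDerivAt (fun y' => inX dx dy x + inY dx dy y') (inY dx dy) y :=
    (inY dx dy).hasFDerivAt.const_add _
  have h3 := (adjoint (inX dx dy)).hasFDerivAt.comp y ((hasFDerivAt_gradient hh _).comp y h2)
  rw [hessXY, funext fun y' => gradX_eq (hh.differentiable (by simp)) x y']
  exact h3.fderiv

lemma hessYY_eq (hh : ContDiff ℝ 2 (joint h)) (x : Vec dx) (y : Vec dy) : hessYY h x y =
    yyBlock (inY dx dy) (hess (joint h) (inX dx dy x + inY dx dy y)) := by
  have h2 : HasFDerivAt (fun y' => inX dx dy x + inY dx dy y') (inY dx dy) y :=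
    (inY dx dy).hasFDerivAt.const_add _
  have h3 := (adjoint (inY dx dy)).hasFDerivAt.comp y ((hasFDerivAt_gradient hh _).comp y h2)
  rw [hessYY, funext fun y' => gradY_eq (hh.differentiable (by simp)) x y']
  exact h3.fderiv

/-- The Schur complement in block form. -/
lemma schur_eq_blocks {A : WithLp 2 (Vec dx × Vec dy) →L[ℝ] WithLp 2 (Vec dx × Vec dy)}
    (hA : ∀ u v, inner ℝ (A u) v = inner ℝ u (A v)) :
    adjoint (inX dx dy) ∘L A ∘L graphDeriv (inX dx dy) (inY dx dy) A =
      adjoint (inX dx dy) ∘L A ∘L inX dx dy -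
        (adjoint (inX dx dy) ∘L A ∘L inY dx dy) ∘L (yyBlock (inY dx dy) A).inverse ∘L
          adjoint (adjoint (inX dx dy) ∘L A ∘L inY dx dy) := by
  have hadj : adjoint (adjoint (inX dx dy) ∘L A ∘L inY dx dy) =
      adjoint (inY dx dy) ∘L A ∘L inX dx dy := by
    ext1 u
    refine ext_inner_right ℝ fun v => ?_
    simp only [adjoint_inner_left, ContinuousLinearMap.comp_apply]
    rw [adjoint_inner_right, hA]
  rw [hadj]
  ext1 u
  simp [graphDeriv, implicitDeriv, sub_eq_add_neg]

/-- By orthogonality the bilinear form is `⟨A Z u, Z v⟩` with `Z` the graph operator, a congruence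
of the self-adjoint `A`. -/
lemma schur_symm {A : WithLp 2 (Vec dx × Vec dy) →L[ℝ] WithLp 2 (Vec dx × Vec dy)} {m : ℝ}
    (hm : 0 < m) (hc : ∀ v, m * ‖v‖ ^ 2 ≤ inner ℝ (A (inY dx dy v)) (inY dx dy v))
    (hA : ∀ u v, inner ℝ (A u) v = inner ℝ u (A v)) (u v : Vec dx) :
    inner ℝ ((adjoint (inX dx dy) ∘L A ∘L graphDeriv (inX dx dy) (inY dx dy) A) u) v =
      inner ℝ u ((adjoint (inX dx dy) ∘L A ∘L graphDeriv (inX dx dy) (inY dx dy) A) v) := by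
  have key : ∀ u v, inner ℝ ((adjoint (inX dx dy) ∘L A ∘L graphDeriv (inX dx dy) (inY dx dy) A) u) v =
      inner ℝ (A (graphDeriv (inX dx dy) (inY dx dy) A u)) (graphDeriv (inX dx dy) (inY dx dy) A v) := by
    intro u v
    have e : graphDeriv (inX dx dy) (inY dx dy) A v =
      inX dx dy v + inY dx dy (implicitDeriv (inX dx dy) (inY dx dy) A v) := rfl
    rw [e, inner_add_right, inner_graphDeriv hm hc, add_zero]
    simp only [adjoint_inner_left, ContinuousLinearMap.comp_apply]
  rw [key, real_inner_comm _ u, key, hA, real_inner_comm]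

end Blocks

/-- The standing assumptions of the analysis. -/
structure BilevelSetting {dx dy : ℕ} (f g : Vec dx → Vec dy → ℝ)
    (C ell rho nu mu lbar kappa lam : ℝ) : Prop where
  asm : BilevelAssumption f g C ell rho nu mu
  dy_pos : 0 < dy
  lbar_eq : lbar = ellBar C ell rho nu
  kappa_eq : kappa = lbar / mu
  lam_ge : 2 * ell / mu ≤ lam

/-! ### The bilevel problem as a penalty system -/

namespace BilevelSetting

open PenaltySystem

variable {dx dy : ℕ} {f g : Vec dx → Vec dy → ℝ} {C ell rho nu mu lbar kappa lam : ℝ}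
variable (S : BilevelSetting f g C ell rho nu mu lbar kappa lam)
include S

lemma mu_pos : 0 < mu := S.asm.mu_pos
lemma C_le : C ≤ lbar := by rw [S.lbar_eq]; exact (le_max_left _ _).trans (le_max_left _ _)
lemma ell_le : ell ≤ lbar := by rw [S.lbar_eq]; exact (le_max_right _ _).trans (le_max_left _ _)
lemma nu_le : nu ≤ lbar := by rw [S.lbar_eq]; exact (le_max_left _ _).trans (le_max_right _ _)
lemma rho_le : rho ≤ lbar := by rw [S.lbar_eq]; exact (le_max_right _ _).trans (le_max_right _ _)

lemma g_diff : Differentiable ℝ (joint g) := S.asm.g_smooth.differentiable (by simp)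
lemma f_diff : Differentiable ℝ (joint f) := S.asm.f_smooth.differentiable (by simp)
lemma g_two : ContDiff ℝ 2 (joint g) := S.asm.g_smooth.of_le (by norm_num)

/-- A unit vector of the lower space is what forces `mu ≤ ell` and `0 ≤ rho`. -/
lemma exists_unit : ∃ v : Vec dy, ‖v‖ = 1 :=
  ⟨EuclideanSpace.single ⟨0, S.dy_pos⟩ 1, by simp⟩

lemma gradY_g_mono (x : Vec dx) (y y' : Vec dy) :
    mu * ‖y - y'‖ ^ 2 ≤ inner ℝ (gradY g x y - gradY g x y') (y - y') :=
  (S.asm.g_strong x).gradient_mono (hasGradientAt_gradY S.g_diff x) y y'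

omit S in
lemma inner_gradY_sub_le {h : Vec dx → Vec dy → ℝ} (hh : Differentiable ℝ (joint h))
    (hl : ∀ p q, ‖gradient (joint h) p - gradient (joint h) q‖ ≤ ell * ‖p - q‖) (x : Vec dx)
    (y y' : Vec dy) : |inner ℝ (gradY h x y - gradY h x y') (y - y')| ≤ ell * ‖y - y'‖ ^ 2 := by
  rw [gradY_eq hh, gradY_eq hh, ← map_sub, adjoint_inner_left]
  refine (abs_real_inner_le_norm _ _).trans ?_
  rw [norm_inY_apply]
  have := hl (inX dx dy x + inY dx dy y) (inX dx dy x + inY dx dy y')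
  rw [add_sub_add_left_eq_sub, ← map_sub, norm_inY_apply] at this
  calc _ ≤ ell * ‖y - y'‖ * ‖y - y'‖ := by gcongr
    _ = _ := by ring

lemma mu_le_ell : mu ≤ ell := by
  obtain ⟨v, hv⟩ := S.exists_unit
  have h1 := S.gradY_g_mono 0 v 0
  have h2 := (abs_le.1 (inner_gradY_sub_le S.g_diff S.asm.g_grad_lip 0 v 0)).2
  rw [sub_zero, hv] at h1 h2
  linarith

lemma ell_pos : 0 < ell := S.mu_pos.trans_le S.mu_le_ell
lemma lbar_pos : 0 < lbar := S.ell_pos.trans_le S.ell_le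

lemma rho_nonneg : 0 ≤ rho := by
  obtain ⟨v, hv⟩ := S.exists_unit
  have := (norm_nonneg _).trans (S.asm.g_hess_lip (inY dx dy v) 0)
  rwa [sub_zero, norm_inY_apply, hv, mul_one] at this

lemma one_le_kappa : 1 ≤ kappa := by
  rw [S.kappa_eq, le_div_iff₀ S.mu_pos, one_mul]
  exact S.mu_le_ell.trans S.ell_le

lemma lbar_eq_mul : lbar = kappa * mu := by
  rw [S.kappa_eq, div_mul_cancel₀ _ S.mu_pos.ne']

lemma two_ell_le : 2 * ell ≤ lam * mu := by
  have := S.lam_ge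
  rwa [div_le_iff₀ S.mu_pos] at this

lemma two_le_lam : 2 ≤ lam := by
  refine le_trans ?_ S.lam_ge
  rw [le_div_iff₀ S.mu_pos]
  linarith [S.mu_le_ell]

/-- The gradient of `L_λ(x, ·)`. -/
lemma hasGradientAt_penalty (x : Vec dx) (y : Vec dy) :
    HasGradientAt (penalty f g lam x) (gradY f x y + lam • gradY g x y) y := by
  have h1 := (hasGradientAt_gradY S.f_diff x y).hasFDerivAt.add
    (((hasGradientAt_gradY S.g_diff x y).hasFDerivAt.sub_const (g x (yStar g x))).const_mul lam)
  rw [hasGradientAt_iff_hasFDerivAt]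
  refine h1.congr_fderiv ?_
  rw [map_add, map_smul]

/-- `f` need not be convex in `y`: its curvature, at worst `-ell`, costs at most half of `lam * mu`,
since `lam * mu ≥ 2 * ell`. -/
lemma penalty_mono (x : Vec dx) (y y' : Vec dy) : lam * mu / 2 * ‖y - y'‖ ^ 2 ≤
    inner ℝ ((gradY f x y + lam • gradY g x y) - (gradY f x y' + lam • gradY g x y')) (y - y') := by
  have e : (gradY f x y + lam • gradY g x y) - (gradY f x y' + lam • gradY g x y') =
      (gradY f x y - gradY f x y') + lam • (gradY g x y - gradY g x y') := by
    rw [smul_sub]; abel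
  rw [e, inner_add_left, real_inner_smul_left]
  have h1 := (abs_le.1 (inner_gradY_sub_le S.f_diff S.asm.f_grad_lip x y y')).1
  have h2 := mul_le_mul_of_nonneg_left (S.gradY_g_mono x y y') (by linarith [S.two_le_lam] : 0 ≤ lam)
  have h3 := mul_le_mul_of_nonneg_right S.two_ell_le (sq_nonneg ‖y - y'‖)
  linarith

lemma penalty_lip (x : Vec dx) (y y' : Vec dy) :
    inner ℝ ((gradY f x y + lam • gradY g x y) - (gradY f x y' + lam • gradY g x y')) (y - y') ≤
      (1 + lam) * ell * ‖y - y'‖ ^ 2 := by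
  have e : (gradY f x y + lam • gradY g x y) - (gradY f x y' + lam • gradY g x y') =
      (gradY f x y - gradY f x y') + lam • (gradY g x y - gradY g x y') := by
    rw [smul_sub]; abel
  rw [e, inner_add_left, real_inner_smul_left]
  have h1 := (abs_le.1 (inner_gradY_sub_le S.f_diff S.asm.f_grad_lip x y y')).2
  have h2 := mul_le_mul_of_nonneg_left (abs_le.1 (inner_gradY_sub_le S.g_diff S.asm.g_grad_lip
    x y y')).2 (by linarith [S.two_le_lam] : 0 ≤ lam)
  linarith

lemma yStar_min (x : Vec dx) (y : Vec dy) : g x (yStar g x) ≤ g x y :=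
  argmin_spec (exists_minimizer (hasGradientAt_gradY S.g_diff x) S.mu_pos (S.gradY_g_mono x)) y

lemma yStarPen_min (x : Vec dx) (y : Vec dy) :
    penalty f g lam x (yStarPen f g lam x) ≤ penalty f g lam x y :=
  argmin_spec (exists_minimizer (S.hasGradientAt_penalty x)
    (by have := S.mu_pos; have := S.two_le_lam; positivity) (S.penalty_mono x)) y

lemma gradY_yStar (x : Vec dx) : gradY g x (yStar g x) = 0 :=
  gradient_eq_zero_of_minimizer (hasGradientAt_gradY S.g_diff x _) (S.yStar_min x)

lemma gradY_yStarPen (x : Vec dx) :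
    gradY f x (yStarPen f g lam x) + lam • gradY g x (yStarPen f g lam x) = 0 :=
  gradient_eq_zero_of_minimizer (S.hasGradientAt_penalty x _) (S.yStarPen_min x)

lemma norm_hess_f_le (p : WithLp 2 (Vec dx × Vec dy)) : ‖hess (joint f) p‖ ≤ ell :=
  (hasFDerivAt_gradient S.asm.f_smooth p).le_of_lip' S.ell_pos.le
    (Filter.Eventually.of_forall fun q => S.asm.f_grad_lip q p)

lemma norm_hess_g_le (p : WithLp 2 (Vec dx × Vec dy)) : ‖hess (joint g) p‖ ≤ ell :=
  (hasFDerivAt_gradient S.g_two p).le_of_lip' S.ell_pos.le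
    (Filter.Eventually.of_forall fun q => S.asm.g_grad_lip q p)

lemma norm_grad_f_le (p : WithLp 2 (Vec dx × Vec dy)) : ‖gradient (joint f) p‖ ≤ lbar := by
  have h1 := (S.f_diff p).hasGradientAt.hasFDerivAt.le_of_lip' S.lbar_pos.le
    (Filter.Eventually.of_forall fun q => (S.asm.f_lip q p).trans
      (mul_le_mul_of_nonneg_right S.C_le (norm_nonneg _)))
  rwa [LinearIsometryEquiv.norm_map] at h1

lemma penHess_norm_le (p : WithLp 2 (Vec dx × Vec dy)) :
    ‖penHess (joint f) (joint g) lam p‖ ≤ (1 + lam) * ell := by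
  have hl : 0 ≤ lam := by linarith [S.two_le_lam]
  refine (norm_add_le _ _).trans ?_
  rw [norm_smul, Real.norm_of_nonneg hl]
  have := mul_le_mul_of_nonneg_left (S.norm_hess_g_le p) hl
  linarith [S.norm_hess_f_le p]

lemma penHess_sub_le (p q : WithLp 2 (Vec dx × Vec dy)) :
    ‖penHess (joint f) (joint g) lam p - penHess (joint f) (joint g) lam q‖ ≤
      (rho + lam * rho) * ‖p - q‖ := by
  have hl : 0 ≤ lam := by linarith [S.two_le_lam]
  have e : penHess (joint f) (joint g) lam p - penHess (joint f) (joint g) lam q =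
      (hess (joint f) p - hess (joint f) q) + lam • (hess (joint g) p - hess (joint g) q) := by
    simp only [penHess, smul_sub]; abel
  rw [e]
  refine (norm_add_le _ _).trans ?_
  rw [norm_smul, Real.norm_of_nonneg hl]
  have := mul_le_mul_of_nonneg_left (S.asm.g_hess_lip p q) hl
  linarith [S.asm.f_hess_lip p q]

/-- Here and in `upper` the bounds keep `ell` instead of `lbar`, to match `hessErrFactor`. The
relaxation to `lbar` happens in `system`. -/
lemma lower : ImplicitSolution (inX dx dy) (inY dx dy) (gradient (joint g)) (hess (joint g)) mu
    ell (yStar g) where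
  norm_i := norm_inX_le
  norm_j := norm_inY_le
  m_pos := S.mu_pos
  deriv := hasFDerivAt_gradient S.g_two
  bound := S.norm_hess_g_le
  mono p v := by
    obtain ⟨x, y, rfl⟩ := exists_eq_inX_add_inY p
    have := S.gradY_g_mono x (y + v) y
    rw [gradY_eq S.g_diff, gradY_eq S.g_diff, ← map_sub, adjoint_inner_left, add_sub_cancel_left,
      map_add, ← add_assoc] at this
    exact this
  crit x v := by
    rw [← adjoint_inner_left, ← gradY_eq S.g_diff, S.gradY_yStar, inner_zero_left]

lemma upper : ImplicitSolution (inX dx dy) (inY dx dy) (penGrad (joint f) (joint g) lam)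
    (penHess (joint f) (joint g) lam) (lam * mu / 2) ((1 + lam) * ell) (yStarPen f g lam) where
  norm_i := norm_inX_le
  norm_j := norm_inY_le
  m_pos := by have := S.mu_pos; have := S.two_le_lam; positivity
  deriv p := (hasFDerivAt_gradient S.asm.f_smooth p).add
    ((hasFDerivAt_gradient S.g_two p).const_smul lam)
  bound := S.penHess_norm_le
  mono p v := by
    obtain ⟨x, y, rfl⟩ := exists_eq_inX_add_inY p
    have := S.penalty_mono x (y + v) y
    rw [gradY_eq S.g_diff, gradY_eq S.g_diff, gradY_eq S.f_diff, gradY_eq S.f_diff, ← map_smul,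
      ← map_smul, ← map_add, ← map_add, ← map_sub, adjoint_inner_left, add_sub_cancel_left,
      map_add, ← add_assoc] at this
    exact this
  crit x v := by
    rw [← adjoint_inner_left, penGrad, map_add, map_smul, ← gradY_eq S.g_diff,
      ← gradY_eq S.f_diff, S.gradY_yStarPen, inner_zero_left]

lemma system : PenaltySystem (inX dx dy) (inY dx dy) (joint f) (joint g) lbar mu kappa lam
    (yStar g) (yStarPen f g lam) where
  lower := { S.lower with bound := fun p => (S.norm_hess_g_le p).trans S.ell_le }
  upper := { S.upper with
    bound := fun p => (S.penHess_norm_le p).trans (by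
      have := S.two_le_lam
      have := S.ell_le
      gcongr) }
  L_eq := S.lbar_eq_mul
  one_le_k := S.one_le_kappa
  two_le_lam := S.two_le_lam
  F_smooth := S.asm.f_smooth
  G_smooth := S.asm.g_smooth
  F_grad := S.norm_grad_f_le
  F_hess p := (S.norm_hess_f_le p).trans S.ell_le
  F_hess_lip p q := (S.asm.f_hess_lip p q).trans
    (mul_le_mul_of_nonneg_right S.rho_le (norm_nonneg _))
  G_hess_lip p q := (S.asm.g_hess_lip p q).trans
    (mul_le_mul_of_nonneg_right S.rho_le (norm_nonneg _))
  G_third_lip p q := (S.asm.g_third_lip p q).trans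
    (mul_le_mul_of_nonneg_right S.nu_le (norm_nonneg _))

omit S in
lemma hyperObj_eq : hyperObj f g = hyper (inX dx dy) (inY dx dy) (joint f) (yStar g) :=
  funext fun x => (joint_apply f x _).symm

omit S in
lemma penaltyStar_eq : penaltyStar f g lam =
    proxy (inX dx dy) (inY dx dy) (joint f) (joint g) lam (yStar g) (yStarPen f g lam) := by
  ext x
  simp only [proxy, graph, joint_apply]; rfl

lemma penaltyStar_le (x : Vec dx) : penaltyStar f g lam x ≤ hyperObj f g x := by
  refine (S.yStarPen_min x (yStar g x)).trans_eq ?_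
  simp [penalty, hyperObj]

/-- Dropping the nonnegative penalty leaves values of `f` at two points within `kappa / lam` of each
other. -/
lemma hyperObj_le (x : Vec dx) :
    hyperObj f g x ≤ penaltyStar f g lam x + lbar * kappa / lam := by
  have h1 := S.yStar_min x (yStarPen f g lam x)
  have h2 := S.system.graph_gap x
  have hl : 0 ≤ lam := by linarith [S.two_le_lam]
  have h3 := S.asm.f_lip (graph (inX dx dy) (inY dx dy) (yStar g) x)
    (graph (inX dx dy) (inY dx dy) (yStarPen f g lam) x)
  simp only [graph] at h2 h3
  rw [joint_apply, joint_apply, norm_sub_rev (_ + _)] at h3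
  have h4 : C * ‖(inX dx dy x + inY dx dy (yStarPen f g lam x))
      - (inX dx dy x + inY dx dy (yStar g x))‖ ≤ lbar * (kappa / lam) :=
    mul_le_mul S.C_le h2 (norm_nonneg _) S.lbar_pos.le
  have h5 := (le_abs_self _).trans (h3.trans h4)
  have h6 : penaltyStar f g lam x = f x (yStarPen f g lam x)
    + lam * (g x (yStarPen f g lam x) - g x (yStar g x)) := rfl
  have h7 := mul_nonneg hl (sub_nonneg.2 h1)
  rw [h6, hyperObj, mul_div_assoc]
  linarith

lemma contDiff_penaltyStar : ContDiff ℝ 2 (penaltyStar f g lam) := by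
  rw [penaltyStar_eq]; exact S.system.contDiff_proxy

lemma hess_penaltyStar_lip (x x' : Vec dx) :
    ‖hess (penaltyStar f g lam) x - hess (penaltyStar f g lam) x'‖ ≤
      352 * (lbar * kappa ^ 5) * ‖x - x'‖ := by
  rw [penaltyStar_eq, S.system.hess_proxy, S.system.hess_proxy]
  exact (S.system.proxyHess_lip x x').trans_eq (by ring)

end BilevelSetting

/-! ### Accuracy of the estimates and of the inner loops -/

namespace BilevelSetting

open PenaltySystem

variable {dx dy : ℕ} {f g : Vec dx → Vec dy → ℝ} {C ell rho nu mu lbar kappa lam : ℝ}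
variable (S : BilevelSetting f g C ell rho nu mu lbar kappa lam)
include S

/-- The estimator is the exact formula `proxyGrad` with the minimizers replaced by `y` and `w`, so
Lipschitz gradients suffice. -/
lemma gradEst_error (x : Vec dx) (y w : Vec dy) :
    ‖(gradEst f g lam x y w).val - gradient (penaltyStar f g lam) x‖ ≤
      (1 + lam) * ell * ‖y - yStarPen f g lam x‖ + lam * ell * ‖w - yStar g x‖ := by
  have hl : 0 ≤ lam := by linarith [S.two_le_lam]
  have e : (gradEst f g lam x y w).val =
      gradX f x y + lam • (gradX g x y - gradX g x w) := rfl
  set p := inX dx dy x + inY dx dy y with hp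
  set q := inX dx dy x + inY dx dy w with hq
  set p' := graph (inX dx dy) (inY dx dy) (yStarPen f g lam) x with hp'
  set q' := graph (inX dx dy) (inY dx dy) (yStar g) x with hq'
  have hpp : ‖p - p'‖ = ‖y - yStarPen f g lam x‖ := by
    rw [hp, hp', graph, add_sub_add_left_eq_sub, ← map_sub, norm_inY_apply]
  have hqq : ‖q - q'‖ = ‖w - yStar g x‖ := by
    rw [hq, hq', graph, add_sub_add_left_eq_sub, ← map_sub, norm_inY_apply]
  rw [e, penaltyStar_eq, S.system.gradient_proxy, proxyGrad, gradX_eq S.f_diff, gradX_eq S.g_diff,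
    gradX_eq S.g_diff, ← map_sub, ← map_smul, ← map_add, ← map_sub]
  have e2 : gradient (joint f) p + lam • (gradient (joint g) p - gradient (joint g) q) -
      (penGrad (joint f) (joint g) lam p' - lam • gradient (joint g) q') =
      (gradient (joint f) p - gradient (joint f) p')
        + lam • (gradient (joint g) p - gradient (joint g) p')
        - lam • (gradient (joint g) q - gradient (joint g) q') := by
    simp only [penGrad, smul_sub]; abel
  refine (le_of_opNorm_le _ (norm_adjoint_le norm_inX_le) _).trans ?_
  rw [one_mul, e2, ← hpp, ← hqq]
  refine (norm_sub_le _ _).trans ((add_le_add ((norm_add_le _ _).trans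
    (add_le_add (S.asm.f_grad_lip p p') (le_of_eq (norm_smul _ _)))) (le_of_eq (norm_smul _ _))).trans ?_)
  rw [Real.norm_of_nonneg hl]
  have h1 := mul_le_mul_of_nonneg_left (S.asm.g_grad_lip p p') hl
  have h2 := mul_le_mul_of_nonneg_left (S.asm.g_grad_lip q q') hl
  linarith

lemma penHess_symm (p u v : WithLp 2 (Vec dx × Vec dy)) :
    inner ℝ (penHess (joint f) (joint g) lam p u) v =
      inner ℝ u (penHess (joint f) (joint g) lam p v) := S.system.penHess_symm p u v

/-- The nine blocks assemble into the two Schur complements of `proxyHess` at inexact points, so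
that `schur_sub_le` applies to each. -/
lemma hessEst_eq (x : Vec dx) (y w : Vec dy) : (hessEst f g lam x y w).val =
    adjoint (inX dx dy) ∘L penHess (joint f) (joint g) lam (inX dx dy x + inY dx dy y) ∘L
        graphDeriv (inX dx dy) (inY dx dy)
          (penHess (joint f) (joint g) lam (inX dx dy x + inY dx dy y))
      - lam • (adjoint (inX dx dy) ∘L hess (joint g) (inX dx dy x + inY dx dy w) ∘L
        graphDeriv (inX dx dy) (inY dx dy) (hess (joint g) (inX dx dy x + inY dx dy w))) := by
  rw [schur_eq_blocks (S.penHess_symm _), schur_eq_blocks (hess_symm S.g_two _)]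
  have e : (hessEst f g lam x y w).val = hessXX f x y + lam • (hessXX g x y - hessXX g x w)
    - (hessXY f x y + lam • hessXY g x y) ∘L (hessYY f x y + lam • hessYY g x y).inverse ∘L
      adjoint (hessXY f x y + lam • hessXY g x y)
    + lam • (hessXY g x w ∘L (hessYY g x w).inverse ∘L adjoint (hessXY g x w)) := rfl
  have b1 : ∀ p, hessXY f x p + lam • hessXY g x p = adjoint (inX dx dy) ∘L
      penHess (joint f) (joint g) lam (inX dx dy x + inY dx dy p) ∘L inY dx dy := fun p => by
    rw [hessXY_eq S.asm.f_smooth, hessXY_eq S.g_two]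
    ext1 u
    simp [penHess]
  have b2 : ∀ p, hessYY f x p + lam • hessYY g x p = yyBlock (inY dx dy)
      (penHess (joint f) (joint g) lam (inX dx dy x + inY dx dy p)) := fun p => by
    rw [hessYY_eq S.asm.f_smooth, hessYY_eq S.g_two]
    ext1 u
    simp [penHess, yyBlock]
  have b3 : hessXX f x y + lam • hessXX g x y = adjoint (inX dx dy) ∘L
      penHess (joint f) (joint g) lam (inX dx dy x + inY dx dy y) ∘L inX dx dy := by
    rw [hessXX_eq S.asm.f_smooth, hessXX_eq S.g_two]
    ext1 u
    simp [penHess]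
  rw [e, b1, b2, ← b3, hessXY_eq S.g_two, hessYY_eq S.g_two, ← hessXX_eq S.g_two]
  simp only [smul_sub]
  abel

lemma hessEst_symm (x : Vec dx) (y w : Vec dy) (u v : Vec dx) :
    inner ℝ ((hessEst f g lam x y w).val u) v = inner ℝ u ((hessEst f g lam x y w).val v) := by
  rw [S.hessEst_eq]
  simp only [sub_apply, smul_apply, inner_sub_left, inner_sub_right, real_inner_smul_left,
    real_inner_smul_right]
  rw [schur_symm S.upper.m_pos (S.upper.coercive _) (S.penHess_symm _),
    schur_symm S.mu_pos (S.lower.coercive _) (hess_symm S.g_two _)]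

lemma hessEst_error (x : Vec dx) (y w : Vec dy) :
    ‖(hessEst f g lam x y w).val - hess (penaltyStar f g lam) x‖ ≤
      hessErrFactor ell rho mu lam * (‖y - yStarPen f g lam x‖ + ‖w - yStar g x‖) := by
  have hl : 0 < lam := by linarith [S.two_le_lam]
  have hmu := S.mu_pos
  have hell := S.ell_pos
  have hrho := S.rho_nonneg
  rw [penaltyStar_eq, S.system.hess_proxy, proxyHess, S.hessEst_eq]
  set p := inX dx dy x + inY dx dy y with hp
  set q := inX dx dy x + inY dx dy w with hq
  set p' := graph (inX dx dy) (inY dx dy) (yStarPen f g lam) x with hp'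
  set q' := graph (inX dx dy) (inY dx dy) (yStar g) x with hq'
  have hpp : ‖p - p'‖ = ‖y - yStarPen f g lam x‖ := by
    rw [hp, hp', graph, add_sub_add_left_eq_sub, ← map_sub, norm_inY_apply]
  have hqq : ‖q - q'‖ = ‖w - yStar g x‖ := by
    rw [hq, hq', graph, add_sub_add_left_eq_sub, ← map_sub, norm_inY_apply]
  have h1 := schur_sub_le (i := inX dx dy) norm_inX_le norm_inY_le S.upper.m_pos
    (S.upper.coercive p) (S.penHess_norm_le p) (S.upper.coercive p') (S.penHess_norm_le p')
    (S.penHess_symm p')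
  have h2 := schur_sub_le (i := inX dx dy) norm_inX_le norm_inY_le S.mu_pos
    (S.lower.coercive q) (S.norm_hess_g_le q) (S.lower.coercive q') (S.norm_hess_g_le q')
    (hess_symm S.g_two q')
  -- The factor is the expansion of `(1 + K / m) ^ 2` from `schur_sub_le`, with `K = (1 + lam) *
  -- ell` and `m = lam * mu / 2`, times the Lipschitz constant of the penalized Hessian.
  have hE : hessErrFactor ell rho mu lam =
      (rho + lam * rho) * (1 + (1 + lam) * ell / (lam * mu / 2)) ^ 2 := by
    unfold hessErrFactor
    field_simp
    ring
  have e : ∀ a b c d : Vec dx →L[ℝ] Vec dx, a - lam • b - (c - lam • d) =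
      (a - c) - lam • (b - d) := fun a b c d => by rw [smul_sub]; abel
  have k1 : ‖penHess (joint f) (joint g) lam p - penHess (joint f) (joint g) lam p'‖ *
      (1 + (1 + lam) * ell / (lam * mu / 2)) ^ 2 ≤
      hessErrFactor ell rho mu lam * ‖y - yStarPen f g lam x‖ := by
    rw [hE, ← hpp]
    calc _ ≤ (rho + lam * rho) * ‖p - p'‖ * (1 + (1 + lam) * ell / (lam * mu / 2)) ^ 2 := by
          gcongr; exact S.penHess_sub_le p p'
      _ = _ := by ring
  have k2 : lam * (‖hess (joint g) q - hess (joint g) q'‖ * (1 + ell / mu) ^ 2) ≤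
      hessErrFactor ell rho mu lam * ‖w - yStar g x‖ := by
    rw [hE, ← hqq]
    have r1 : ell / mu ≤ (1 + lam) * ell / (lam * mu / 2) := by
      rw [div_le_div_iff₀ hmu (by positivity)]
      nlinarith [mul_pos hell hmu]
    calc _ ≤ lam * (rho * ‖q - q'‖ * (1 + (1 + lam) * ell / (lam * mu / 2)) ^ 2) := by
          gcongr; exact S.asm.g_hess_lip q q'
      _ = (lam * rho) * (1 + (1 + lam) * ell / (lam * mu / 2)) ^ 2 * ‖q - q'‖ := by ring
      _ ≤ _ := by gcongr; linarith
  rw [e, mul_add]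
  refine (norm_sub_le _ _).trans (add_le_add (h1.trans k1) ?_)
  rw [norm_smul, Real.norm_of_nonneg hl.le]
  exact (mul_le_mul_of_nonneg_left h2 hl.le).trans k2

lemma agd_lower_accuracy (x : Vec dx) {z : Vec dy} {K : ℕ} {tol a : ℝ} (htol : 0 < tol)
    (ha : ‖z - yStar g x‖ ≤ a)
    (hK : 2 * √(3 * kappa) * Real.log (√(3 * kappa + 1) / tol * a) ≤ K) :
    ‖(agd (gradLower g x) z K (1 / ell) (momentum kappa)).val - yStar g x‖ ≤ tol :=
  agd_accuracy (hasGradientAt_gradY S.g_diff x) S.ell_pos S.one_le_kappa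
    (by rw [mul_comm, ← S.lbar_eq_mul]; exact S.ell_le)
    (fun p p' => (abs_le.1 (inner_gradY_sub_le S.g_diff S.asm.g_grad_lip x p p')).2)
    (S.gradY_g_mono x) (S.gradY_yStar x) (fun _ => rfl) (by linarith [S.one_le_kappa]) htol ha hK

/-- Since `lam ≥ 2`, `(1 + lam) * ell ≤ 3 / 2 * lam * lbar`, so the condition number relative to
`lam * mu / 2` is at most `3 * kappa`. -/
lemma agd_upper_accuracy (x : Vec dx) {z : Vec dy} {K : ℕ} {tol a : ℝ} (htol : 0 < tol)
    (ha : ‖z - yStarPen f g lam x‖ ≤ a)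
    (hK : 2 * √(3 * kappa) * Real.log (√(3 * kappa + 1) / tol * a) ≤ K) :
    ‖(agd (gradPenalty f g lam x) z K (1 / ((1 + lam) * ell)) (momentum (3 * kappa))).val
      - yStarPen f g lam x‖ ≤ tol := by
  have hell := S.ell_pos
  have h2 := S.two_le_lam
  refine agd_accuracy (S.hasGradientAt_penalty x) (by positivity) (by linarith [S.one_le_kappa])
    ?_ (S.penalty_lip x) (S.penalty_mono x) (S.gradY_yStarPen x) (fun _ => rfl) le_rfl htol ha hK
  have e : lam * mu / 2 * (3 * kappa) = 3 / 2 * lam * lbar := by rw [S.lbar_eq_mul]; ring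
  rw [e]
  have := S.ell_le
  exact mul_le_mul (by linarith) S.ell_le hell.le (by linarith)

/-- The constant `kappa` would do; `4 * kappa` agrees with `yStarPen_lip`, so one warm-start radius
serves both loops. -/
lemma yStar_lip (x x' : Vec dx) : ‖yStar g x - yStar g x'‖ ≤ 4 * kappa * ‖x - x'‖ := by
  refine (S.system.lower.norm_sub_le x x').trans ?_
  rw [S.system.lower_ratio]
  gcongr
  linarith [S.one_le_kappa]

lemma yStarPen_lip (x x' : Vec dx) :
    ‖yStarPen f g lam x - yStarPen f g lam x'‖ ≤ 4 * kappa * ‖x - x'‖ := by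
  refine (S.system.upper.norm_sub_le x x').trans ?_
  gcongr
  linarith [S.one_le_kappa, S.system.upper_ratio]

end BilevelSetting

/-! ### One iteration and its oracle calls -/

section Iteration

variable {dx dy : ℕ} (f g : Vec dx → Vec dy → ℝ) (I : LFSBAInput dx) (t : ℕ)
  (σ : LFSBAState dx dy)

/-- The vector `w_t` computed by iteration `t`. -/
def nextW : Vec dy :=
  (agd (gradLower g σ.x) σ.w (I.K1 t σ.s) (1 / I.ell1) (momentum I.kappa1)).val

/-- The vector `y_t` computed by iteration `t`. -/
def nextY : Vec dy :=
  (agd (gradPenalty f g I.lam σ.x) σ.y (I.K2 t σ.s) (1 / I.ell2) (momentum I.kappa2)).val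

lemma lfsbaOracles_grad : (lfsbaOracles f g I t σ).val.1 =
    (gradEst f g I.lam σ.x (nextY f g I t σ) (nextW g I t σ)).val := by
  unfold lfsbaOracles
  simp only [Counted.bind_val]
  split_ifs <;> rfl

lemma lfsbaOracles_w : (lfsbaOracles f g I t σ).val.2.w = nextW g I t σ := by
  unfold lfsbaOracles
  simp only [Counted.bind_val]
  split_ifs <;> rfl

lemma lfsbaOracles_y : (lfsbaOracles f g I t σ).val.2.y = nextY f g I t σ := by
  unfold lfsbaOracles
  simp only [Counted.bind_val]
  split_ifs <;> rfl

lemma lfsbaOracles_snap : (lfsbaOracles f g I t σ).val.2.snap =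
    if t % I.m = 0 then σ.x else σ.snap := by
  unfold lfsbaOracles
  simp only [Counted.bind_val]
  split_ifs <;> rfl

lemma lfsbaOracles_H : (lfsbaOracles f g I t σ).val.2.H =
    if t % I.m = 0 then (hessEst f g I.lam σ.x (nextY f g I t σ) (nextW g I t σ)).val else σ.H := by
  unfold lfsbaOracles
  simp only [Counted.bind_val]
  split_ifs <;> rfl

lemma lfsbaOracles_first : (lfsbaOracles f g I t σ).first = I.K1 t σ.s + I.K2 t σ.s * 2 + 3 := by
  have h1 : ∀ a b, (agd (gradLower g σ.x) σ.w (I.K1 t σ.s) a b).first = I.K1 t σ.s := fun a b => by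
    rw [agd, agdLoop_first (c := 1) (fun _ => rfl), mul_one]
  have h2 : ∀ a b, (agd (gradPenalty f g I.lam σ.x) σ.y (I.K2 t σ.s) a b).first =
      I.K2 t σ.s * 2 := fun a b => by rw [agd, agdLoop_first (c := 2) (fun _ => rfl)]
  unfold lfsbaOracles
  simp only [Counted.bind_first, h1, h2]
  split_ifs
  · change _ + (_ + (3 + (0 + 0))) = _; ring
  · change _ + (_ + (3 + 0)) = _; ring

lemma lfsbaOracles_second : (lfsbaOracles f g I t σ).second = if t % I.m = 0 then 9 else 0 := by
  have h1 : ∀ a b, (agd (gradLower g σ.x) σ.w (I.K1 t σ.s) a b).second = 0 := fun a b => by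
    rw [agd, agdLoop_second (fun _ => rfl)]
  have h2 : ∀ a b, (agd (gradPenalty f g I.lam σ.x) σ.y (I.K2 t σ.s) a b).second = 0 :=
    fun a b => by rw [agd, agdLoop_second (fun _ => rfl)]
  unfold lfsbaOracles
  simp only [Counted.bind_second, h1, h2]
  split_ifs <;> rfl

end Iteration

/-- The assumptions under which a run of LFSBA is analysed, with the constant `1000` for the
lower bounds on `ρ̄`, `M` and `T`. -/
structure LFSBASetting {dx dy : ℕ} (f g : Vec dx → Vec dy → ℝ)
    (C ell rho nu mu lbar kappa lam : ℝ) (x₀ : Vec dx) (Δ : ℝ) (m : ℕ) (ε rhoBar M C₂ : ℝ)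
    (T : ℕ) : Prop extends BilevelSetting f g C ell rho nu mu lbar kappa lam where
  gap_eq : Δ = gap f g x₀
  gap_pos : 0 < Δ
  one_le_m : 1 ≤ m
  eps_pos : 0 < ε
  rhoBar_ge : 1000 * (lbar * kappa ^ 5) ≤ rhoBar
  M_ge : 1000 * (m * rhoBar) ≤ M
  lam_eq : lam = penaltyParam lbar kappa Δ ε M
  C₂_pos : 0 < C₂
  C₂_ge : hessErrFactor ell rho mu lam ≤ C₂
  T_ge : 1000 * (Δ * √M * ε ^ (-(3 / 2) : ℝ)) ≤ T

lemma rpow_neg_three_halves {ε : ℝ} (hε : 0 < ε) : ε ^ (-(3 / 2) : ℝ) = (√ε ^ 3)⁻¹ := by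
  rw [Real.rpow_neg hε.le, Real.sqrt_eq_rpow, ← Real.rpow_natCast, ← Real.rpow_mul hε.le]
  norm_num

/-! ### Consequences of the parameter choices -/

namespace LFSBASetting

variable {dx dy : ℕ} {f g : Vec dx → Vec dy → ℝ} {C ell rho nu mu lbar kappa lam : ℝ}
  {x₀ : Vec dx} {Δ : ℝ} {m : ℕ} {ε rhoBar M C₂ : ℝ} {T : ℕ}

section Parameters

variable (S : LFSBASetting f g C ell rho nu mu lbar kappa lam x₀ Δ m ε rhoBar M C₂ T)
include S

lemma kappa_pos : 0 < kappa := by linarith [S.one_le_kappa]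

lemma rhoBar_pos : 0 < rhoBar := by
  have := S.lbar_pos
  have := S.kappa_pos
  exact lt_of_lt_of_le (by positivity) S.rhoBar_ge

lemma m_cast : (1 : ℝ) ≤ m := by exact_mod_cast S.one_le_m

lemma M_pos : 0 < M := by
  have := S.rhoBar_pos
  have := S.m_cast
  exact lt_of_lt_of_le (by positivity) S.M_ge

lemma lam_pos : 0 < lam := by linarith [S.two_le_lam]

lemma M_ge' : 1000 * rhoBar ≤ M := by
  refine le_trans ?_ S.M_ge
  have := S.rhoBar_pos
  nlinarith [S.m_cast]

lemma hess_lip (x x' : Vec dx) :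
    ‖hess (penaltyStar f g lam) x - hess (penaltyStar f g lam) x'‖ ≤ rhoBar * ‖x - x'‖ := by
  refine (S.hess_penaltyStar_lip x x').trans ?_
  have := S.rhoBar_ge
  have := S.lbar_pos
  have := S.kappa_pos
  have : 0 < lbar * kappa ^ 5 := by positivity
  gcongr
  linarith

/-- Each entry of the maximum defining `lam` has one purpose: this one controls the proxy gap, the
next two the gradient and Hessian errors of the proxy. -/
lemma lam_ge_gap : lbar * kappa ^ 2 ≤ lam * Δ := by
  have h : lbar * kappa ^ 2 / Δ ≤ lam := by rw [S.lam_eq]; exact le_max_left _ _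
  rwa [div_le_iff₀ S.gap_pos] at h

lemma lam_ge_eps : lbar * kappa ^ 3 / lam ≤ ε := by
  have h : lbar * kappa ^ 3 / ε ≤ lam := by
    rw [S.lam_eq]; exact (le_max_left _ _).trans (le_max_right _ _)
  rw [div_le_iff₀ S.eps_pos] at h
  rw [div_le_iff₀ S.lam_pos]; linarith

lemma lam_ge_sqrt : lbar * kappa ^ 5 / lam ≤ √(M * ε) := by
  have h : lbar * kappa ^ 5 / √(M * ε) ≤ lam := by
    rw [S.lam_eq]; exact (le_max_right _ _).trans (le_max_right _ _)
  have := S.M_pos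
  have := S.eps_pos
  rw [div_le_iff₀ (by positivity)] at h
  rw [div_le_iff₀ S.lam_pos]; linarith

/-- The proxy lies below the hyper-objective by at most `lbar * kappa / lam ≤ Δ`. -/
lemma proxy_gap (x : Vec dx) : penaltyStar f g lam x₀ - penaltyStar f g lam x ≤ 2 * Δ := by
  have h1 := S.penaltyStar_le x₀
  have h2 := S.hyperObj_le x
  have h3 : ⨅ x, hyperObj f g x ≤ hyperObj f g x := ciInf_le S.asm.bdd_below x
  have h4 := S.gap_eq
  have h5 : lbar * kappa / lam ≤ Δ := by
    rw [div_le_iff₀ S.lam_pos]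
    have : lbar * kappa ≤ lbar * kappa ^ 2 :=
      mul_le_mul_of_nonneg_left (le_self_pow₀ S.one_le_kappa (by norm_num)) S.lbar_pos.le
    linarith [S.lam_ge_gap]
  rw [gap] at h4
  linarith

/-- The tolerance of the inner loops. -/
lemma tol_pos : 0 < innerTol lbar lam ε M C₂ := by
  have := S.eps_pos
  have := S.lam_pos
  have := S.lbar_pos
  have := S.M_pos
  have := S.C₂_pos
  exact lt_min (by positivity) (by positivity)

lemma tol_le_grad : 4 * lam * lbar * innerTol lbar lam ε M C₂ ≤ ε / 576 := by
  have h : innerTol lbar lam ε M C₂ ≤ (1 / 576) * ε / (4 * lam * lbar) := min_le_left _ _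
  have := S.lam_pos
  have := S.lbar_pos
  rw [le_div_iff₀ (by positivity)] at h
  linarith

lemma tol_le_hess : 2 * C₂ * innerTol lbar lam ε M C₂ ≤ √(M * ε) / 288 := by
  have h : innerTol lbar lam ε M C₂ ≤ (1 / 288) * √(M * ε) / (2 * C₂) := min_le_right _ _
  have := S.C₂_pos
  rw [le_div_iff₀ (by positivity)] at h
  linarith

end Parameters

/-! ### Accuracy, termination and stationarity of a run -/

section Run

variable (S : LFSBASetting f g C ell rho nu mu lbar kappa lam x₀ Δ m ε rhoBar M C₂ T)
  (r : LFSBARun f g (lfsbaInput f g x₀ ell lbar kappa lam rhoBar m ε M C₂ T))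
include S

/-- Index shift: `state (t + 1)` holds `w_t`, `y_t` and `s_t`, which belong to the iterate `(state
t).x`, next to the new iterate `x_{t+1}`. -/
lemma state_w {t : ℕ} (ht : t < r.iters) : (r.state (t + 1)).w =
    nextW g (lfsbaInput f g x₀ ell lbar kappa lam rhoBar m ε M C₂ T) t (r.state t) := by
  rw [← lfsbaOracles_w f]
  have h := congrArg LFSBAState.w (r.update t ht)
  exact h

lemma state_y {t : ℕ} (ht : t < r.iters) : (r.state (t + 1)).y =
    nextY f g (lfsbaInput f g x₀ ell lbar kappa lam rhoBar m ε M C₂ T) t (r.state t) := by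
  rw [← lfsbaOracles_y]
  have h := congrArg LFSBAState.y (r.update t ht)
  exact h

lemma state_x {t : ℕ} (ht : t < r.iters) :
    (r.state (t + 1)).x = (r.state t).x + (r.state (t + 1)).s :=
  congrArg LFSBAState.x (r.update t ht)

lemma state_H {t : ℕ} (ht : t < r.iters) : (r.state (t + 1)).H =
    (lfsbaOracles f g (lfsbaInput f g x₀ ell lbar kappa lam rhoBar m ε M C₂ T) t
      (r.state t)).val.2.H := by
  have h := congrArg LFSBAState.H (r.update t ht)
  exact h

/-- The estimates `y_t`, `w_t` are accurate up to the tolerance of the inner loops. -/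
lemma inner_accuracy (t : ℕ) (ht : t < r.iters) :
    ‖(r.state (t + 1)).w - yStar g (r.state t).x‖ ≤ innerTol lbar lam ε M C₂ ∧
      ‖(r.state (t + 1)).y - yStarPen f g lam (r.state t).x‖ ≤ innerTol lbar lam ε M C₂ := by
  induction t with
  | zero =>
    rw [S.state_w r ht, S.state_y r ht]
    have hi := r.init
    have hx : (r.state 0).x = x₀ := by rw [hi]; rfl
    -- The loops start from zero, within `initRadius` of both minimizers. `Nat.le_ceil` also covers
    -- negative lengths, rounded up to `0`.
    constructor
    · refine S.agd_lower_accuracy _ (a := initRadius f g lam x₀) S.tol_pos ?_ (Nat.le_ceil _)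
      rw [hx, hi]
      simp [initRadius]
    · refine S.agd_upper_accuracy _ (a := initRadius f g lam x₀) S.tol_pos ?_ (Nat.le_ceil _)
      rw [hx, hi]
      simp [initRadius]
  | succ t ih =>
    obtain ⟨h1, h2⟩ := ih (by omega)
    have hs := S.state_x r (t := t) (by omega)
    have hd : ‖(r.state t).x - (r.state (t + 1)).x‖ = ‖(r.state (t + 1)).s‖ := by
      rw [hs, sub_add_cancel_left, norm_neg]
    rw [S.state_w r ht, S.state_y r ht]
    -- Warm start: previous error plus drift of the minimizer.
    constructor
    · refine S.agd_lower_accuracy _ (a := innerTol lbar lam ε M C₂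
        + 4 * kappa * ‖(r.state (t + 1)).s‖) S.tol_pos ?_ (Nat.le_ceil _)
      have h3 := S.yStar_lip (r.state t).x (r.state (t + 1)).x
      rw [hd] at h3
      exact (norm_sub_le_norm_sub_add_norm_sub _ _ _).trans (add_le_add h1 h3)
    · refine S.agd_upper_accuracy _ (a := innerTol lbar lam ε M C₂
        + 4 * kappa * ‖(r.state (t + 1)).s‖) S.tol_pos ?_ (Nat.le_ceil _)
      have h3 := S.yStarPen_lip (r.state t).x (r.state (t + 1)).x
      rw [hd] at h3
      exact (norm_sub_le_norm_sub_add_norm_sub _ _ _).trans (add_le_add h2 h3)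

/-- The gradient estimate of iteration `t`. -/
def runGrad (t : ℕ) : Vec dx :=
  (lfsbaOracles f g (lfsbaInput f g x₀ ell lbar kappa lam rhoBar m ε M C₂ T) t
    (r.state t)).val.1

lemma runGrad_error {t : ℕ} (ht : t < r.iters) :
    ‖runGrad r t - gradient (penaltyStar f g lam) (r.state t).x‖ ≤ ε / 576 := by
  obtain ⟨h1, h2⟩ := S.inner_accuracy r t ht
  have e : runGrad r t =
      (gradEst f g lam (r.state t).x (r.state (t + 1)).y (r.state (t + 1)).w).val := by
    rw [S.state_w r ht, S.state_y r ht]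
    exact lfsbaOracles_grad f g _ t _
  rw [e]
  refine (S.gradEst_error _ _ _).trans (le_trans ?_ S.tol_le_grad)
  have hl := S.two_le_lam
  have hell := S.ell_pos
  have htol := S.tol_pos
  calc _ ≤ (1 + lam) * ell * innerTol lbar lam ε M C₂ + lam * ell * innerTol lbar lam ε M C₂ := by
        gcongr
    _ = ((1 + 2 * lam) * ell) * innerTol lbar lam ε M C₂ := by ring
    _ ≤ (4 * lam * lbar) * innerTol lbar lam ε M C₂ := by
        refine mul_le_mul_of_nonneg_right ?_ htol.le
        exact mul_le_mul (by linarith) S.ell_le hell.le (by linarith)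

/-- The snapshot and the Hessian estimate in use at iteration `t` come from iteration
`m ⌊t / m⌋`. -/
lemma snapshot (t : ℕ) (ht : t < r.iters) :
    (r.state (t + 1)).snap = (r.state (m * (t / m))).x ∧
      (r.state (t + 1)).H = (hessEst f g lam (r.state (m * (t / m))).x
        (r.state (m * (t / m) + 1)).y (r.state (m * (t / m) + 1)).w).val := by
  have hm := S.one_le_m
  have hsnap : (r.state (t + 1)).snap = if t % m = 0 then (r.state t).x else (r.state t).snap := by
    have := lfsbaOracles_snap f g (lfsbaInput f g x₀ ell lbar kappa lam rhoBar m ε M C₂ T) t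
      (r.state t)
    exact (congrArg LFSBAState.snap (r.update t ht)).trans this
  have hH : (r.state (t + 1)).H = if t % m = 0 then (hessEst f g lam (r.state t).x
      (r.state (t + 1)).y (r.state (t + 1)).w).val else (r.state t).H := by
    rw [S.state_w r ht, S.state_y r ht, S.state_H r ht]
    exact lfsbaOracles_H f g _ t (r.state t)
  have hdiv := Nat.div_add_mod t m
  by_cases h0 : t % m = 0
  · have e : m * (t / m) = t := by omega
    rw [e, hsnap, hH, if_pos h0, if_pos h0]
    exact ⟨rfl, rfl⟩
  · rw [hsnap, hH, if_neg h0, if_neg h0]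
    cases t with
    | zero => simp at h0
    | succ t =>
      have ih := snapshot t (by omega)
      have e : (t + 1) / m = t / m := by
        rw [Nat.succ_div, if_neg (fun h => h0 (Nat.mod_eq_zero_of_dvd h)), add_zero]
      rw [e]
      exact ih

lemma runHess_symm {t : ℕ} (ht : t < r.iters) (u v : Vec dx) :
    inner ℝ ((r.state (t + 1)).H u) v = inner ℝ u ((r.state (t + 1)).H v) := by
  rw [(S.snapshot r t ht).2]
  exact S.hessEst_symm _ _ _ u v

/-- The error is measured at the snapshot, where the inner solutions were accurate; the drift since
then is accounted for in `lazy_cubic_descent`. -/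
lemma runHess_error {t : ℕ} (ht : t < r.iters) :
    ‖(r.state (t + 1)).H - hess (penaltyStar f g lam) (r.state (m * (t / m))).x‖ ≤
      √(M * ε) / 288 := by
  rw [(S.snapshot r t ht).2]
  obtain ⟨h1, h2⟩ := S.inner_accuracy r (m * (t / m)) ((Nat.mul_div_le t m).trans_lt ht)
  refine (S.hessEst_error _ _ _).trans (le_trans ?_ S.tol_le_hess)
  have := S.C₂_pos
  calc _ ≤ C₂ * (innerTol lbar lam ε M C₂ + innerTol lbar lam ε M C₂) := by
        gcongr
        exact S.C₂_ge
    _ = _ := by ring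

lemma runModel_min {t : ℕ} (ht : t < r.iters) (v : Vec dx) :
    cubicModel (runGrad r t) (r.state (t + 1)).H M (r.state (t + 1)).s ≤
      cubicModel (runGrad r t) (r.state (t + 1)).H M v := by
  rw [S.state_H r ht]
  exact r.minimizes t ht v

/-- Failure of the stopping test at every iteration before `n` bounds `n` and the steps. -/
lemma descent {n : ℕ} (hn : n ≤ r.iters)
    (htest : ∀ t < n, ¬ lfsbaStop (lfsbaInput f g x₀ ell lbar kappa lam rhoBar m ε M C₂ T)
      (r.state (t + 1)).s (r.state (t + 1)).snap (r.state t).x) :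
    n * √(M * ε) ^ 3 ≤ 36 * M ^ 2 * Δ ∧
      M * ∑ t ∈ Finset.range n, ‖(r.state (t + 1)).s‖ ^ 3 ≤ 12 * Δ := by
  have h := lazy_cubic_descent (n := n) (x := fun t => (r.state t).x)
    (s := fun t => (r.state (t + 1)).s) (g := runGrad r) (H := fun t => (r.state (t + 1)).H)
    S.contDiff_penaltyStar S.rhoBar_pos.le S.hess_lip S.one_le_m S.M_pos S.M_ge S.eps_pos
    (fun t ht => S.state_x r (by omega)) (fun t ht => S.runHess_symm r (by omega))
    (fun t ht => S.runModel_min r (by omega)) (fun t ht => S.runGrad_error r (by omega))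
    (fun t ht => S.runHess_error r (by omega)) (fun t ht => by
      rw [← (S.snapshot r t (by omega)).1]; exact htest t ht)
  have h0 : (r.state 0).x = x₀ := by rw [r.init]; rfl
  have hgap := S.proxy_gap (r.state n).x
  rw [h0] at h
  have hM := S.M_pos
  refine ⟨h.1.trans ?_, by linarith [h.2]⟩
  calc _ ≤ 18 * M ^ 2 * (2 * Δ) := by gcongr
    _ = _ := by ring

/-- Every run ends with an iteration that passes the stopping test. -/
lemma exists_passed_test : ∃ t, t + 1 = r.iters ∧
    lfsbaStop (lfsbaInput f g x₀ ell lbar kappa lam rhoBar m ε M C₂ T)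
      (r.state (t + 1)).s (r.state (t + 1)).snap (r.state t).x := by
  by_contra hcon
  -- If no final test passes, the run exhausts its budget and every test fails: earlier ones by
  -- `not_stopped`, the last by `hcon`.
  have hT : r.iters = T := r.finished.resolve_right hcon
  have h := (S.descent r le_rfl (fun t ht hs => by
    rcases Nat.lt_or_ge (t + 1) r.iters with h | h
    · exact r.not_stopped t h hs
    · exact hcon ⟨t, by omega, hs⟩)).1
  rw [hT] at h
  have hε := S.eps_pos
  have hM := S.M_pos
  have hΔ := S.gap_pos
  have h2 := S.T_ge
  rw [rpow_neg_three_halves hε] at h2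
  have h3 : 1000 * (Δ * √M * (√ε ^ 3)⁻¹) * √(M * ε) ^ 3 ≤ 36 * M ^ 2 * Δ :=
    le_trans (mul_le_mul_of_nonneg_right h2 (by positivity)) h
  -- The powers of `ε` cancel and `√M` to the fourth power is `M ^ 2`, so a full budget would give
  -- `1000 ≤ 36`.
  have h4 : 1000 * (Δ * √M * (√ε ^ 3)⁻¹) * √(M * ε) ^ 3 = 1000 * M ^ 2 * Δ := by
    have e1 : √M ^ 2 = M := Real.sq_sqrt hM.le
    have e2 : √ε ^ 3 ≠ 0 := by positivity
    rw [Real.sqrt_mul hM.le, mul_pow]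
    calc _ = 1000 * Δ * (√M ^ 2) ^ 2 * ((√ε ^ 3)⁻¹ * √ε ^ 3) := by ring
      _ = _ := by rw [e1, inv_mul_cancel₀ e2]; ring
  rw [h4] at h3
  have : 0 < M ^ 2 * Δ := by positivity
  linarith

/-- The final step is excluded because its test passes; it never determines an inner length. -/
lemma step_bound {t : ℕ} (ht : t + 1 < r.iters) : M * ‖(r.state (t + 1)).s‖ ^ 3 ≤ 12 * Δ := by
  have h := (S.descent r (n := t + 1) ht.le (fun k hk => r.not_stopped k (by omega))).2
  refine le_trans (mul_le_mul_of_nonneg_left ?_ S.M_pos.le) h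
  exact Finset.single_le_sum (f := fun t => ‖(r.state (t + 1)).s‖ ^ 3)
    (fun _ _ => by positivity) (Finset.mem_range.2 (Nat.lt_succ_self t))

/-- Stationarity of the proxy plus the transfer errors: `4 + 4 = 8` and `2 + 48 = 50`. -/
lemma output_stationary :
    IsSOSP (hyperObj f g) (8 * ε) (50 * √(M * ε)) r.output := by
  obtain ⟨t, ht, hs⟩ := S.exists_passed_test r
  have ht' : t < r.iters := by omega
  have h := cubic_step_stationary S.contDiff_penaltyStar S.rhoBar_pos.le S.hess_lip S.M_pos
    S.M_ge' S.eps_pos (S.runHess_symm r ht') (S.runModel_min r ht') (S.runGrad_error r ht')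
    (S.runHess_error r ht') (by rw [← (S.snapshot r t ht').1]; exact hs)
  have hout : r.output = (r.state t).x + (r.state (t + 1)).s := by
    rw [← S.state_x r ht', LFSBARun.output, ht]
  rw [← hout] at h
  have hsys := S.system
  refine ⟨?_, ?_, fun v => ?_⟩
  · rw [BilevelSetting.hyperObj_eq]; exact hsys.contDiff_hyper.contDiffAt
  · have h1 := hsys.gradient_proxy_sub_hyper r.output
    rw [← BilevelSetting.hyperObj_eq, ← BilevelSetting.penaltyStar_eq] at h1
    have h2 : ‖gradient (hyperObj f g) r.output‖ ≤ ‖gradient (penaltyStar f g lam) r.output‖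
        + ‖gradient (penaltyStar f g lam) r.output - gradient (hyperObj f g) r.output‖ := by
      have := norm_sub_le (gradient (penaltyStar f g lam) r.output)
        (gradient (penaltyStar f g lam) r.output - gradient (hyperObj f g) r.output)
      rwa [sub_sub_cancel] at this
    linarith [h.1, S.lam_ge_eps]
  · have h1 := (abs_le.1 (hsys.hess_proxy_sub_hyper r.output v)).2
    rw [← BilevelSetting.hyperObj_eq, ← BilevelSetting.penaltyStar_eq] at h1
    have h2 := h.2 v
    have h3 := mul_le_mul_of_nonneg_right S.lam_ge_sqrt (sq_nonneg ‖v‖)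
    linarith

end Run

end LFSBASetting

/-! ### Auxiliary counting and logarithm bounds -/

lemma card_filter_mod_eq_zero_le (m n : ℕ) :
    ((((Finset.range n).filter fun t => t % m = 0).card : ℕ) : ℝ) ≤ 1 + n / m := by
  have hsub : ((Finset.range n).filter fun t => t % m = 0) ⊆
      (Finset.range (n / m + 1)).image fun k => m * k := by
    intro t ht
    obtain ⟨h1, h2⟩ := Finset.mem_filter.1 ht
    rw [Finset.mem_range] at h1
    refine Finset.mem_image.2 ⟨t / m, ?_, ?_⟩
    · exact Finset.mem_range.2 (Nat.lt_succ_of_le (Nat.div_le_div_right h1.le))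
    · have := Nat.div_add_mod t m
      omega
  have h := (Finset.card_le_card hsub).trans Finset.card_image_le
  rw [Finset.card_range] at h
  have h' : (n / m : ℕ) ≤ (n : ℝ) / m := Nat.cast_div_le
  have : ((((Finset.range n).filter fun t => t % m = 0).card : ℕ) : ℝ) ≤ ((n / m + 1 : ℕ) : ℝ) := by
    exact_mod_cast h
  push_cast at this
  linarith

lemma IsSOSP.mono {E : Type} [NormedAddCommGroup E] [InnerProductSpace ℝ E] [CompleteSpace E]
    {h : E → ℝ} {ε ε' τ τ' : ℝ} {p : E} (hp : IsSOSP h ε τ p) (hε : ε ≤ ε') (hτ : τ ≤ τ') :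
    IsSOSP h ε' τ' p := by
  refine ⟨hp.1, hp.2.1.trans hε, fun v => le_trans ?_ (hp.2.2 v)⟩
  have := mul_le_mul_of_nonneg_right hτ (sq_nonneg ‖v‖)
  linarith

/-- A logarithm of a polynomially bounded quantity is at most a multiple of `log Z`. -/
lemma log_le_mul_log_of_le_pow {a b Z : ℝ} {n : ℕ} (ha : 0 ≤ a) (hb : 1 ≤ b) (hZ : 2 ≤ Z)
    (h : a ≤ b * Z ^ n) : Real.log a ≤ (2 * b + n) * Real.log Z := by
  have hlog : 1 / 2 ≤ Real.log Z :=
    le_trans (by linarith [Real.log_two_gt_d9]) (Real.log_le_log two_pos hZ)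
  have hb' := Real.log_le_self (x := b) (by linarith)
  have key : Real.log (b * Z ^ n) ≤ (2 * b + n) * Real.log Z := by
    rw [Real.log_mul (by linarith) (by positivity), Real.log_pow]
    nlinarith
  rcases ha.eq_or_lt with rfl | ha
  · rw [Real.log_zero]; positivity
  · exact (Real.log_le_log ha h).trans key

/-- The assumptions on a run of LFSBA together with the upper bounds on the parameters. -/
structure LFSBAScaling {dx dy : ℕ} (f g : Vec dx → Vec dy → ℝ)
    (C ell rho nu mu lbar kappa lam : ℝ) (x₀ : Vec dx) (Δ : ℝ) (m : ℕ) (ε rhoBar M C₂ : ℝ)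
    (T : ℕ) (B : ℝ) : Prop
    extends LFSBASetting f g C ell rho nu mu lbar kappa lam x₀ Δ m ε rhoBar M C₂ T where
  one_le_B : 1 ≤ B
  rhoBar_le : rhoBar ≤ B * (lbar * kappa ^ 5)
  M_le : M ≤ B * (m * rhoBar)
  C₂_le : C₂ ≤ B * (lam * lbar * kappa ^ 2)
  T_le : T ≤ B * (Δ * √M * ε ^ (-(3 / 2) : ℝ))

/-! ### Complexity bounds -/

namespace LFSBAScaling

variable {dx dy : ℕ} {f g : Vec dx → Vec dy → ℝ} {C ell rho nu mu lbar kappa lam : ℝ}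
  {x₀ : Vec dx} {Δ : ℝ} {m : ℕ} {ε rhoBar M C₂ : ℝ} {T : ℕ} {B : ℝ}
  (S : LFSBAScaling f g C ell rho nu mu lbar kappa lam x₀ Δ m ε rhoBar M C₂ T B)
include S

lemma sqrt_M_le : √M ≤ B * (kappa ^ (5 / 2 : ℝ) * lbar ^ (1 / 2 : ℝ) * √m) := by
  have hκ := S.kappa_pos
  have hl := S.lbar_pos
  have hm := S.m_cast
  have hB := S.one_le_B
  have e1 : (kappa ^ (5 / 2 : ℝ)) ^ 2 = kappa ^ 5 := by
    rw [← Real.rpow_natCast, ← Real.rpow_mul hκ.le, ← Real.rpow_natCast]; norm_num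
  have e2 : (lbar ^ (1 / 2 : ℝ)) ^ 2 = lbar := by
    rw [← Real.sqrt_eq_rpow, Real.sq_sqrt hl.le]
  refine Real.sqrt_le_iff.2 ⟨by positivity, ?_⟩
  rw [mul_pow, mul_pow, mul_pow, e1, e2, Real.sq_sqrt (by positivity)]
  calc M ≤ B * (m * rhoBar) := S.M_le
    _ ≤ B * (m * (B * (lbar * kappa ^ 5))) := by gcongr; exact S.rhoBar_le
    _ = _ := by ring

/-- The number of iterations is at most `O(Δ κ^{5/2} ℓ̄^{1/2} m^{1/2} ε^{-3/2})`. -/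
lemma T_le' : (T : ℝ) ≤
    B ^ 2 * (Δ * kappa ^ (5 / 2 : ℝ) * lbar ^ (1 / 2 : ℝ) * ε ^ (-(3 / 2) : ℝ) * √m) := by
  have hΔ := S.gap_pos
  have hε := S.eps_pos
  have hB := S.one_le_B
  calc (T : ℝ) ≤ B * (Δ * √M * ε ^ (-(3 / 2) : ℝ)) := S.T_le
    _ ≤ B * (Δ * (B * (kappa ^ (5 / 2 : ℝ) * lbar ^ (1 / 2 : ℝ) * √m)) * ε ^ (-(3 / 2) : ℝ)) := by
        gcongr; exact S.sqrt_M_le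
    _ = _ := by ring

/-- Inside the logarithms `M` is needed only from below, which is why `m` does not appear in
`logFactor`. -/
lemma M_ge_lbar : 1000 * lbar ≤ M := by
  have h1 := S.M_ge'
  have h2 := S.rhoBar_ge
  have h3 : lbar * 1 ≤ lbar * kappa ^ 5 :=
    mul_le_mul_of_nonneg_left (one_le_pow₀ S.one_le_kappa) S.lbar_pos.le
  linarith [S.lbar_pos]

/-- The argument of the logarithmic factor dominates every parameter. -/
lemma parameter_bounds {Z : ℝ}
    (hZ : Z = 2 + kappa + lbar + 1 / lbar + Δ + 1 / Δ + 1 / ε + initRadius f g lam x₀) :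
    2 ≤ Z ∧ kappa ≤ Z ∧ lbar ≤ Z ∧ 1 / lbar ≤ Z ∧ Δ ≤ Z ∧ 1 / Δ ≤ Z ∧ 1 / ε ≤ Z ∧
      initRadius f g lam x₀ ≤ Z := by
  have h1 := S.kappa_pos
  have h2 := S.lbar_pos
  have h3 := one_div_pos.2 h2
  have h4 := S.gap_pos
  have h5 := one_div_pos.2 h4
  have h6 := one_div_pos.2 S.eps_pos
  have h7 : 0 ≤ initRadius f g lam x₀ := (norm_nonneg _).trans (le_max_left _ _)
  refine ⟨?_, ?_, ?_, ?_, ?_, ?_, ?_, ?_⟩ <;> linarith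

/-! ### Polynomial bounds inside the logarithms -/

section Polynomial

variable {Z : ℝ}
  (hZ : Z = 2 + kappa + lbar + 1 / lbar + Δ + 1 / Δ + 1 / ε + initRadius f g lam x₀)
include hZ

lemma one_div_sqrt_le : 1 / √(M * ε) ≤ Z := by
  obtain ⟨h2, hκ, hl, hl', hΔ, hΔ', hε', -⟩ := S.parameter_bounds hZ
  have hlp := S.lbar_pos
  have hεp := S.eps_pos
  have hM := S.M_ge_lbar
  rw [one_div, ← Real.sqrt_inv]
  refine Real.sqrt_le_iff.2 ⟨by linarith, ?_⟩
  calc (M * ε)⁻¹ ≤ (lbar * ε)⁻¹ := by gcongr; linarith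
    _ = (1 / lbar) * (1 / ε) := by rw [mul_inv, one_div, one_div]
    _ ≤ Z * Z := by gcongr
    _ = Z ^ 2 := by ring

lemma lam_le_pow : lam ≤ Z ^ 7 := by
  obtain ⟨h2, hκ, hl, hl', hΔ, hΔ', hε', -⟩ := S.parameter_bounds hZ
  have hlp := S.lbar_pos
  have hεp := S.eps_pos
  have hκp := S.kappa_pos
  have hΔp := S.gap_pos
  have hs := S.one_div_sqrt_le hZ
  have h1 : 1 ≤ Z := by linarith
  rw [S.lam_eq]
  refine max_le ?_ (max_le ?_ ?_)
  · calc lbar * kappa ^ 2 / Δ = lbar * kappa ^ 2 * (1 / Δ) := by ring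
      _ ≤ Z * Z ^ 2 * Z := by gcongr
      _ = Z ^ 4 := by ring
      _ ≤ Z ^ 7 := pow_le_pow_right₀ h1 (by norm_num)
  · calc lbar * kappa ^ 3 / ε = lbar * kappa ^ 3 * (1 / ε) := by ring
      _ ≤ Z * Z ^ 3 * Z := by gcongr
      _ = Z ^ 5 := by ring
      _ ≤ Z ^ 7 := pow_le_pow_right₀ h1 (by norm_num)
  · calc lbar * kappa ^ 5 / √(M * ε) = lbar * kappa ^ 5 * (1 / √(M * ε)) := by ring
      _ ≤ Z * Z ^ 5 * Z := by gcongr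
      _ = Z ^ 7 := by ring

lemma one_div_tol_le : 1 / innerTol lbar lam ε M C₂ ≤ 2304 * B * Z ^ 11 := by
  obtain ⟨h2, hκ, hl, hl', hΔ, hΔ', hε', -⟩ := S.parameter_bounds hZ
  have hlp := S.lbar_pos
  have hεp := S.eps_pos
  have hκp := S.kappa_pos
  have hlamp := S.lam_pos
  have hlam := S.lam_le_pow hZ
  have hs := S.one_div_sqrt_le hZ
  have hB := S.one_le_B
  have hM := S.M_pos
  have hC := S.C₂_pos
  have h1 : 1 ≤ Z := by linarith
  have hsp : 0 < √(M * ε) := by positivity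
  rw [innerTol]
  rcases min_choice ((1 / 576) * ε / (4 * lam * lbar)) ((1 / 288) * √(M * ε) / (2 * C₂))
    with h | h <;> rw [h]
  · calc 1 / ((1 / 576) * ε / (4 * lam * lbar)) = 2304 * 1 * (lam * lbar * (1 / ε)) := by
          field_simp; norm_num
      _ ≤ 2304 * B * (Z ^ 7 * Z * Z) := by gcongr
      _ = 2304 * B * Z ^ 9 := by ring
      _ ≤ 2304 * B * Z ^ 11 := by gcongr; norm_num
  · calc 1 / ((1 / 288) * √(M * ε) / (2 * C₂)) = 576 * (C₂ * (1 / √(M * ε))) := by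
          field_simp; norm_num
      _ ≤ 2304 * (B * (Z ^ 7 * Z * Z ^ 2) * Z) := by
          gcongr
          · norm_num
          · exact S.C₂_le.trans (by gcongr)
      _ = 2304 * B * Z ^ 11 := by ring

lemma sqrt_kappa_le : √(3 * kappa + 1) ≤ 4 * Z := by
  obtain ⟨h2, hκ, -⟩ := S.parameter_bounds hZ
  refine Real.sqrt_le_iff.2 ⟨by linarith, ?_⟩
  nlinarith

lemma initial_log_arg_le : √(3 * kappa + 1) / innerTol lbar lam ε M C₂ * initRadius f g lam x₀ ≤
    40000 * B * Z ^ 14 := by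
  obtain ⟨h2, -, -, -, -, -, -, hR⟩ := S.parameter_bounds hZ
  have hB := S.one_le_B
  have htol := S.tol_pos
  calc _ = √(3 * kappa + 1) * (1 / innerTol lbar lam ε M C₂) * initRadius f g lam x₀ := by ring
    _ ≤ 4 * Z * (2304 * B * Z ^ 11) * Z := by
        gcongr
        · exact (norm_nonneg _).trans (le_max_left _ _)
        · exact S.sqrt_kappa_le hZ
        · exact S.one_div_tol_le hZ
    _ = 9216 * B * Z ^ 13 := by ring
    _ ≤ 40000 * B * Z ^ 14 := by gcongr <;> linarith

/-- The step bound and `M ≥ 1000 * lbar` give `‖s‖ ^ 3 ≤ Δ / lbar`, so the warm-start radius stays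
polynomial in `Z`. -/
lemma step_log_arg_le {s : Vec dx} (hs : M * ‖s‖ ^ 3 ≤ 12 * Δ) :
    √(3 * kappa + 1) / innerTol lbar lam ε M C₂ *
      (innerTol lbar lam ε M C₂ + 4 * kappa * ‖s‖) ≤ 40000 * B * Z ^ 14 := by
  obtain ⟨h2, hκ, -, hl', hΔ, -, -, -⟩ := S.parameter_bounds hZ
  have hB := S.one_le_B
  have htol := S.tol_pos
  have hκp := S.kappa_pos
  have hlp := S.lbar_pos
  have h1 : 1 ≤ Z := by linarith
  have hsZ : ‖s‖ ≤ Z := by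
    refine le_of_pow_le_pow_left₀ (n := 3) (by norm_num) (by linarith) ?_
    have h3 : 12 * lbar * ‖s‖ ^ 3 ≤ 12 * Δ := by
      refine le_trans ?_ hs
      gcongr
      linarith [S.M_ge_lbar]
    calc ‖s‖ ^ 3 ≤ Δ * (1 / lbar) := by
          rw [mul_one_div, le_div_iff₀ hlp]; linarith
      _ ≤ Z * Z := by gcongr
      _ = Z ^ 2 := by ring
      _ ≤ Z ^ 3 := pow_le_pow_right₀ h1 (by norm_num)
  have hone : 1 ≤ B * Z ^ 13 := one_le_mul_of_one_le_of_one_le hB (one_le_pow₀ h1)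
  calc _ = √(3 * kappa + 1) * (1 + 4 * kappa * ‖s‖ * (1 / innerTol lbar lam ε M C₂)) := by
        field_simp
    _ ≤ 4 * Z * (1 + 4 * Z * Z * (2304 * B * Z ^ 11)) := by
        gcongr
        · exact S.sqrt_kappa_le hZ
        · exact S.one_div_tol_le hZ
    _ = 4 * Z * (1 + 9216 * (B * Z ^ 13)) := by ring
    _ ≤ 4 * Z * (10000 * (B * Z ^ 13)) := by gcongr; linarith
    _ = 40000 * B * Z ^ 14 := by ring

end Polynomial

lemma half_le_logFactor : 1 / 2 ≤ logFactor lbar kappa Δ ε (initRadius f g lam x₀) := by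
  have h := (S.parameter_bounds rfl).1
  exact le_trans (by linarith [Real.log_two_gt_d9]) (Real.log_le_log two_pos h)

/-- `√κ * log Z ≥ 1 / 2` lets the main term absorb the `+ 1` of the ceiling. -/
lemma ceil_inner_le {a Z : ℝ} (ha : 0 ≤ a) (hZ : 2 ≤ Z) (h : a ≤ 40000 * B * Z ^ 14) :
    ((⌈2 * √(3 * kappa) * Real.log a⌉₊ : ℕ) : ℝ) ≤ 1000000 * B * (√kappa * Real.log Z) := by
  have hB := S.one_le_B
  have hL : 1 / 2 ≤ Real.log Z :=
    le_trans (by linarith [Real.log_two_gt_d9]) (Real.log_le_log two_pos hZ)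
  have hκ1 : 1 ≤ √kappa := Real.one_le_sqrt.2 S.one_le_kappa
  have hlog := log_le_mul_log_of_le_pow ha (by linarith) hZ h
  generalize Real.log Z = L at hL hlog ⊢
  have hL0 : 0 ≤ L := by linarith
  have h3 : √(3 * kappa) ≤ 2 * √kappa := by
    rw [Real.sqrt_mul (by norm_num)]
    gcongr
    exact Real.sqrt_le_iff.2 (by norm_num)
  have hlog' : Real.log a ≤ 100000 * B * L := by
    refine hlog.trans (mul_le_mul_of_nonneg_right ?_ hL0)
    push_cast
    linarith
  have hle : 2 * √(3 * kappa) * Real.log a ≤ 400000 * (B * (√kappa * L)) := by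
    calc 2 * √(3 * kappa) * Real.log a ≤ 2 * √(3 * kappa) * (100000 * B * L) :=
          mul_le_mul_of_nonneg_left hlog' (by positivity)
      _ ≤ 2 * (2 * √kappa) * (100000 * B * L) := by gcongr
      _ = _ := by ring
  have hκL : 1 / 2 ≤ √kappa * L := hL.trans (le_mul_of_one_le_left hL0 hκ1)
  have hBκL : √kappa * L ≤ B * (√kappa * L) := le_mul_of_one_le_left (by linarith) hB
  have h4 := Nat.ceil_le_ceil hle
  have h5 := Nat.ceil_lt_add_one (a := 400000 * (B * (√kappa * L))) (by linarith)
  have h6 := (Nat.cast_le (α := ℝ)).2 h4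
  linarith

variable (r : LFSBARun f g (lfsbaInput f g x₀ ell lbar kappa lam rhoBar m ε M C₂ T))

lemma innerLength_le {t : ℕ} (ht : t < r.iters) :
    (innerLength kappa (3 * kappa) (innerTol lbar lam ε M C₂) (initRadius f g lam x₀) t
      (r.state t).s : ℝ) ≤
      1000000 * B * (√kappa * logFactor lbar kappa Δ ε (initRadius f g lam x₀)) := by
  have htol := S.tol_pos
  have hκ := S.kappa_pos
  cases t with
  | zero =>
    rw [innerLength, if_pos rfl]
    have hR : 0 ≤ initRadius f g lam x₀ := (norm_nonneg _).trans (le_max_left _ _)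
    exact S.ceil_inner_le (by positivity) (S.parameter_bounds rfl).1 (S.initial_log_arg_le rfl)
  | succ t =>
    rw [innerLength, if_neg (Nat.succ_ne_zero t)]
    exact S.ceil_inner_le (by positivity) (S.parameter_bounds rfl).1 (S.step_log_arg_le rfl (S.step_bound r ht))

lemma iters_le : (r.iters : ℝ) ≤ T := by exact_mod_cast r.le_T

lemma firstCalls_le : (r.firstCalls : ℝ) ≤ 4000000 * B ^ 3 *
    (Δ * kappa ^ (5 / 2 : ℝ) * lbar ^ (1 / 2 : ℝ) * ε ^ (-(3 / 2) : ℝ) * √m *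
      (√kappa * logFactor lbar kappa Δ ε (initRadius f g lam x₀))) := by
  have hB := S.one_le_B
  have hL := S.half_le_logFactor
  have hκ1 : 1 ≤ √kappa := Real.one_le_sqrt.2 S.one_le_kappa
  set L := logFactor lbar kappa Δ ε (initRadius f g lam x₀)
  have hL0 : 0 ≤ L := by linarith
  have hκL : 1 / 2 ≤ √kappa * L := hL.trans (le_mul_of_one_le_left hL0 hκ1)
  have hBκL : √kappa * L ≤ B * (√kappa * L) := le_mul_of_one_le_left (by linarith) hB
  have hterm : ∀ t ∈ Finset.range r.iters,
      ((lfsbaOracles f g (lfsbaInput f g x₀ ell lbar kappa lam rhoBar m ε M C₂ T) t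
        (r.state t)).first : ℝ) ≤ 4000000 * B * (√kappa * L) := by
    intro t ht
    have h := S.innerLength_le r (Finset.mem_range.1 ht)
    rw [lfsbaOracles_first]
    push_cast
    change (innerLength kappa (3 * kappa) (innerTol lbar lam ε M C₂) (initRadius f g lam x₀) t
      (r.state t).s : ℝ) + (innerLength kappa (3 * kappa) (innerTol lbar lam ε M C₂)
        (initRadius f g lam x₀) t (r.state t).s : ℝ) * 2 + 3 ≤ _
    linarith
  rw [LFSBARun.firstCalls, Nat.cast_sum]
  refine (Finset.sum_le_card_nsmul _ _ _ hterm).trans ?_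
  rw [Finset.card_range, nsmul_eq_mul]
  calc _ ≤ (B ^ 2 * (Δ * kappa ^ (5 / 2 : ℝ) * lbar ^ (1 / 2 : ℝ) * ε ^ (-(3 / 2) : ℝ) * √m)) *
        (4000000 * B * (√kappa * L)) := by
        gcongr
        exact (S.iters_le r).trans S.T_le'
    _ = _ := by ring

lemma secondCalls_le : (r.secondCalls : ℝ) ≤ 9 * B ^ 2 *
    (1 + Δ * kappa ^ (5 / 2 : ℝ) * lbar ^ (1 / 2 : ℝ) * ε ^ (-(3 / 2) : ℝ) * (√m)⁻¹) := by
  have hB := S.one_le_B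
  have hm := S.m_cast
  have hms : √(m : ℝ) * √m = m := Real.mul_self_sqrt (by positivity)
  have hm0 : (0 : ℝ) < √m := by positivity
  have e : r.secondCalls = ((Finset.range r.iters).filter fun t => t % m = 0).card * 9 := by
    rw [LFSBARun.secondCalls, Finset.sum_congr rfl fun t _ => lfsbaOracles_second f g _ t _,
      ← Finset.sum_filter, Finset.sum_const, smul_eq_mul]
    rfl
  set W := Δ * kappa ^ (5 / 2 : ℝ) * lbar ^ (1 / 2 : ℝ) * ε ^ (-(3 / 2) : ℝ)
  have hT : (r.iters : ℝ) / m ≤ B ^ 2 * (W * (√m)⁻¹) := by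
    rw [div_le_iff₀ (by positivity)]
    have hT' : (T : ℝ) ≤ B ^ 2 * (W * √m) := S.T_le'
    refine ((S.iters_le r).trans hT').trans (le_of_eq ?_)
    calc B ^ 2 * (W * √m) = B ^ 2 * (W * √m) * ((√m)⁻¹ * √m) := by
          rw [inv_mul_cancel₀ hm0.ne', mul_one]
      _ = B ^ 2 * (W * (√m)⁻¹) * (√m * √m) := by ring
      _ = _ := by rw [hms]
  rw [e]
  push_cast
  have h1 := card_filter_mod_eq_zero_le m r.iters
  have hB2 : 1 ≤ B ^ 2 := one_le_pow₀ hB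
  nlinarith

/-! ### Total cost and the balance of `m` -/

section Cost

variable {d N : ℝ} (hd : d = (max dx dy : ℕ)) (hN : 0 ≤ N)
  (hm1 : (m : ℝ) ≤ B * (1 + d / √kappa)) (hm2 : 1 + d / √kappa ≤ B * m)
include hd hN hm1 hm2

/-- Per unit of the common factor `W`, first-order calls cost `√m * √κ` up to the logarithm and
second-order calls `d / √m`. For `m ≈ 1 + d / √κ` both are at most of order `κ^{1/2} + κ^{1/4}
d^{1/2}`. -/
lemma cost_le : r.cost N ≤ 5000000 * B ^ 4 *
    (N * d + N * (kappa ^ (1 / 2 : ℝ) + kappa ^ (1 / 4 : ℝ) * d ^ (1 / 2 : ℝ))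
      * (Δ * kappa ^ (5 / 2 : ℝ) * lbar ^ (1 / 2 : ℝ) * ε ^ (-(3 / 2) : ℝ))
      * logFactor lbar kappa Δ ε (initRadius f g lam x₀)) := by
  have hd0 : 0 ≤ d := by rw [hd]; positivity
  have hB := S.one_le_B
  have hL := S.half_le_logFactor
  have hκp := S.kappa_pos
  have hm := S.m_cast
  have hΔ := S.gap_pos
  have hlp := S.lbar_pos
  have hεp := S.eps_pos
  have h1 := S.firstCalls_le r
  have h2 := S.secondCalls_le r
  have eκ : √kappa = (kappa ^ (1 / 4 : ℝ)) ^ 2 := by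
    rw [← Real.rpow_natCast, ← Real.rpow_mul hκp.le, Real.sqrt_eq_rpow]; norm_num
  rw [LFSBARun.cost, ← hd, ← Real.sqrt_eq_rpow, ← Real.sqrt_eq_rpow]
  have hW0 : 0 ≤ Δ * kappa ^ (5 / 2 : ℝ) * lbar ^ (1 / 2 : ℝ) * ε ^ (-(3 / 2) : ℝ) := by positivity
  set L := logFactor lbar kappa Δ ε (initRadius f g lam x₀)
  set W := Δ * kappa ^ (5 / 2 : ℝ) * lbar ^ (1 / 2 : ℝ) * ε ^ (-(3 / 2) : ℝ)
  have ha0 : 0 < kappa ^ (1 / 4 : ℝ) := by positivity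
  rw [eκ] at hm1 hm2 h1 ⊢
  set a := kappa ^ (1 / 4 : ℝ)
  have hds : √d ^ 2 = d := Real.sq_sqrt hd0
  have hL0 : 0 ≤ L := by linarith
  have hsm : √(m : ℝ) * a ^ 2 ≤ B * (a ^ 2 + a * √d) := by
    have : √(m : ℝ) ≤ B * (1 + √d / a) := by
      refine Real.sqrt_le_iff.2 ⟨by positivity, hm1.trans ?_⟩
      rw [← hds, mul_pow, ← div_pow]
      have hq : 0 ≤ √d / a := by positivity
      rw [Real.sqrt_sq (by positivity)]
      refine mul_le_mul (le_self_pow₀ hB (by norm_num)) ?_ (by positivity) (by positivity)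
      nlinarith
    calc √(m : ℝ) * a ^ 2 ≤ B * (1 + √d / a) * a ^ 2 := by gcongr
      _ = _ := by field_simp
  have hdm : d * (√(m : ℝ))⁻¹ ≤ B * (a * √d) := by
    rw [← div_eq_mul_inv, div_le_iff₀ (by positivity)]
    refine abs_le_of_sq_le_sq' ?_ (by positivity) |>.2
    have h3 : d ≤ B * m * a ^ 2 := by
      rw [← div_le_iff₀ (by positivity)]; linarith
    rw [mul_pow, mul_pow, mul_pow, hds, Real.sq_sqrt (by positivity)]
    calc d ^ 2 = d * d := by ring
      _ ≤ (B * m * a ^ 2) * d := by gcongr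
      _ ≤ (B ^ 2 * m * a ^ 2) * d := by gcongr; exact le_self_pow₀ hB (by norm_num)
      _ = _ := by ring
  have c1 : N * r.firstCalls ≤ 4000000 * B ^ 4 * (N * (a ^ 2 + a * √d) * W * L) := by
    calc N * r.firstCalls ≤ N * (4000000 * B ^ 3 * (W * √m * (a ^ 2 * L))) := by gcongr
      _ = N * (4000000 * B ^ 3 * (W * (√m * a ^ 2) * L)) := by ring
      _ ≤ N * (4000000 * B ^ 3 * (W * (B * (a ^ 2 + a * √d)) * L)) := by gcongr
      _ = _ := by ring
  have c2 : N * d * r.secondCalls ≤ 18 * B ^ 4 * (N * d + N * (a ^ 2 + a * √d) * W * L) := by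
    calc N * d * r.secondCalls ≤ N * d * (9 * B ^ 2 * (1 + W * (√m)⁻¹)) := by gcongr
      _ = 9 * B ^ 2 * (N * d + N * (d * (√m)⁻¹) * W) := by ring
      _ ≤ 9 * B ^ 2 * (N * d + N * (B * (a * √d)) * W) := by gcongr
      _ ≤ 9 * B ^ 2 * (B ^ 2 * (2 * (N * d)) + N * (B ^ 2 * (a ^ 2 + a * √d)) * W * (2 * L)) := by
          have hB2 : 1 ≤ B ^ 2 := one_le_pow₀ hB
          have hNd : 0 ≤ N * d := by positivity
          have e1 : N * d ≤ B ^ 2 * (2 * (N * d)) := by nlinarith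
          have e2 : N * (B * (a * √d)) * W ≤ N * (B ^ 2 * (a ^ 2 + a * √d)) * W * (2 * L) := by
            calc N * (B * (a * √d)) * W ≤ N * (B ^ 2 * (a ^ 2 + a * √d)) * W := by
                  gcongr
                  · exact le_self_pow₀ hB (by norm_num)
                  · linarith [sq_nonneg a]
              _ ≤ _ := le_mul_of_one_le_right (by positivity) (by linarith)
          gcongr
      _ = _ := by ring
  have p1 : 0 ≤ B ^ 4 * (N * d) := by positivity
  have p2 : 0 ≤ B ^ 4 * (N * (a ^ 2 + a * √d) * W * L) := by positivity
  linarith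

lemma cost_le' (hdy : 0 < dy) : r.cost N ≤ 10000000 * B ^ 4 *
    (N * d + kappa ^ (1 / 4 : ℝ) / d ^ (1 / 2 : ℝ) * (N * (kappa ^ (1 / 2 : ℝ) + d)
      * (Δ * kappa ^ (5 / 2 : ℝ) * lbar ^ (1 / 2 : ℝ) * ε ^ (-(3 / 2) : ℝ))
      * logFactor lbar kappa Δ ε (initRadius f g lam x₀))) := by
  have hd0 : 0 < d := by
    rw [hd]; exact_mod_cast lt_max_of_lt_right hdy
  have hB := S.one_le_B
  have hL := S.half_le_logFactor
  have hκp := S.kappa_pos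
  have hΔ := S.gap_pos
  have hlp := S.lbar_pos
  have hεp := S.eps_pos
  refine (S.cost_le r hd hN hm1 hm2).trans ?_
  have eκ : kappa ^ (1 / 2 : ℝ) = (kappa ^ (1 / 4 : ℝ)) ^ 2 := by
    rw [← Real.rpow_natCast, ← Real.rpow_mul hκp.le]; norm_num
  rw [← Real.sqrt_eq_rpow d, eκ]
  have hW0 : 0 ≤ Δ * kappa ^ (5 / 2 : ℝ) * lbar ^ (1 / 2 : ℝ) * ε ^ (-(3 / 2) : ℝ) := by positivity
  set L := logFactor lbar kappa Δ ε (initRadius f g lam x₀)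
  set W := Δ * kappa ^ (5 / 2 : ℝ) * lbar ^ (1 / 2 : ℝ) * ε ^ (-(3 / 2) : ℝ)
  have ha0 : 0 < kappa ^ (1 / 4 : ℝ) := by positivity
  set a := kappa ^ (1 / 4 : ℝ)
  have hds : √d ^ 2 = d := Real.sq_sqrt hd0.le
  have hb0 : 0 < √d := by positivity
  have hL0 : 0 ≤ L := by linarith
  -- After multiplication by `√d` and cancellation of `a`, this is `a * √d + d ≤ 2 * (a ^ 2 + d)`.
  have key : a ^ 2 + a * √d ≤ 2 * (a / √d * (a ^ 2 + d)) := by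
    have e : 2 * (a / √d * (a ^ 2 + d)) = (2 * a * (a ^ 2 + √d ^ 2)) / √d := by rw [hds]; ring
    rw [e, le_div_iff₀ hb0]
    have : 0 ≤ a * ((a - √d) ^ 2 + a ^ 2 + a * √d) := by positivity
    nlinarith [sq_nonneg (a - √d), mul_pos ha0 hb0]
  have hNd : 0 ≤ N * d := by positivity
  calc _ ≤ 5000000 * B ^ 4 * (2 * (N * d) + N * (2 * (a / √d * (a ^ 2 + d))) * W * L) := by
        refine mul_le_mul_of_nonneg_left (add_le_add (by linarith) ?_) (by positivity)
        gcongr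
    _ = _ := by ring

end Cost

end LFSBAScaling

end

theorem theorem4p3 :
    -- `c` is an absolute constant; `A` depends only on `B`, which bounds the hidden constants
    ∃ c : ℝ, 0 < c ∧ ∀ B : ℝ, ∃ A : ℝ, 0 < A ∧
    ∀ (dx dy : ℕ), 0 < dy →
    ∀ (f g : Vec dx → Vec dy → ℝ) (C ell rho nu mu : ℝ),
      BilevelAssumption f g C ell rho nu mu →
    ∀ (lbar kappa : ℝ), lbar = ellBar C ell rho nu → kappa = lbar / mu →
    ∀ (x₀ : Vec dx) (Δ : ℝ), Δ = gap f g x₀ → 0 < Δ →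
    ∀ (m : ℕ), 1 ≤ m → ∀ (ε : ℝ), 0 < ε →
    -- `ρ̄ = Θ(ℓ̄ κ⁵)`
    ∀ (rhoBar : ℝ), c * (lbar * kappa ^ 5) ≤ rhoBar → rhoBar ≤ B * (lbar * kappa ^ 5) →
    -- `M = Θ(m ρ̄)`
    ∀ (M : ℝ), c * (m * rhoBar) ≤ M → M ≤ B * (m * rhoBar) →
    ∀ (lam : ℝ), lam = penaltyParam lbar kappa Δ ε M → 2 * ell / mu ≤ lam →
    -- `C₂ = O(λ ℓ̄ κ²)`
    ∀ (C₂ : ℝ), 0 < C₂ → hessErrFactor ell rho mu lam ≤ C₂ →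
      C₂ ≤ B * (lam * lbar * kappa ^ 2) →
    -- `T = Θ(Δ √M ε^{-3/2})`
    ∀ (T : ℕ), c * (Δ * √M * ε ^ (-(3 / 2) : ℝ)) ≤ T → T ≤ B * (Δ * √M * ε ^ (-(3 / 2) : ℝ)) →
    -- `ρ̄` is a Lipschitz constant of the Hessian of `L*_λ`
    (ContDiff ℝ 2 (penaltyStar f g lam) ∧
      ∀ x x' : Vec dx,
        ‖hess (penaltyStar f g lam) x - hess (penaltyStar f g lam) x'‖ ≤ rhoBar * ‖x - x'‖) ∧
    ∀ r : LFSBARun f g (lfsbaInput f g x₀ ell lbar kappa lam rhoBar m ε M C₂ T),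
      IsSOSP (hyperObj f g) (A * ε)
        (A * (kappa ^ (5 / 2 : ℝ) * lbar ^ (1 / 2 : ℝ) * (m : ℝ) ^ (1 / 2 : ℝ)
          * ε ^ (1 / 2 : ℝ))) r.output ∧
      (r.firstCalls : ℝ) ≤
        A * (Δ * kappa ^ 3 * lbar ^ (1 / 2 : ℝ) * (m : ℝ) ^ (1 / 2 : ℝ) * ε ^ (-(3 / 2) : ℝ)
          * logFactor lbar kappa Δ ε (initRadius f g lam x₀)) ∧
      (r.secondCalls : ℝ) ≤
        A * (1 + Δ * kappa ^ (5 / 2 : ℝ) * lbar ^ (1 / 2 : ℝ) * (m : ℝ) ^ (-(1 / 2) : ℝ)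
          * ε ^ (-(3 / 2) : ℝ)) ∧
      -- total cost for `m = Θ(1 + d / √κ)`
      ∀ (d N : ℝ), d = (max dx dy : ℕ) → 0 ≤ N →
        (m : ℝ) ≤ B * (1 + d / √kappa) → 1 + d / √kappa ≤ B * m →
        r.cost N ≤
          A * (N * d + N * (kappa ^ (1 / 2 : ℝ) + kappa ^ (1 / 4 : ℝ) * d ^ (1 / 2 : ℝ))
            * (Δ * kappa ^ (5 / 2 : ℝ) * lbar ^ (1 / 2 : ℝ) * ε ^ (-(3 / 2) : ℝ))
            * logFactor lbar kappa Δ ε (initRadius f g lam x₀)) ∧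
        r.cost N ≤
          A * (N * d + kappa ^ (1 / 4 : ℝ) / d ^ (1 / 2 : ℝ)
            * (N * (kappa ^ (1 / 2 : ℝ) + d)
              * (Δ * kappa ^ (5 / 2 : ℝ) * lbar ^ (1 / 2 : ℝ) * ε ^ (-(3 / 2) : ℝ))
              * logFactor lbar kappa Δ ε (initRadius f g lam x₀))) := by
  -- `B` may be below 1, or negative; `max B 1` makes its fourth power dominate the lower ones. The
  -- coefficient is the largest one needed, that of `cost_le'`.
  refine ⟨1000, by norm_num, fun B => ⟨10000000 * max B 1 ^ 4, by positivity, ?_⟩⟩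
  intro dx dy hdy f g C ell rho nu mu asm lbar kappa hlbar hkappa x₀ Δ hΔ hΔ0 m hm ε hε rhoBar
    hrho1 hrho2 M hM1 hM2 lam hlam hlam2 C₂ hC hC1 hC2 T hT1 hT2
  have hS : LFSBASetting f g C ell rho nu mu lbar kappa lam x₀ Δ m ε rhoBar M C₂ T :=
    { asm := asm, dy_pos := hdy, lbar_eq := hlbar, kappa_eq := hkappa, lam_ge := hlam2
      gap_eq := hΔ, gap_pos := hΔ0, one_le_m := hm, eps_pos := hε, rhoBar_ge := hrho1
      M_ge := hM1, lam_eq := hlam, C₂_pos := hC, C₂_ge := hC1, T_ge := hT1 }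
  have hl := hS.lbar_pos
  have hκ := hS.kappa_pos
  have hρ := hS.rhoBar_pos
  have hlam0 := hS.lam_pos
  have hB' : B ≤ max B 1 := le_max_left _ _
  have S : LFSBAScaling f g C ell rho nu mu lbar kappa lam x₀ Δ m ε rhoBar M C₂ T (max B 1) :=
    { hS with
      one_le_B := le_max_right _ _
      rhoBar_le := hrho2.trans (by gcongr)
      M_le := hM2.trans (by gcongr)
      C₂_le := hC2.trans (by gcongr)
      T_le := hT2.trans (by gcongr) }
  have hB := S.one_le_B
  generalize max B 1 = b at hB hB' S ⊢
  have hb4 : 1 ≤ b ^ 4 := one_le_pow₀ hB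
  have hL := S.half_le_logFactor
  refine ⟨⟨S.contDiff_penaltyStar, S.hess_lip⟩, fun r => ⟨?_, ?_, ?_, ?_⟩⟩
  · refine (S.output_stationary r).mono (by gcongr; linarith) ?_
    have hbb : b ≤ b ^ 4 := le_self_pow₀ hB (by norm_num)
    rw [Real.sqrt_mul S.M_pos.le, ← Real.sqrt_eq_rpow (m : ℝ), ← Real.sqrt_eq_rpow ε]
    calc 50 * (√M * √ε)
        ≤ 50 * (b * (kappa ^ (5 / 2 : ℝ) * lbar ^ (1 / 2 : ℝ) * √m) * √ε) := by
          gcongr; exact S.sqrt_M_le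
      _ = 50 * b * (kappa ^ (5 / 2 : ℝ) * lbar ^ (1 / 2 : ℝ) * √m * √ε) := by ring
      _ ≤ _ := by gcongr; linarith
  · refine (S.firstCalls_le r).trans ?_
    have e : kappa ^ 3 = kappa ^ (5 / 2 : ℝ) * √kappa := by
      rw [Real.sqrt_eq_rpow, ← Real.rpow_add hκ, ← Real.rpow_natCast]; norm_num
    rw [e, ← Real.sqrt_eq_rpow (m : ℝ)]
    have hb : b ^ 3 ≤ b ^ 4 := pow_le_pow_right₀ hB (by norm_num)
    calc _ = 4000000 * b ^ 3 * (Δ * (kappa ^ (5 / 2 : ℝ) * √kappa) * lbar ^ (1 / 2 : ℝ) * √m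
          * ε ^ (-(3 / 2) : ℝ) * logFactor lbar kappa Δ ε (initRadius f g lam x₀)) := by ring
      _ ≤ _ := by gcongr; norm_num
  · refine (S.secondCalls_le r).trans ?_
    have hb : b ^ 2 ≤ b ^ 4 := pow_le_pow_right₀ hB (by norm_num)
    rw [Real.rpow_neg (Nat.cast_nonneg m), ← Real.sqrt_eq_rpow (m : ℝ)]
    calc _ = 9 * b ^ 2 * (1 + Δ * kappa ^ (5 / 2 : ℝ) * lbar ^ (1 / 2 : ℝ) * (√m)⁻¹
          * ε ^ (-(3 / 2) : ℝ)) := by ring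
      _ ≤ _ := by gcongr; norm_num
  · intro d N hd hN hm1 hm2
    have hd0 : 0 ≤ d := by rw [hd]; positivity
    have hm1' : (m : ℝ) ≤ b * (1 + d / √kappa) := hm1.trans (by gcongr)
    have hm2' : 1 + d / √kappa ≤ b * m := hm2.trans (by gcongr)
    refine ⟨(S.cost_le r hd hN hm1' hm2').trans ?_, S.cost_le' r hd hN hm1' hm2' hdy⟩
    gcongr
    norm_num
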